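/- Let $V=\mathbb C^4$ and $\mathbb P^3=\mathbb P V$. A curve $Z\subset\mathbb P^3$ is a (not necessarily closed) one-dimensional complex submanifold, with affine cone $\widehat Z\subset V$; germs $(Z,p)$, $p\in Z$, are considered up to projective equivalence, i.e. up to the action of $GL(4,\mathbb C)$. For $0\ne z\in\widehat Z$ let $T^{(1)}_z\widehat Z=T_z\widehat Z$ be the affine tangent space and let $T^{(k+1)}_z\widehat Z$ be spanned by $T^{(k)}_z\widehat Z$ and the vectors $\delta^{(k+1)}(0)$, $\delta$ a holomorphic curve in $\widehat Z$ with $\delta(0)=z$. The point $p=[z]$ is nondegenerate if $T^{(k)}_z\widehat Z=V$ for some $k\ge1$, and the germ $(Z,p)$ is called osculating if already $T^{(3)}_z\widehat Z=V$. For a symplectic form $\sigma$ on $V$, $Z$ is Legendrian if $\sigma(T_z\widehat Z,T_z\widehat Z)=0$ for all $0\neq z\in\widehat Z$; then $\mathfrak{aut}(Z)=\{u\in\mathfrak{csp}(V,\sigma): u(z)\in T_z\widehat Z\ \forall z\in\widehat Z\}$ (for a germ: $z$ over a neighbourhood of $p$), and a nondegenerate $Z$ is homogeneous if $\dim\mathfrak{aut}(Z)\ge2$.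 For $r\in\mathbb C$ let $\mathbf L_{r^2}$ be the projective equivalence class of the germ at $t=0$ of the curve $t\mapsto[\exp(tA)(1,1,1,1)^\top]$, where $$A=\mathrm{diag}(r,1,-1,-r)\ (r^2\ne0,1),\qquad A=\begin{pmatrix}1&1&0&0\\0&1&0&0\\0&0&-1&1\\0&0&0&-1\end{pmatrix}\ (r^2=1),\qquad A=\begin{pmatrix}1&0&0&0\\0&0&1&0\\0&0&0&0\\0&0&0&-1\end{pmatrix}\ (r=0).$$ **Theorem 2.10.** 1. Every $\mathbf L_{r^2}$ consists of osculating homogeneous Legendrian germs (for a suitable symplectic form). 2. Let $(Z,p)$ be a germ of a homogeneous nondegenerate Legendrian curve. If $(Z,p)$ is osculating, then it belongs to $\mathbf L_{r^2}$ for some $r\in\mathbb C$. Without this condition at $p$, for all $q\in Z\setminus\{p\}$ close to $p$ the germ $(Z,q)$ belongs to $\mathbf L_{r^2}$ for some $r\in\mathbb C$. 3. $\mathbf L_{r^2}=\mathbf L_{s^2}$ if and only if $r^2=s^2$ or $r^2s^2=1$. 4. For a germ $(Z,p)$ in $\mathbf L_{r^2}$, Legendrian with respect to $\sigma$, $\dim\mathfrak{aut}(Z)=4$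 if $r^2\in\{9,\tfrac19\}$ and $\dim\mathfrak{aut}(Z)=2$ otherwise. 5. A germ $(Z,p)$ in $\mathbf L_{r^2}$ has local homogeneous coordinates $\gamma(t)$, $p=[\gamma(0)]$, in Laguerre–Forsyth form, i.e. with $\gamma''''+q_1\gamma'+q_0\gamma=0$ for holomorphic $q_0,q_1$ near $t=0$. For every such choice $q_1\equiv0$ near $0$. If $r^2\in\{9,\tfrac19\}$, then $q_0\equiv0$ near $0$. Otherwise $q_0$ has no zero near $0$ and the absolute invariant $\mathcal I=\frac{(8q_0q_0''-9(q_0')^2)^2}{4096\,q_0^5}$ is constant, equal to $$\mathcal I=-\frac{(r^2+1)^2}{(r^2-9)(9r^2-1)}$$ (so $\mathcal I=\tfrac1{16}$ for $\mathbf L_1$ and $\mathcal I=-\tfrac19$ for $\mathbf L_0$). 6. The germ at each of its points of the rational normal curve $\{[a^3:a^2b:ab^2:b^3]\}$ belongs to $\mathbf L_9$. -/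

import Mathlib

open Filter Topology
open scoped LinearAlgebra.Projectivization

noncomputable section

namespace LegendrianCurve

/-- The vector space `ℂ⁴`. -/
abbrev V4 : Type := Fin 4 → ℂ

/-- Complex projective 3-space. -/
abbrev P3 : Type := ℙ ℂ V4

/-- The quotient topology on projective space. -/
instance instTopologicalSpaceP3 : TopologicalSpace P3 :=
  TopologicalSpace.coinduced (Projectivization.mk' ℂ) inferInstance

open Classical in
/-- The point `[v]` of projective space (with an irrelevant value at `v = 0`). -/
def toP3 (v : V4) : P3 :=
  if h : v = 0 then Classical.arbitrary P3 else Projectivization.mk ℂ v h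

/-- `γ` is a local holomorphic parametrization, in homogeneous coordinates, of `Z` around
its point `p = [γ 0]`: it is holomorphic near `0`, the projected curve `t ↦ [γ t]` is immersed at
`0` (that is, `γ 0` and `γ' 0` are linearly independent), and `t ↦ [γ t]` carries the
neighbourhoods of `0` exactly to the neighbourhoods of `p` in `Z`. -/
def IsLocalParam (γ : ℂ → V4) (Z : Set P3) (p : P3) : Prop :=
  AnalyticAt ℂ γ 0 ∧ LinearIndependent ℂ ![γ 0, deriv γ 0] ∧
    map (fun t => toP3 (γ t)) (𝓝 0) = 𝓝[Z] p

/-- Near its point `p`, the set `Z` is a (not necessarily closed) one-dimensional complex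
submanifold of projective space; so `(Z, p)` represents the germ of a curve. -/
def IsCurveGerm (Z : Set P3) (p : P3) : Prop :=
  ∃ γ : ℂ → V4, IsLocalParam γ Z p

/-- The affine cone over `Z`: the union of the lines in `ℂ⁴` that are the points of `Z`. -/
def affineCone (Z : Set P3) : Set V4 :=
  {v | ∃ q ∈ Z, v ∈ q.submodule}

/-- `δ` is a holomorphic curve (germ at `0`) in the affine cone of `Z` with `δ 0 = z`. -/
def IsConeCurve (Z : Set P3) (z : V4) (δ : ℂ → V4) : Prop :=
  AnalyticAt ℂ δ 0 ∧ δ 0 = z ∧ ∀ᶠ t in 𝓝 (0 : ℂ), δ t ∈ affineCone Z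

/-- The osculating sequence of the affine cone at `z`, starting with the line spanned by `z`;
the next term is the affine tangent space. -/
def osculating (Z : Set P3) (z : V4) : ℕ → Submodule ℂ V4
  | 0 => Submodule.span ℂ {z}
  | k + 1 => osculating Z z k ⊔
      Submodule.span ℂ {w | ∃ δ : ℂ → V4, IsConeCurve Z z δ ∧ w = iteratedDeriv (k + 1) δ 0}

/-- The affine tangent space of the cone over `Z` at `z`. -/
def affineTangent (Z : Set P3) (z : V4) : Submodule ℂ V4 := osculating Z z 1

/-- The `k`-th osculating space of `Z` at the point `p` is all of `ℂ⁴`. -/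
def OsculatingFull (Z : Set P3) (p : P3) (k : ℕ) : Prop :=
  ∀ z ∈ p.submodule, z ≠ 0 → osculating Z z k = ⊤

/-- `p` is a nondegenerate point of `Z`: some osculating space is all of `ℂ⁴`. -/
def IsNondegenerate (Z : Set P3) (p : P3) : Prop :=
  ∃ k : ℕ, 1 ≤ k ∧ OsculatingFull Z p k

/-- Symplectic forms on `ℂ⁴`. -/
def IsSymplectic (σ : LinearMap.BilinForm ℂ V4) : Prop :=
  σ.IsAlt ∧ σ.Nondegenerate

/-- The germ of `Z` at `p` is Legendrian for `σ`: `σ` vanishes on the affine tangent spaces. -/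
def IsLegendrian (σ : LinearMap.BilinForm ℂ V4) (Z : Set P3) (p : P3) : Prop :=
  ∀ᶠ q in 𝓝[Z] p, ∀ z ∈ q.submodule, z ≠ 0 →
    ∀ v ∈ affineTangent Z z, ∀ w ∈ affineTangent Z z, σ v w = 0

/-- The conformal symplectic Lie algebra of `σ` (as a linear subspace of `𝔤𝔩₄`). -/
def csp (σ : LinearMap.BilinForm ℂ V4) : Submodule ℂ (Module.End ℂ V4) where
  carrier := {u | ∃ c : ℂ, ∀ v w, σ (u v) w + σ v (u w) = c * σ v w}
  zero_mem' := ⟨0, by simp⟩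
  add_mem' := by
    rintro a b ⟨c, hc⟩ ⟨d, hd⟩
    refine ⟨c + d, fun v w => ?_⟩
    simp only [LinearMap.add_apply, map_add]
    linear_combination hc v w + hd v w
  smul_mem' := by
    rintro a u ⟨c, hc⟩
    refine ⟨a * c, fun v w => ?_⟩
    simp only [LinearMap.smul_apply, map_smul, smul_eq_mul]
    linear_combination a * hc v w

/-- The infinitesimal symmetry algebra of the germ of `Z` at `p`: the `u ∈ csp σ` that are tangent
to the affine cone over a neighbourhood of `p` in `Z`. -/
def aut (σ : LinearMap.BilinForm ℂ V4) (Z : Set P3) (p : P3) :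
    Submodule ℂ (Module.End ℂ V4) where
  carrier := {u | u ∈ csp σ ∧
    ∀ᶠ q in 𝓝[Z] p, ∀ z ∈ q.submodule, z ≠ 0 → u z ∈ affineTangent Z z}
  zero_mem' := ⟨Submodule.zero_mem _, Eventually.of_forall fun _ _ _ _ => by simp⟩
  add_mem' := by
    rintro a b ⟨ha, ha'⟩ ⟨hb, hb'⟩
    refine ⟨Submodule.add_mem _ ha hb, ?_⟩
    filter_upwards [ha', hb'] with q h1 h2 z hz hz0
    exact Submodule.add_mem _ (h1 z hz hz0) (h2 z hz hz0)
  smul_mem' := by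
    rintro c u ⟨hu, hu'⟩
    refine ⟨Submodule.smul_mem _ c hu, ?_⟩
    filter_upwards [hu'] with q h1 z hz hz0
    exact Submodule.smul_mem _ c (h1 z hz hz0)

/-- The germ is homogeneous: its symmetry algebra has dimension at least two. -/
def IsHomogeneous (σ : LinearMap.BilinForm ℂ V4) (Z : Set P3) (p : P3) : Prop :=
  2 ≤ Module.finrank ℂ (aut σ Z p)

/-- Projective equivalence of the germs `(Z, p)` and `(Z', p')` under `GL(4, ℂ)`. -/
def ProjEquiv (Z : Set P3) (p : P3) (Z' : Set P3) (p' : P3) : Prop :=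
  ∃ g : V4 ≃ₗ[ℂ] V4, g • p = p' ∧
    ∀ᶠ q in 𝓝 p', q ∈ (fun x : P3 => g • x) '' Z ↔ q ∈ Z'

open Classical in
/-- The matrix `A` of the representative of the class indexed by `r²`. -/
def modelMatrix (r : ℂ) : Matrix (Fin 4) (Fin 4) ℂ :=
  if r ^ 2 = 0 then !![1, 0, 0, 0; 0, 0, 1, 0; 0, 0, 0, 0; 0, 0, 0, -1]
  else if r ^ 2 = 1 then !![1, 1, 0, 0; 0, 1, 0, 0; 0, 0, -1, 1; 0, 0, 0, -1]
  else !![r, 0, 0, 0; 0, 1, 0, 0; 0, 0, -1, 0; 0, 0, 0, -r]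

/-- The curve `t ↦ exp(tA) (1,1,1,1)ᵀ`. -/
def modelCurve (r : ℂ) (t : ℂ) : V4 :=
  (NormedSpace.exp (t • modelMatrix r)).mulVec ![1, 1, 1, 1]

/-- The class indexed by `r²`: all germs `(Z, p)` that are projectively equivalent to a germ
parametrized by `t ↦ [exp(tA) (1,1,1,1)ᵀ]` around `t = 0`. -/
def classL (r : ℂ) : Set (Set P3 × P3) :=
  {g | ∃ (Z₀ : Set P3) (p₀ : P3), IsLocalParam (modelCurve r) Z₀ p₀ ∧ ProjEquiv Z₀ p₀ g.1 g.2}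

/-- The local homogeneous coordinates `γ` of `Z` around `p` are in Laguerre–Forsyth form: the
components of `γ` solve `u'''' + q₁ u' + q₀ u = 0` with `q₁`, `q₀` holomorphic near `0`. -/
def IsLaguerreForsyth (γ : ℂ → V4) (q₁ q₀ : ℂ → ℂ) (Z : Set P3) (p : P3) : Prop :=
  IsLocalParam γ Z p ∧ AnalyticAt ℂ q₁ 0 ∧ AnalyticAt ℂ q₀ 0 ∧
    ∀ᶠ t in 𝓝 (0 : ℂ), iteratedDeriv 4 γ t + q₁ t • deriv γ t + q₀ t • γ t = 0

/-- The relative invariant `8 q₀ q₀'' - 9 (q₀')²` of weight 10. -/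
def relInv (q₀ : ℂ → ℂ) (t : ℂ) : ℂ :=
  8 * q₀ t * iteratedDeriv 2 q₀ t - 9 * (deriv q₀ t) ^ 2

/-- The absolute invariant (meaningful where `q₀ t ≠ 0`). -/
def absInv (q₀ : ℂ → ℂ) (t : ℂ) : ℂ :=
  (relInv q₀ t) ^ 2 / (4096 * (q₀ t) ^ 5)

/-- The rational normal curve, in the basis `x³, 3x²y, 3xy², y³` of cubic forms: the points
`[(a x + b y)³]`. -/
def rationalNormalCurve : Set P3 :=
  {q | ∃ a b : ℂ, (a ≠ 0 ∨ b ≠ 0) ∧ q = toP3 ![a ^ 3, a ^ 2 * b, a * b ^ 2, b ^ 3]}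

end LegendrianCurve

end

open LegendrianCurve

/-!
# Homogeneous Legendrian curves in projective 3-space

Along a Legendrian curve `γ` in `ℂ⁴` the pairings `σ(γ⁽ⁱ⁾, γ⁽ʲ⁾)` are determined by the single
function `σ(γ', γ'')`, whose zeros are the points where the curve fails to be osculating
(`linearIndependent_frame`, `derivSpan_ne_top`). Once `γ` is rescaled so that this function is
constant, `γ` solves an equation `γ'''' = c₂ γ'' + c₂' γ' + c₀ γ` (`exists_solvesODE`), and the
curve is determined up to `GL(4, ℂ)` by this equation. The curves `t ↦ exp(tA) (1,1,1,1)ᵀ` solve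
`γ'''' = (1 + r²) γ'' - r² γ`; so a germ belongs to the class of `r²` if and only if it has a local
parametrization that solves this equation and has independent derivatives up to order three
(`mem_classL_iff`).

A parameter change `τ` together with the rescaling by `(τ')^(-3/2)` preserves the shape of the
equation; `c₂` changes by the Schwarzian derivative of `τ`, and `Q = c₀ + (9/100) c₂² - (3/10) c₂''`
transforms like the coefficient of a quartic differential (`solvesODE_reparam` has what is needed
here: the case of an equation with constant coefficients). Infinitesimally, a symmetry of the curve
is, up to a scalar matrix, the motion `β γ' - (3/2) β' γ` along a vector field `β d/dt`, and it
preserves the equation if and only if `5 β''' = 2 β' c₂ + β c₂'` and `4 β' Q + β Q' = 0`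
(`equations_of_solvesODE_motion`, `solvesODE_motion_of_equations`). Hence the symmetry algebra of a
germ given by constant coefficients has dimension `1 + 1` if `Q ≠ 0`, since then `β` is constant,
and dimension `1 + 3` if `Q = 0`, since then the equation can be brought to the form `γ'''' = 0`,
where the solutions `β` are the quadratic polynomials (`finrank_aut_eq_two`,
`finrank_aut_eq_four`). For the equation of the class of `r²` the invariant `Q` is
`(r² - 9) (9 r² - 1) / 100`.

Conversely, a homogeneous germ has a symmetry along some vector field `β ≠ 0`. If `β` vanishes at
the base point, then `β⁴ Q` is constant, hence zero, so `Q = 0`; then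
`3 F F'' - 2 F'² - (9/10) c₂ F²`, for a component `F` of `γ`, is another symmetric vector field,
which can be chosen not to vanish at the point (`exists_motion_of_quarticInv_eq_zero`). In the time
parameter of a nonvanishing symmetric vector field the coefficients are constant
(`IsLocalParam.exists_const_solvesODE`), and rescaling the parameter, or passing to a logarithmic
parameter if `γ'''' = 0`, gives the equation of some class (`IsLocalParam.exists_mem_classL`).

The Laguerre–Forsyth parametrizations of a germ given by constant coefficients are those whose
parameter change solves the Schwarzian equation that annihilates `c₂`, and there `q₀ = -Q w⁴` with
`w = τ'`. The Schwarzian equation for `w` turns the absolute invariant into `-c₂² / (100 Q)`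
(`laguerreForsyth_coefficients`, `absInv_eq`). It separates the classes up to `r² ↦ r⁻²`, which is
realized by rescaling the parameter.
-/

namespace LegendrianCurve

/-! ### Germs of holomorphic functions and linear differential equations -/

/-- `G` is the derivative of `F` at all points of a neighbourhood of `0`. -/
def HasDerivNear {E : Type*} [NormedAddCommGroup E] [NormedSpace ℂ E] (F G : ℂ → E) : Prop :=
  ∀ᶠ t in 𝓝 (0 : ℂ), HasDerivAt F (G t) t

namespace HasDerivNear

variable {E : Type*} [NormedAddCommGroup E] [NormedSpace ℂ E] {F G F' G' : ℂ → E}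

theorem congr (h : HasDerivNear F G) (hF : F' =ᶠ[𝓝 0] F) (hG : G' =ᶠ[𝓝 0] G) :
    HasDerivNear F' G' := by
  filter_upwards [h, hF.eventually_nhds, hG] with t h1 h2 h3
  rw [h3]
  exact h1.congr_of_eventuallyEq h2

theorem congr_right (h : HasDerivNear F G) (hG : G' =ᶠ[𝓝 0] G) : HasDerivNear F G' :=
  h.congr EventuallyEq.rfl hG

/-- Identities between germs of functions may be differentiated. -/
theorem unique (h : HasDerivNear F G) (h' : HasDerivNear F' G') (hF : F =ᶠ[𝓝 0] F') :
    G =ᶠ[𝓝 0] G' := by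
  filter_upwards [h, h', hF.eventually_nhds] with t h1 h2 h3
  exact h1.unique (h2.congr_of_eventuallyEq h3)

theorem add (h : HasDerivNear F G) (h' : HasDerivNear F' G') :
    HasDerivNear (fun t => F t + F' t) (fun t => G t + G' t) := by
  filter_upwards [h, h'] with t h1 h2 using h1.add h2

theorem sub (h : HasDerivNear F G) (h' : HasDerivNear F' G') :
    HasDerivNear (fun t => F t - F' t) (fun t => G t - G' t) := by
  filter_upwards [h, h'] with t h1 h2 using h1.sub h2

theorem smul {f g : ℂ → ℂ} (hf : HasDerivNear f g) (h : HasDerivNear F G) :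
    HasDerivNear (fun t => f t • F t) (fun t => f t • G t + g t • F t) := by
  filter_upwards [hf, h] with t h1 h2 using h1.smul h2

theorem const_smul (c : ℂ) (h : HasDerivNear F G) :
    HasDerivNear (fun t => c • F t) (fun t => c • G t) := by
  filter_upwards [h] with t h1 using h1.const_smul c

theorem mul {f g f' g' : ℂ → ℂ} (h : HasDerivNear f g) (h' : HasDerivNear f' g') :
    HasDerivNear (fun t => f t * f' t) (fun t => g t * f' t + f t * g' t) := by
  filter_upwards [h, h'] with t h1 h2 using h1.mul h2

theorem pow {f g : ℂ → ℂ} (h : HasDerivNear f g) (n : ℕ) :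
    HasDerivNear (fun t => f t ^ n) (fun t => n * f t ^ (n - 1) * g t) := by
  filter_upwards [h] with t h1 using h1.pow n

theorem const_mul {f g : ℂ → ℂ} (c : ℂ) (h : HasDerivNear f g) :
    HasDerivNear (fun t => c * f t) (fun t => c * g t) := by
  filter_upwards [h] with t h1 using h1.const_mul c

theorem const (c : E) : HasDerivNear (fun _ => c) (fun _ => 0) :=
  Eventually.of_forall fun t => hasDerivAt_const t c

theorem id : HasDerivNear (fun t : ℂ => t) (fun _ => 1) :=
  Eventually.of_forall fun t => hasDerivAt_id t

theorem linear {W : Type*} [NormedAddCommGroup W] [NormedSpace ℂ W] [FiniteDimensional ℂ E]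
    (u : E →ₗ[ℂ] W) (h : HasDerivNear F G) :
    HasDerivNear (fun t => u (F t)) (fun t => u (G t)) := by
  filter_upwards [h] with t h1
  exact (LinearMap.toContinuousLinearMap u).hasFDerivAt.comp_hasDerivAt t h1

theorem bilin [FiniteDimensional ℂ E] (σ : LinearMap.BilinForm ℂ E) (h : HasDerivNear F G)
    (h' : HasDerivNear F' G') :
    HasDerivNear (fun t => σ (F t) (F' t)) (fun t => σ (G t) (F' t) + σ (F t) (G' t)) := by
  filter_upwards [h, h'] with t h1 h2
  refine ((LinearMap.toContinuousBilinearMap σ).hasFDerivAt_of_bilinear h1.hasFDerivAt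
    h2.hasFDerivAt).hasDerivAt.congr_deriv ?_
  simp [LinearMap.toContinuousBilinearMap_apply, add_comm]

theorem tendsto_zero {τ w : ℂ → ℂ} (h : HasDerivNear τ w) (h0 : τ 0 = 0) :
    Tendsto τ (𝓝 0) (𝓝 0) := by
  have := (h.self_of_nhds).continuousAt.tendsto
  rwa [h0] at this

theorem comp {τ w : ℂ → ℂ} (h : HasDerivNear F G) (hτ : HasDerivNear τ w) (h0 : τ 0 = 0) :
    HasDerivNear (fun s => F (τ s)) (fun s => w s • G (τ s)) := by
  filter_upwards [hτ, (hτ.tendsto_zero h0).eventually h] with s h1 h2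
  exact h2.scomp s h1

theorem comp_mul {τ w f g : ℂ → ℂ} (h : HasDerivNear f g) (hτ : HasDerivNear τ w) (h0 : τ 0 = 0) :
    HasDerivNear (fun s => f (τ s)) (fun s => w s * g (τ s)) :=
  h.comp hτ h0

/-- A function with vanishing derivative near `0` is constant near `0`. -/
theorem eventually_const (h : HasDerivNear F G) (hG : ∀ᶠ t in 𝓝 0, G t = 0) :
    ∀ᶠ t in 𝓝 0, F t = F 0 := by
  obtain ⟨ε, hε, hb⟩ := Metric.eventually_nhds_iff_ball.1 (h.and hG)
  filter_upwards [Metric.ball_mem_nhds (0 : ℂ) hε] with t ht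
  refine Metric.isOpen_ball.is_const_of_deriv_eq_zero (convex_ball (0 : ℂ) ε).isPreconnected
    (fun x hx => (hb x hx).1.differentiableAt.differentiableWithinAt) (fun x hx => ?_) ht
    (Metric.mem_ball_self hε)
  rw [(hb x hx).1.deriv, (hb x hx).2]
  rfl

theorem deriv_eq (h : HasDerivNear F G) : deriv F =ᶠ[𝓝 0] G := by
  filter_upwards [h] with t h1 using h1.deriv

variable [CompleteSpace E]

theorem analyticAt (h : HasDerivNear F G) : AnalyticAt ℂ F 0 :=
  Complex.analyticAt_iff_eventually_differentiableAt.2 (h.mono fun _ h1 => h1.differentiableAt)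

theorem analyticAt_right (h : HasDerivNear F G) : AnalyticAt ℂ G 0 :=
  h.analyticAt.deriv.congr h.deriv_eq

end HasDerivNear

section

variable {E : Type*} [NormedAddCommGroup E] [NormedSpace ℂ E] [CompleteSpace E]

theorem hasDerivNear_deriv {F : ℂ → E} (h : AnalyticAt ℂ F 0) : HasDerivNear F (deriv F) :=
  h.eventually_analyticAt.mono fun _ ht => ht.differentiableAt.hasDerivAt

theorem analyticAt_iteratedDeriv {F : ℂ → E} (h : AnalyticAt ℂ F 0) (k : ℕ) :
    AnalyticAt ℂ (iteratedDeriv k F) 0 := by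
  rw [iteratedDeriv_eq_iterate]
  exact h.iterated_deriv k

theorem hasDerivNear_iteratedDeriv {F : ℂ → E} (h : AnalyticAt ℂ F 0) (k : ℕ) :
    HasDerivNear (iteratedDeriv k F) (iteratedDeriv (k + 1) F) := by
  rw [iteratedDeriv_succ]
  exact hasDerivNear_deriv (analyticAt_iteratedDeriv h k)

theorem eventuallyEq_iteratedDeriv_succ {F : ℂ → E} (h : AnalyticAt ℂ F 0) {k : ℕ} {G G' : ℂ → E}
    (hG : iteratedDeriv k F =ᶠ[𝓝 0] G) (hG' : HasDerivNear G G') :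
    iteratedDeriv (k + 1) F =ᶠ[𝓝 0] G' :=
  (hasDerivNear_iteratedDeriv h k).unique hG' hG

theorem exists_primitive {g : ℂ → E} (hg : AnalyticAt ℂ g 0) :
    ∃ G : ℂ → E, G 0 = 0 ∧ HasDerivNear G g := by
  obtain ⟨ε, hε, hb⟩ := Metric.eventually_nhds_iff_ball.1 hg.eventually_analyticAt
  have hd : DifferentiableOn ℂ g (Metric.ball 0 ε) := fun x hx =>
    (hb x hx).differentiableAt.differentiableWithinAt
  obtain ⟨G, h0, hG⟩ := hd.isExactOn_ball.with_val_at 0 0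
  refine ⟨G, h0, ?_⟩
  filter_upwards [Metric.ball_mem_nhds (0 : ℂ) hε] with t ht using hG t ht

/-- The scalar linear equation `f' = g f` is solvable near `0`. -/
theorem exists_exp_primitive {g : ℂ → ℂ} (hg : AnalyticAt ℂ g 0) :
    ∃ f : ℂ → ℂ, f 0 = 1 ∧ HasDerivNear f (fun t => g t * f t) := by
  obtain ⟨G, h0, hG⟩ := exists_primitive hg
  refine ⟨fun t => Complex.exp (G t), by simp [h0], ?_⟩
  filter_upwards [hG] with t ht
  exact ht.cexp.congr_deriv (mul_comm _ _)

/-- Uniqueness for linear differential equations, in the form of a differential inequality. -/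
theorem eventually_eq_zero_of_norm_deriv_le {F : ℂ → E} (hF : AnalyticAt ℂ F 0) (h0 : F 0 = 0)
    {C : ℝ} (h : ∀ᶠ t in 𝓝 0, ‖deriv F t‖ ≤ C * ‖F t‖) : ∀ᶠ t in 𝓝 0, F t = 0 := by
  by_contra hne
  obtain ⟨n, G, hG, hG0, hFG⟩ :=
    (hF.exists_eventuallyEq_pow_smul_nonzero_iff).2 hne
  simp only [sub_zero] at hFG
  have hn : n ≠ 0 := by
    rintro rfl
    have := hFG.self_of_nhds
    simp [h0] at this
    exact hG0 this.symm
  obtain ⟨m, rfl⟩ := Nat.exists_eq_succ_of_ne_zero hn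
  have hd : deriv F =ᶠ[𝓝 0] fun t => t ^ (m + 1) • deriv G t + ((m + 1 : ℕ) * t ^ m) • G t := by
    refine (hasDerivNear_deriv hF).unique ?_ hFG
    have h1 := (HasDerivNear.id.pow (m + 1)).smul (hasDerivNear_deriv hG)
    simpa using h1
  -- Divide the inequality by `t ^ m`; at `t = 0` it then reads `(m + 1) * ‖G 0‖ ≤ 0`.
  have hk : ∀ᶠ t in 𝓝[≠] (0 : ℂ),
      ‖t • deriv G t + ((m + 1 : ℕ) : ℂ) • G t‖ ≤ C * ‖t • G t‖ := by
    have hFG' := hFG.filter_mono (nhdsWithin_le_nhds (s := {0}ᶜ))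
    have hd' := hd.filter_mono (nhdsWithin_le_nhds (s := {0}ᶜ))
    have h' := h.filter_mono (nhdsWithin_le_nhds (s := {0}ᶜ))
    filter_upwards [hFG', hd', h', self_mem_nhdsWithin] with t h1 h2 h3 ht
    have ht' : (0 : ℝ) < ‖t ^ m‖ := norm_pos_iff.2 (pow_ne_zero _ ht)
    have e1 : deriv F t = t ^ m • (t • deriv G t + ((m + 1 : ℕ) : ℂ) • G t) := by
      rw [h2]; module
    have e2 : F t = t ^ m • (t • G t) := by
      rw [h1, Nat.succ_eq_add_one, pow_succ]; module
    rw [e1, e2, norm_smul, norm_smul] at h3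
    nlinarith
  have hc : ContinuousAt (fun t : ℂ => ‖t • deriv G t + ((m + 1 : ℕ) : ℂ) • G t‖) 0 :=
    ((continuousAt_id.smul hG.deriv.continuousAt).add (hG.continuousAt.const_smul _)).norm
  have hc' : ContinuousAt (fun t : ℂ => C * ‖t • G t‖) 0 :=
    (continuousAt_id.smul hG.continuousAt).norm.const_mul C
  have hle := le_of_tendsto_of_tendsto (hc.tendsto.mono_left nhdsWithin_le_nhds)
    (hc'.tendsto.mono_left nhdsWithin_le_nhds) hk
  simp only [zero_smul, zero_add, norm_zero, mul_zero, norm_smul] at hle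
  have h1 : (0 : ℝ) < ‖((m + 1 : ℕ) : ℂ)‖ := norm_pos_iff.2 (by exact_mod_cast Nat.succ_ne_zero m)
  have h2 : (0 : ℝ) < ‖G 0‖ := norm_pos_iff.2 hG0
  nlinarith [mul_pos h1 h2]

/-- Uniqueness for `h'''' = c₂ h'' + c₁ h' + c₀ h`. -/
theorem eventually_eq_zero_of_linear_ode {h₀ h₁ h₂ h₃ : ℂ → E} {c₀ c₁ c₂ : ℂ → ℂ}
    (hc₀ : AnalyticAt ℂ c₀ 0) (hc₁ : AnalyticAt ℂ c₁ 0) (hc₂ : AnalyticAt ℂ c₂ 0)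
    (d₀ : HasDerivNear h₀ h₁) (d₁ : HasDerivNear h₁ h₂) (d₂ : HasDerivNear h₂ h₃)
    (d₃ : HasDerivNear h₃ (fun t => c₂ t • h₂ t + c₁ t • h₁ t + c₀ t • h₀ t))
    (z₀ : h₀ 0 = 0) (z₁ : h₁ 0 = 0) (z₂ : h₂ 0 = 0) (z₃ : h₃ 0 = 0) :
    ∀ᶠ t in 𝓝 0, h₀ t = 0 := by
  have hd : HasDerivNear (fun t => (h₀ t, h₁ t, h₂ t, h₃ t)) (fun t => (h₁ t, h₂ t, h₃ t,
      c₂ t • h₂ t + c₁ t • h₁ t + c₀ t • h₀ t)) := by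
    filter_upwards [d₀, d₁, d₂, d₃] with t e₀ e₁ e₂ e₃
    exact e₀.prodMk (e₁.prodMk (e₂.prodMk e₃))
  have hz := eventually_eq_zero_of_norm_deriv_le hd.analyticAt (by simp [z₀, z₁, z₂, z₃])
    (C := 1 + (‖c₂ 0‖ + 1) + (‖c₁ 0‖ + 1) + (‖c₀ 0‖ + 1)) ?_
  · filter_upwards [hz] with t ht
    exact congrArg Prod.fst ht
  · have hb : ∀ {c : ℂ → ℂ}, AnalyticAt ℂ c 0 → ∀ᶠ t in 𝓝 0, ‖c t‖ < ‖c 0‖ + 1 := fun hc =>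
      hc.continuousAt.norm.eventually_lt_const (lt_add_one _)
    filter_upwards [hd.deriv_eq, hb hc₀, hb hc₁, hb hc₂] with t ht b₀ b₁ b₂
    rw [ht]
    set N := ‖(h₀ t, h₁ t, h₂ t, h₃ t)‖ with hN
    have n₀ : ‖h₀ t‖ ≤ N := by simp [hN, Prod.norm_def]
    have n₁ : ‖h₁ t‖ ≤ N := by simp [hN, Prod.norm_def]
    have n₂ : ‖h₂ t‖ ≤ N := by simp [hN, Prod.norm_def]
    have n₃ : ‖h₃ t‖ ≤ N := by simp [hN, Prod.norm_def]
    have hN0 : 0 ≤ N := norm_nonneg _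
    have hA : N ≤ (1 + (‖c₂ 0‖ + 1) + (‖c₁ 0‖ + 1) + (‖c₀ 0‖ + 1)) * N := by
      nlinarith [mul_nonneg (norm_nonneg (c₂ 0)) hN0, mul_nonneg (norm_nonneg (c₁ 0)) hN0,
        mul_nonneg (norm_nonneg (c₀ 0)) hN0]
    have hm : ∀ {c c' : ℂ} {v : E}, ‖c‖ < ‖c'‖ + 1 → ‖v‖ ≤ N → ‖c • v‖ ≤ (‖c'‖ + 1) * N := by
      intro c c' v h1 h2
      rw [norm_smul]
      exact mul_le_mul h1.le h2 (norm_nonneg _) (by positivity)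
    have hB : ‖c₂ t • h₂ t + c₁ t • h₁ t + c₀ t • h₀ t‖ ≤
        (1 + (‖c₂ 0‖ + 1) + (‖c₁ 0‖ + 1) + (‖c₀ 0‖ + 1)) * N := by
      have := norm_add₃_le (a := c₂ t • h₂ t) (b := c₁ t • h₁ t) (c := c₀ t • h₀ t)
      have e2 := hm b₂ n₂
      have e1 := hm b₁ n₁
      have e0 := hm b₀ n₀
      linarith
    simp only [Prod.norm_def (x := (h₁ t, h₂ t, h₃ t, _)), Prod.norm_def (x := (h₂ t, h₃ t, _)),
      Prod.norm_def (x := (h₃ t, _))]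
    exact max_le (n₁.trans hA) (max_le (n₂.trans hA) (max_le (n₃.trans hA) hB))

end

/-! ### Projective space and local parametrizations -/

theorem toP3_of_ne {v : V4} (hv : v ≠ 0) : toP3 v = Projectivization.mk ℂ v hv := by
  simp [toP3, hv]

theorem exists_eq_toP3 (q : P3) : ∃ v : V4, v ≠ 0 ∧ q = toP3 v :=
  ⟨q.rep, q.rep_nonzero, by rw [toP3_of_ne q.rep_nonzero, q.mk_rep]⟩

theorem mem_submodule_toP3 {v w : V4} (hv : v ≠ 0) :
    w ∈ (toP3 v).submodule ↔ ∃ c : ℂ, c • v = w := by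
  rw [toP3_of_ne hv, Projectivization.submodule_mk, Submodule.mem_span_singleton]

theorem toP3_eq_toP3_iff {v w : V4} (hv : v ≠ 0) (hw : w ≠ 0) :
    toP3 v = toP3 w ↔ ∃ c : ℂ, c • v = w := by
  rw [eq_comm, toP3_of_ne hv, toP3_of_ne hw, Projectivization.mk_eq_mk_iff']

theorem toP3_smul {v : V4} (hv : v ≠ 0) {c : ℂ} (hc : c ≠ 0) : toP3 (c • v) = toP3 v :=
  ((toP3_eq_toP3_iff hv (smul_ne_zero hc hv)).2 ⟨c, rfl⟩).symm

theorem eq_toP3_of_mem {q : P3} {z : V4} (hz : z ∈ q.submodule) (hz0 : z ≠ 0) : q = toP3 z := by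
  obtain ⟨v, hv, rfl⟩ := exists_eq_toP3 q
  exact (toP3_eq_toP3_iff hv hz0).2 ((mem_submodule_toP3 hv).1 hz)

theorem mem_submodule_toP3_self {v : V4} (hv : v ≠ 0) : v ∈ (toP3 v).submodule :=
  (mem_submodule_toP3 hv).2 ⟨1, one_smul _ _⟩

theorem smul_toP3 (g : V4 ≃ₗ[ℂ] V4) {v : V4} (hv : v ≠ 0) : g • toP3 v = toP3 (g v) := by
  have : g v ≠ 0 := by simpa using hv
  rw [toP3_of_ne hv, toP3_of_ne this]
  rfl

/-- The quotient map to projective space is continuous and open. -/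
theorem nhds_toP3 {v : V4} (hv : v ≠ 0) : 𝓝 (toP3 v) = map toP3 (𝓝 v) := by
  let m : {v : V4 // v ≠ 0} → P3 := Projectivization.mk' ℂ
  have hm : ∀ x, m x = toP3 x.1 := fun x => (toP3_of_ne x.2).symm
  have hcont : Continuous m := continuous_coinduced_rng
  have hopen : IsOpenMap m := by
    intro U hU
    refine isOpen_coinduced.2 ?_
    have hU' : IsOpen (Subtype.val '' U) := isOpen_ne.isOpenEmbedding_subtypeVal.isOpenMap U hU
    have : Projectivization.mk' ℂ ⁻¹' (m '' U) =
        Subtype.val ⁻¹' (⋃ c ∈ {c : ℂ | c ≠ 0}, (fun w : V4 => c • w) ⁻¹' (Subtype.val '' U)) := by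
      ext x
      simp only [Set.mem_preimage, Set.mem_image, Set.mem_iUnion, Set.mem_ofPred_eq, exists_prop]
      constructor
      · rintro ⟨u, hu, hux⟩
        have h1 : toP3 x.1 = toP3 u.1 := by rw [← hm, ← hm]; exact hux.symm
        obtain ⟨c, hc⟩ := (toP3_eq_toP3_iff x.2 u.2).1 h1
        refine ⟨c, ?_, u, hu, hc.symm⟩
        rintro rfl
        exact u.2 (by rw [← hc, zero_smul])
      · rintro ⟨c, hc, u, hu, hux⟩
        refine ⟨u, hu, ?_⟩
        change m u = m x
        rw [hm, hm, hux, toP3_smul x.2 hc]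
    rw [this]
    refine IsOpen.preimage continuous_subtype_val (isOpen_biUnion fun c _ => ?_)
    exact hU'.preimage (continuous_const_smul c)
  have h1 : map Subtype.val (𝓝 (⟨v, hv⟩ : {v : V4 // v ≠ 0})) = 𝓝 v :=
    isOpen_ne.isOpenEmbedding_subtypeVal.map_nhds_eq _
  have h2 : map m (𝓝 ⟨v, hv⟩) = 𝓝 (m ⟨v, hv⟩) := hopen.map_nhds_eq hcont.continuousAt
  rw [hm] at h2
  rw [← h2, ← h1, map_map]
  exact congrArg (fun f => map f _) (funext hm)

theorem eq_toP3_of_forall_mem_nhds {p : P3} {v : V4} (hv : v ≠ 0)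
    (h : ∀ U ∈ 𝓝 p, toP3 v ∈ U) : p = toP3 v := by
  obtain ⟨w, hw, rfl⟩ := exists_eq_toP3 p
  by_contra hne
  have hw' : w ∉ Submodule.span ℂ {v} := fun hmem => by
    obtain ⟨c, hc⟩ := Submodule.mem_span_singleton.1 hmem
    exact hne ((toP3_eq_toP3_iff hv hw).2 ⟨c, hc⟩).symm
  have hcl : IsClosed (Submodule.span ℂ {v} : Set V4) := Submodule.closed_of_finiteDimensional _
  have hU : {q : P3 | v ∉ q.submodule} ∈ 𝓝 (toP3 w) := by
    rw [nhds_toP3 hw, mem_map]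
    filter_upwards [hcl.isOpen_compl.mem_nhds hw', isOpen_ne.mem_nhds hw] with x hx hx0 hvx
    obtain ⟨c, rfl⟩ := (mem_submodule_toP3 hx0).1 hvx
    have hc : c ≠ 0 := by rintro rfl; simp at hv
    refine hx (Submodule.mem_span_singleton.2 ⟨c⁻¹, ?_⟩)
    rw [smul_smul, inv_mul_cancel₀ hc, one_smul]
  exact h _ hU (mem_submodule_toP3_self hv)

theorem exists_dual_family {n : ℕ} {v : Fin n → V4} (hv : LinearIndependent ℂ v) :
    ∃ ℓ : Fin n → V4 →ₗ[ℂ] ℂ, ∀ i j, ℓ i (v j) = if i = j then 1 else 0 := by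
  obtain ⟨R, hR⟩ := LinearMap.exists_leftInverse_of_injective (Fintype.linearCombination ℂ v)
    (LinearMap.ker_eq_bot.2 hv.fintypeLinearCombination_injective)
  refine ⟨fun i => (LinearMap.proj i).comp R, fun i j => ?_⟩
  have := LinearMap.congr_fun hR (Pi.single j 1)
  simp only [LinearMap.comp_apply, Fintype.linearCombination_apply_single, one_smul,
    LinearMap.id_apply] at this
  simp [this, Pi.single_apply]

/-- A curve immersed at `0` in projective space has a holomorphic left inverse, defined on an open
cone around the line through `γ 0`: the local inverse of the affine coordinate `ℓ₁ / ℓ₀`. -/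
theorem exists_left_inverse {γ : ℂ → V4} (hγ : AnalyticAt ℂ γ 0)
    (hi : LinearIndependent ℂ ![γ 0, deriv γ 0]) :
    ∃ ψ : V4 → ℂ, (∀ (c : ℂ) (v : V4), c ≠ 0 → ψ (c • v) = ψ v) ∧
      (∀ᶠ t in 𝓝 0, ψ (γ t) = t) ∧ ∀ c : ℂ, c ≠ 0 → AnalyticAt ℂ ψ (c • γ 0) := by
  obtain ⟨ℓ, hℓ⟩ := exists_dual_family hi
  have h00 : ℓ 0 (γ 0) = 1 := by simpa using hℓ 0 0
  have h01 : ℓ 0 (deriv γ 0) = 0 := by simpa using hℓ 0 1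
  have h10 : ℓ 1 (γ 0) = 0 := by simpa using hℓ 1 0
  have h11 : ℓ 1 (deriv γ 0) = 1 := by simpa using hℓ 1 1
  let x : V4 → ℂ := fun v => ℓ 1 v / ℓ 0 v
  have hlin : ∀ i v, AnalyticAt ℂ (fun v => ℓ i v) v := fun i v =>
    (LinearMap.toContinuousLinearMap (ℓ i)).analyticAt v
  have hx : ∀ c : ℂ, c ≠ 0 → AnalyticAt ℂ x (c • γ 0) := fun c hc =>
    (hlin 1 _).div (hlin 0 _) (by simp [h00, hc])
  have hx0 : AnalyticAt ℂ x (γ 0) := by simpa using hx 1 one_ne_zero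
  have hxγ : AnalyticAt ℂ (x ∘ γ) 0 := hx0.comp hγ
  have hd : HasDerivAt (x ∘ γ) 1 0 := by
    have hγd := hγ.differentiableAt.hasDerivAt
    have e1 := (LinearMap.toContinuousLinearMap (ℓ 1)).hasFDerivAt.comp_hasDerivAt 0 hγd
    have e0 := (LinearMap.toContinuousLinearMap (ℓ 0)).hasFDerivAt.comp_hasDerivAt 0 hγd
    refine (e1.div e0 (by simp [h00])).congr_deriv ?_
    simp [h00, h01, h10, h11]
  have hd' : deriv (x ∘ γ) 0 ≠ 0 := by rw [hd.deriv]; exact one_ne_zero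
  let φ := hxγ.hasStrictDerivAt.localInverse _ _ _ hd'
  have hφ : AnalyticAt ℂ φ ((x ∘ γ) 0) := hxγ.analyticAt_localInverse hd'
  have hxc : ∀ (c : ℂ) (v : V4), c ≠ 0 → x (c • v) = x v := fun c v hc => by
    simp only [x, map_smul, smul_eq_mul]
    exact mul_div_mul_left _ _ hc
  refine ⟨φ ∘ x, fun c v hc => ?_, HasStrictDerivAt.eventually_left_inverse hxγ.hasStrictDerivAt hd',
    fun c hc => ?_⟩
  · simp only [Function.comp_apply, hxc c v hc]
  · refine AnalyticAt.comp ?_ (hx c hc)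
    rw [hxc c _ hc]
    exact hφ

/-- A curve with a homogeneous left inverse `ψ` carries neighbourhoods of `t₀` to neighbourhoods
of its image, as soon as the points of `Z` near the image lie on the curve. -/
theorem map_nhds_eq_of_left_inverse {γ : ℂ → V4} {ψ : V4 → ℂ} {N : Set ℂ} {Z : Set P3} {t₀ : ℂ}
    (hγ : ContinuousAt γ t₀) (h0 : γ t₀ ≠ 0) (hψ : ∀ (c : ℂ) (v : V4), c ≠ 0 → ψ (c • v) = ψ v)
    (hψc : ContinuousAt ψ (γ t₀)) (hψ0 : ψ (γ t₀) = t₀)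
    (hN : ∀ t ∈ N, ψ (γ t) = t ∧ γ t ≠ 0)
    (hZN : ∀ᶠ q in 𝓝[Z] (toP3 (γ t₀)), q ∈ (fun t => toP3 (γ t)) '' N)
    (hZ : ∀ᶠ t in 𝓝 t₀, toP3 (γ t) ∈ Z) :
    map (fun t => toP3 (γ t)) (𝓝 t₀) = 𝓝[Z] (toP3 (γ t₀)) := by
  apply le_antisymm
  · refine tendsto_nhdsWithin_iff.2 ⟨?_, hZ⟩
    rw [nhds_toP3 h0]
    exact tendsto_map.comp hγ
  · intro S hS
    have h1 : ∀ᶠ q in 𝓝 (toP3 (γ t₀)), ∃ v, v ≠ 0 ∧ q = toP3 v ∧ toP3 (γ (ψ v)) ∈ S := by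
      rw [nhds_toP3 h0, eventually_map]
      have : ∀ᶠ v in 𝓝 (γ t₀), toP3 (γ (ψ v)) ∈ S := by
        have h2 : Tendsto ψ (𝓝 (γ t₀)) (𝓝 t₀) := by
          have := hψc.tendsto
          rwa [hψ0] at this
        exact h2.eventually hS
      filter_upwards [this, isOpen_ne.mem_nhds h0] with v hv hv0
      exact ⟨v, hv0, rfl, hv⟩
    filter_upwards [hZN, nhdsWithin_le_nhds h1] with q hq hq'
    obtain ⟨t, ht, rfl⟩ := hq
    obtain ⟨v, hv0, hv, hvS⟩ := hq'
    obtain ⟨c, hc⟩ := (toP3_eq_toP3_iff (hN t ht).2 hv0).1 hv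
    have hc0 : c ≠ 0 := by rintro rfl; exact hv0 (by rw [← hc, zero_smul])
    rwa [← hc, hψ c _ hc0, (hN t ht).1] at hvS

theorem linearIndependent_pair_ne_zero {v w : V4} (h : LinearIndependent ℂ ![v, w]) : v ≠ 0 := by
  simpa using h.ne_zero 0

namespace IsLocalParam

variable {γ : ℂ → V4} {Z : Set P3} {p : P3}

theorem ne_zero (h : IsLocalParam γ Z p) : γ 0 ≠ 0 := linearIndependent_pair_ne_zero h.2.1

theorem eventually_ne_zero (h : IsLocalParam γ Z p) : ∀ᶠ t in 𝓝 0, γ t ≠ 0 :=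
  h.1.continuousAt.eventually_ne h.ne_zero

theorem eventually_mem (h : IsLocalParam γ Z p) : ∀ᶠ t in 𝓝 0, toP3 (γ t) ∈ Z := by
  have : Z ∈ map (fun t => toP3 (γ t)) (𝓝 0) := h.2.2 ▸ self_mem_nhdsWithin
  exact this

theorem eq_toP3 (h : IsLocalParam γ Z p) : p = toP3 (γ 0) := by
  refine eq_toP3_of_forall_mem_nhds h.ne_zero fun U hU => ?_
  have : U ∈ map (fun t => toP3 (γ t)) (𝓝 0) := h.2.2 ▸ nhdsWithin_le_nhds hU
  exact mem_of_mem_nhds (s := (fun t => toP3 (γ t)) ⁻¹' U) this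

theorem eventually_nhdsWithin_iff (h : IsLocalParam γ Z p) {P : P3 → Prop} :
    (∀ᶠ q in 𝓝[Z] p, P q) ↔ ∀ᶠ t in 𝓝 0, P (toP3 (γ t)) := by
  rw [← h.2.2, eventually_map]

theorem congr {γ' : ℂ → V4} (h : IsLocalParam γ Z p) (he : γ' =ᶠ[𝓝 0] γ) :
    IsLocalParam γ' Z p := by
  refine ⟨h.1.congr he.symm, ?_, ?_⟩
  · rw [he.self_of_nhds, he.deriv_eq]
    exact h.2.1
  · rw [← h.2.2]
    exact map_congr (he.mono fun t ht => by simp only [ht])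

end IsLocalParam

/-- Every curve immersed at `0` parametrizes a germ. -/
theorem exists_isLocalParam {γ : ℂ → V4} (hγ : AnalyticAt ℂ γ 0)
    (hi : LinearIndependent ℂ ![γ 0, deriv γ 0]) :
    ∃ Z : Set P3, IsLocalParam γ Z (toP3 (γ 0)) := by
  obtain ⟨ψ, hψ, hψγ, hψa⟩ := exists_left_inverse hγ hi
  have h0 := linearIndependent_pair_ne_zero hi
  have hne : ∀ᶠ t in 𝓝 0, γ t ≠ 0 := hγ.continuousAt.eventually_ne h0
  refine ⟨(fun t => toP3 (γ t)) '' {t | ψ (γ t) = t ∧ γ t ≠ 0}, hγ, hi, ?_⟩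
  refine map_nhds_eq_of_left_inverse hγ.continuousAt h0 hψ
    (by simpa using (hψa 1 one_ne_zero).continuousAt) hψγ.self_of_nhds (fun t ht => ht)
    self_mem_nhdsWithin ?_
  filter_upwards [hψγ, hne] with t h1 h2
  exact ⟨t, ⟨h1, h2⟩, rfl⟩

namespace IsLocalParam

variable {γ : ℂ → V4} {Z : Set P3} {p : P3}

/-- A local parametrization at `p` is, after translation, one at all nearby points. -/
theorem eventually_translate (h : IsLocalParam γ Z p) :
    ∀ᶠ t in 𝓝 0, IsLocalParam (fun s => γ (t + s)) Z (toP3 (γ t)) := by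
  obtain ⟨ψ, hψ, hψγ, hψa⟩ := exists_left_inverse h.1 h.2.1
  let N : Set ℂ := {t | ψ (γ t) = t ∧ γ t ≠ 0}
  have hN : N ∈ 𝓝 (0 : ℂ) := hψγ.and h.eventually_ne_zero
  have hZN : ∀ᶠ q in 𝓝[Z] p, q ∈ (fun t => toP3 (γ t)) '' N := by
    rw [← h.2.2]
    exact image_mem_map hN
  have hZN' := h.eventually_nhdsWithin_iff.1 (eventually_eventually_nhdsWithin.2 hZN)
  have hψc : ∀ᶠ t in 𝓝 0, ContinuousAt ψ (γ t) := by
    have h1 : AnalyticAt ℂ ψ (γ 0) := by simpa using hψa 1 one_ne_zero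
    exact h.1.continuousAt.eventually (h1.eventually_analyticAt.mono fun _ hv => hv.continuousAt)
  have hindep : ∀ᶠ t in 𝓝 0, LinearIndependent ℂ ![γ t, deriv γ t] := by
    have hc : ContinuousAt (fun t => (![γ t, deriv γ t] : Fin 2 → V4)) 0 := by
      refine continuousAt_pi.2 fun i => ?_
      fin_cases i
      · exact h.1.continuousAt
      · exact h.1.deriv.continuousAt
    exact hc.eventually (isOpen_setOfPred_linearIndependent.mem_nhds h.2.1)
  filter_upwards [hN, hZN', hψc, h.eventually_mem.eventually_nhds, h.1.eventually_analyticAt,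
    hindep] with t hNt hZNt hψct hmem han hin
  have hcomp : AnalyticAt ℂ (fun s => γ (t + s)) 0 := by
    have h1 : AnalyticAt ℂ γ (t + 0) := by simpa using han
    exact h1.comp_of_eq (by fun_prop) rfl
  refine ⟨hcomp, ?_, ?_⟩
  · simpa [deriv_comp_const_add] using hin
  · have h1 := map_nhds_eq_of_left_inverse han.continuousAt hNt.2 hψ hψct hNt.1 (fun s hs => hs)
      hZNt hmem
    rw [← h1]
    have h2 : map (fun s => t + s) (𝓝 (0 : ℂ)) = 𝓝 t := by
      simp
    rw [← h2, map_map]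
    rfl

/-- Holomorphic curves in the affine cone are obtained from a local parametrization by
reparametrizing and rescaling. -/
theorem exists_reparam_of_isConeCurve (h : IsLocalParam γ Z p) {z : V4} (hz : z ∈ p.submodule)
    (hz0 : z ≠ 0) {δ : ℂ → V4} (hδ : IsConeCurve Z z δ) :
    ∃ f τ : ℂ → ℂ, AnalyticAt ℂ f 0 ∧ AnalyticAt ℂ τ 0 ∧ τ 0 = 0 ∧
      δ =ᶠ[𝓝 0] fun s => f s • γ (τ s) := by
  obtain ⟨ψ, hψ, hψγ, hψa⟩ := exists_left_inverse h.1 h.2.1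
  obtain ⟨hδa, hδ0, hδZ⟩ := hδ
  have hp := h.eq_toP3
  obtain ⟨c, rfl⟩ := (mem_submodule_toP3 h.ne_zero).1 (hp ▸ hz)
  have hc : c ≠ 0 := by rintro rfl; simp at hz0
  let τ : ℂ → ℂ := ψ ∘ δ
  have hτ : AnalyticAt ℂ τ 0 := AnalyticAt.comp (by rw [hδ0]; exact hψa c hc) hδa
  have hτ0 : τ 0 = 0 := by
    simp only [τ, Function.comp_apply, hδ0, hψ c _ hc]
    exact hψγ.self_of_nhds
  have hne : ∀ᶠ s in 𝓝 0, δ s ≠ 0 := hδa.continuousAt.eventually_ne (by rw [hδ0]; exact hz0)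
  -- The points of the curve `δ` lie on the curve parametrized by `γ`.
  have hmem : ∀ᶠ s in 𝓝 0, ∃ t, (ψ (γ t) = t ∧ γ t ≠ 0) ∧ toP3 (γ t) = toP3 (δ s) := by
    have h1 : Tendsto (fun s => toP3 (δ s)) (𝓝 0) (𝓝[Z] p) := by
      refine tendsto_nhdsWithin_iff.2 ⟨?_, ?_⟩
      · have h2 : p = toP3 (δ 0) := by rw [hδ0, toP3_smul h.ne_zero hc, hp]
        rw [h2, nhds_toP3 (by rw [hδ0]; exact hz0)]
        exact tendsto_map.comp hδa.continuousAt
      · filter_upwards [hδZ, hne] with s ⟨q, hq, hqs⟩ hs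
        rwa [← eq_toP3_of_mem hqs hs]
    have hZN : ∀ᶠ q in 𝓝[Z] p, q ∈ (fun t => toP3 (γ t)) '' {t | ψ (γ t) = t ∧ γ t ≠ 0} := by
      rw [← h.2.2]
      exact image_mem_map (hψγ.and h.eventually_ne_zero)
    exact h1.eventually hZN
  have hpar : ∀ᶠ s in 𝓝 0, ∃ b : ℂ, δ s = b • γ (τ s) := by
    filter_upwards [hmem, hne] with s ⟨t, ⟨ht, ht0⟩, hts⟩ hs
    obtain ⟨b, hb⟩ := (toP3_eq_toP3_iff ht0 hs).1 hts
    have hb0 : b ≠ 0 := by rintro rfl; exact hs (by rw [← hb, zero_smul])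
    refine ⟨b, ?_⟩
    have : τ s = t := by
      simp only [τ, Function.comp_apply, ← hb, hψ b _ hb0, ht]
    rw [this, hb]
  obtain ⟨ℓ, hℓ⟩ := exists_dual_family h.2.1
  have h00 : ℓ 0 (γ 0) = 1 := by simpa using hℓ 0 0
  have hlin : ∀ v, AnalyticAt ℂ (fun v => ℓ 0 v) v := fun v =>
    (LinearMap.toContinuousLinearMap (ℓ 0)).analyticAt v
  have hγτ : AnalyticAt ℂ (fun s => γ (τ s)) 0 :=
    AnalyticAt.comp (f := τ) (by rw [hτ0]; exact h.1) hτ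
  have hden : AnalyticAt ℂ (fun s => ℓ 0 (γ (τ s))) 0 := (hlin _).comp hγτ
  have hden0 : ℓ 0 (γ (τ 0)) ≠ 0 := by rw [hτ0, h00]; exact one_ne_zero
  refine ⟨fun s => ℓ 0 (δ s) / ℓ 0 (γ (τ s)), τ, ((hlin _).comp hδa).div hden hden0, hτ, hτ0, ?_⟩
  filter_upwards [hpar, hden.continuousAt.eventually_ne hden0] with s ⟨b, hb⟩ hs
  have : ℓ 0 (δ s) / ℓ 0 (γ (τ s)) = b := by
    rw [hb, map_smul, smul_eq_mul, mul_div_assoc, div_self hs, mul_one]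
  rw [this, hb]

end IsLocalParam

/-! ### Osculating spaces and changes of parametrization -/

/-- The derivatives of `f • γ ∘ τ` up to order `k` are combinations of those of `γ`. -/
theorem exists_coeff_iteratedDeriv {γ δ : ℂ → V4} {f τ : ℂ → ℂ} (hγ : AnalyticAt ℂ γ 0)
    (hf : AnalyticAt ℂ f 0) (hτ : AnalyticAt ℂ τ 0) (hτ0 : τ 0 = 0)
    (hδ : δ =ᶠ[𝓝 0] fun s => f s • γ (τ s)) (k : ℕ) :
    ∃ a : ℕ → ℂ → ℂ, (∀ j, AnalyticAt ℂ (a j) 0) ∧ iteratedDeriv k δ =ᶠ[𝓝 0]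
      fun s => ∑ j ∈ Finset.range (k + 1), a j s • iteratedDeriv j γ (τ s) := by
  have hδa : AnalyticAt ℂ δ 0 := by
    refine AnalyticAt.congr ?_ hδ.symm
    exact hf.smul (AnalyticAt.comp (f := τ) (by rw [hτ0]; exact hγ) hτ)
  induction k with
  | zero =>
    refine ⟨fun _ => f, fun _ => hf, ?_⟩
    simpa using hδ
  | succ k ih =>
    obtain ⟨a, ha, hk⟩ := ih
    have hw := hasDerivNear_deriv hτ
    refine ⟨fun j s => (if j ≤ k then deriv (a j) s else 0) +
      (if j = 0 then 0 else a (j - 1) s * deriv τ s), fun j => ?_, ?_⟩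
    · refine AnalyticAt.add ?_ ?_
      · split_ifs
        · exact (ha j).deriv
        · exact analyticAt_const
      · split_ifs
        · exact analyticAt_const
        · exact (ha _).mul hτ.deriv
    · have hd : HasDerivNear
          (fun s => ∑ j ∈ Finset.range (k + 1), a j s • iteratedDeriv j γ (τ s))
          (fun s => ∑ j ∈ Finset.range (k + 1), (a j s • (deriv τ s • iteratedDeriv (j + 1) γ (τ s))
            + deriv (a j) s • iteratedDeriv j γ (τ s))) := by
        have : ∀ j ∈ Finset.range (k + 1), HasDerivNear
            (fun s => a j s • iteratedDeriv j γ (τ s))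
            (fun s => a j s • (deriv τ s • iteratedDeriv (j + 1) γ (τ s))
            + deriv (a j) s • iteratedDeriv j γ (τ s)) := fun j _ =>
          (hasDerivNear_deriv (ha j)).smul ((hasDerivNear_iteratedDeriv hγ j).comp hw hτ0)
        have h2 : ∀ᶠ s in 𝓝 (0 : ℂ), ∀ j ∈ Finset.range (k + 1), HasDerivAt
            (fun s => a j s • iteratedDeriv j γ (τ s))
            (a j s • (deriv τ s • iteratedDeriv (j + 1) γ (τ s))
            + deriv (a j) s • iteratedDeriv j γ (τ s)) s :=
          (Finset.eventually_all _).2 this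
        filter_upwards [h2] with s hs
        exact HasDerivAt.fun_sum hs
      filter_upwards [eventuallyEq_iteratedDeriv_succ hδa hk hd] with s hs
      rw [hs]
      simp only [add_smul, Finset.sum_add_distrib]
      rw [add_comm]
      congr 1
      · rw [Finset.sum_range_succ _ (k + 1)]
        simp only [Nat.not_succ_le_self, if_false, zero_smul, add_zero]
        refine Finset.sum_congr rfl fun j hj => ?_
        rw [if_pos (Nat.lt_succ_iff.1 (Finset.mem_range.1 hj))]
      · rw [Finset.sum_range_succ' _ (k + 1)]
        simp [smul_smul]

/-- The span of the derivatives of `γ` at `0` up to order `k`. -/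
def derivSpan (γ : ℂ → V4) (k : ℕ) : Submodule ℂ V4 :=
  Submodule.span ℂ ((fun j => iteratedDeriv j γ 0) '' Set.Iic k)

theorem derivSpan_mono (γ : ℂ → V4) {j k : ℕ} (h : j ≤ k) : derivSpan γ j ≤ derivSpan γ k :=
  Submodule.span_mono (Set.image_mono (Set.Iic_subset_Iic.2 h))

theorem mem_derivSpan (γ : ℂ → V4) {j k : ℕ} (h : j ≤ k) : iteratedDeriv j γ 0 ∈ derivSpan γ k :=
  Submodule.subset_span ⟨j, h, rfl⟩

theorem derivSpan_one (γ : ℂ → V4) : derivSpan γ 1 = Submodule.span ℂ {γ 0, deriv γ 0} := by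
  unfold derivSpan
  congr 1
  ext v
  simp only [Set.mem_image, Set.mem_Iic, Nat.le_one_iff_eq_zero_or_eq_one, Set.mem_insert_iff,
    Set.mem_singleton_iff]
  constructor
  · rintro ⟨j, rfl | rfl, rfl⟩
    · simp
    · simp
  · rintro (rfl | rfl)
    · exact ⟨0, by simp⟩
    · exact ⟨1, by simp⟩

/-- The first four derivatives of `γ` at `t`, starting with `γ t` itself. -/
noncomputable def frame (γ : ℂ → V4) (t : ℂ) : Fin 4 → V4 := fun j => iteratedDeriv j γ t

theorem derivSpan_three (γ : ℂ → V4) :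
    derivSpan γ 3 = Submodule.span ℂ (Set.range (frame γ 0)) := by
  unfold derivSpan
  congr 1
  ext v
  constructor
  · rintro ⟨j, hj, rfl⟩
    exact ⟨⟨j, Nat.lt_succ_iff.2 hj⟩, rfl⟩
  · rintro ⟨j, rfl⟩
    exact ⟨j, Nat.lt_succ_iff.1 j.2, rfl⟩

theorem derivSpan_three_eq_top_iff (γ : ℂ → V4) :
    derivSpan γ 3 = ⊤ ↔ LinearIndependent ℂ (frame γ 0) := by
  rw [derivSpan_three]
  constructor
  · intro h
    exact linearIndependent_of_top_le_span_of_card_eq_finrank h.ge (by simp)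
  · intro h
    exact h.span_eq_top_of_card_eq_finrank (by simp)

namespace IsLocalParam

variable {γ : ℂ → V4} {Z : Set P3} {p : P3}

theorem isConeCurve (h : IsLocalParam γ Z p) (c : ℂ) :
    IsConeCurve Z (c • γ 0) (fun t => c • γ t) := by
  refine ⟨h.1.fun_const_smul, rfl, ?_⟩
  filter_upwards [h.eventually_mem, h.eventually_ne_zero] with t ht h0
  exact ⟨_, ht, (mem_submodule_toP3 h0).2 ⟨c, rfl⟩⟩

theorem osculating_eq (h : IsLocalParam γ Z p) {z : V4} (hz : z ∈ p.submodule) (hz0 : z ≠ 0)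
    (k : ℕ) : osculating Z z k = derivSpan γ k := by
  obtain ⟨c, rfl⟩ := (mem_submodule_toP3 h.ne_zero).1 (h.eq_toP3 ▸ hz)
  have hc : c ≠ 0 := by rintro rfl; simp at hz0
  have hz' : ∀ k, c • γ 0 ∈ derivSpan γ k := fun k =>
    Submodule.smul_mem _ _ (by simpa using mem_derivSpan γ (Nat.zero_le k))
  apply le_antisymm
  · induction k with
    | zero => exact (Submodule.span_singleton_le_iff_mem _ _).2 (hz' 0)
    | succ k ih =>
      refine sup_le (ih.trans (derivSpan_mono γ k.le_succ)) (Submodule.span_le.2 ?_)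
      rintro w ⟨δ, hδ, rfl⟩
      obtain ⟨f, τ, hf, hτ, hτ0, he⟩ := h.exists_reparam_of_isConeCurve hz hz0 hδ
      obtain ⟨a, -, ha⟩ := exists_coeff_iteratedDeriv h.1 hf hτ hτ0 he (k + 1)
      rw [ha.self_of_nhds]
      simp only [hτ0]
      refine Submodule.sum_mem _ fun j hj => Submodule.smul_mem _ _ (mem_derivSpan γ ?_)
      exact Nat.lt_succ_iff.1 (Finset.mem_range.1 hj)
  · have hmem : ∀ k, iteratedDeriv k γ 0 ∈ osculating Z (c • γ 0) k := by
      intro k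
      have hcc : ∀ v : V4, v = c⁻¹ • c • v := fun v => by
        rw [smul_smul, inv_mul_cancel₀ hc, one_smul]
      rw [hcc (iteratedDeriv k γ 0)]
      refine Submodule.smul_mem _ _ ?_
      cases k with
      | zero => exact Submodule.mem_span_singleton_self _
      | succ k =>
        refine Submodule.mem_sup_right (Submodule.subset_span ⟨_, h.isConeCurve c, ?_⟩)
        rw [iteratedDeriv_fun_const_smul_field]
    have hmono : Monotone (osculating Z (c • γ 0)) := monotone_nat_of_le_succ fun k => le_sup_left
    refine Submodule.span_le.2 ?_
    rintro _ ⟨j, hj, rfl⟩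
    exact hmono hj (hmem j)

theorem osculatingFull_iff (h : IsLocalParam γ Z p) (k : ℕ) :
    OsculatingFull Z p k ↔ derivSpan γ k = ⊤ := by
  have hmem : γ 0 ∈ p.submodule := by
    rw [h.eq_toP3]
    exact mem_submodule_toP3_self h.ne_zero
  constructor
  · intro hf
    rw [← h.osculating_eq hmem h.ne_zero]
    exact hf _ hmem h.ne_zero
  · intro hs z hz hz0
    rw [h.osculating_eq hz hz0, hs]

theorem eventually_affineTangent_eq (h : IsLocalParam γ Z p) :
    ∀ᶠ t in 𝓝 0, ∀ z ∈ (toP3 (γ t)).submodule, z ≠ 0 →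
      affineTangent Z z = Submodule.span ℂ {γ t, deriv γ t} := by
  filter_upwards [h.eventually_translate] with t ht z hz hz0
  rw [affineTangent, ht.osculating_eq hz hz0, derivSpan_one, deriv_comp_const_add]
  simp

theorem isLegendrian_iff (h : IsLocalParam γ Z p) {σ : LinearMap.BilinForm ℂ V4} (hσ : σ.IsAlt) :
    IsLegendrian σ Z p ↔ ∀ᶠ t in 𝓝 0, σ (γ t) (deriv γ t) = 0 := by
  rw [IsLegendrian, h.eventually_nhdsWithin_iff]
  refine eventually_congr ?_
  filter_upwards [h.eventually_affineTangent_eq, h.eventually_ne_zero] with t ht h0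
  constructor
  · intro hL
    have hmem := mem_submodule_toP3_self h0
    refine hL _ hmem h0 _ ?_ _ ?_ <;> rw [ht _ hmem h0]
    · exact Submodule.subset_span (by simp)
    · exact Submodule.subset_span (by simp)
  · intro hz z hz' hz0 v hv w hw
    rw [ht z hz' hz0] at hv hw
    obtain ⟨a, b, rfl⟩ := Submodule.mem_span_pair.1 hv
    obtain ⟨c, d, rfl⟩ := Submodule.mem_span_pair.1 hw
    have h1 : σ (deriv γ t) (γ t) = 0 := by rw [← hσ.neg_eq, hz, neg_zero]
    simp [hz, h1, hσ.self_eq_zero]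

theorem mem_aut_iff (h : IsLocalParam γ Z p) {σ : LinearMap.BilinForm ℂ V4}
    {u : Module.End ℂ V4} :
    u ∈ aut σ Z p ↔ u ∈ csp σ ∧ ∀ᶠ t in 𝓝 0, u (γ t) ∈ Submodule.span ℂ {γ t, deriv γ t} := by
  change (_ ∧ _) ↔ _
  rw [h.eventually_nhdsWithin_iff]
  refine and_congr_right fun _ => eventually_congr ?_
  filter_upwards [h.eventually_affineTangent_eq, h.eventually_ne_zero] with t ht h0
  constructor
  · intro hL
    have hmem := mem_submodule_toP3_self h0
    rw [← ht _ hmem h0]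
    exact hL _ hmem h0
  · intro hu z hz hz0
    rw [ht z hz hz0]
    obtain ⟨c, rfl⟩ := (mem_submodule_toP3 h0).1 hz
    rw [map_smul]
    exact Submodule.smul_mem _ _ hu

theorem reparam (h : IsLocalParam γ Z p) {f τ w : ℂ → ℂ} (hf : AnalyticAt ℂ f 0) (hf0 : f 0 ≠ 0)
    (hτ : HasDerivNear τ w) (hτ0 : τ 0 = 0) (hw0 : w 0 ≠ 0) :
    IsLocalParam (fun s => f s • γ (τ s)) Z p := by
  have hd := (hasDerivNear_deriv hf).smul ((hasDerivNear_deriv h.1).comp hτ hτ0)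
  refine ⟨hd.analyticAt, ?_, ?_⟩
  · rw [hd.self_of_nhds.deriv]
    simp only [hτ0]
    rw [LinearIndependent.pair_iff]
    intro a b hab
    have h1 := LinearIndependent.pair_iff.1 h.2.1 (a * f 0 + b * deriv f 0) (b * (f 0 * w 0)) (by
      rw [← hab]; module)
    have hb : b = 0 := by simpa [hf0, hw0] using h1.2
    refine ⟨?_, hb⟩
    simpa [hb, hf0] using h1.1
  · have hmap : map τ (𝓝 0) = 𝓝 0 := by
      have h1 : HasStrictDerivAt τ (w 0) 0 := by
        rw [← hτ.self_of_nhds.deriv]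
        exact hτ.analyticAt.hasStrictDerivAt
      simpa [hτ0] using h1.map_nhds_eq hw0
    rw [← h.2.2]
    conv_rhs => rw [← hmap, map_map]
    refine Filter.map_congr ?_
    filter_upwards [(hτ.tendsto_zero hτ0).eventually h.eventually_ne_zero,
      hf.continuousAt.eventually_ne hf0] with s h1 h2
    exact toP3_smul h1 h2

/-- Two local parametrizations of a germ differ by a change of parameter and a rescaling. -/
theorem exists_reparam (h : IsLocalParam γ Z p) {γ' : ℂ → V4} (h' : IsLocalParam γ' Z p) :
    ∃ f τ w : ℂ → ℂ, AnalyticAt ℂ f 0 ∧ f 0 ≠ 0 ∧ HasDerivNear τ w ∧ τ 0 = 0 ∧ w 0 ≠ 0 ∧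
      γ' =ᶠ[𝓝 0] fun s => f s • γ (τ s) := by
  have hmem : γ' 0 ∈ p.submodule := by
    rw [h'.eq_toP3]
    exact mem_submodule_toP3_self h'.ne_zero
  have hc : IsConeCurve Z (γ' 0) γ' := by simpa using h'.isConeCurve 1
  obtain ⟨f, τ, hf, hτ, hτ0, he⟩ := h.exists_reparam_of_isConeCurve hmem h'.ne_zero hc
  have hw := hasDerivNear_deriv hτ
  have hd := (hasDerivNear_deriv hf).smul ((hasDerivNear_deriv h.1).comp hw hτ0)
  have h0 : γ' 0 = f 0 • γ 0 := by
    rw [he.self_of_nhds]; simp only [hτ0]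
  have h1 : deriv γ' 0 = f 0 • (deriv τ 0 • deriv γ 0) + deriv f 0 • γ 0 := by
    rw [he.deriv_eq, hd.self_of_nhds.deriv]; simp only [hτ0]
  have hf0 : f 0 ≠ 0 := fun hz => h'.ne_zero (by rw [h0, hz, zero_smul])
  refine ⟨f, τ, deriv τ, hf, hf0, hw, hτ0, fun hz => ?_, he⟩
  have := LinearIndependent.pair_iff.1 h'.2.1 (-deriv f 0) (f 0) (by
    rw [h0, h1, hz]; module)
  exact hf0 this.2

end IsLocalParam

theorem map_smul_nhds (g : V4 ≃ₗ[ℂ] V4) (q : P3) :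
    map (fun x : P3 => g • x) (𝓝 q) = 𝓝 (g • q) := by
  obtain ⟨v, hv, rfl⟩ := exists_eq_toP3 q
  have hgv : g v ≠ 0 := by simpa using hv
  rw [smul_toP3 g hv, nhds_toP3 hv, nhds_toP3 hgv, map_map]
  have h1 : map g (𝓝 v) = 𝓝 (g v) := g.toContinuousLinearEquiv.toHomeomorph.map_nhds_eq v
  rw [← h1, map_map]
  refine Filter.map_congr ?_
  filter_upwards [isOpen_ne.mem_nhds hv] with x hx
  exact smul_toP3 g hx

theorem map_smul_nhdsWithin (g : V4 ≃ₗ[ℂ] V4) (Z : Set P3) (q : P3) :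
    map (fun x : P3 => g • x) (𝓝[Z] q) = 𝓝[(fun x : P3 => g • x) '' Z] (g • q) := by
  rw [nhdsWithin, Filter.map_inf (MulAction.injective g), map_smul_nhds, map_principal]
  rfl

namespace IsLocalParam

variable {γ : ℂ → V4} {Z : Set P3} {p : P3}

theorem linear_image (h : IsLocalParam γ Z p) (g : V4 ≃ₗ[ℂ] V4) :
    IsLocalParam (fun t => g (γ t)) ((fun x : P3 => g • x) '' Z) (g • p) := by
  have hd := (hasDerivNear_deriv h.1).linear g.toLinearMap
  refine ⟨hd.analyticAt, ?_, ?_⟩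
  · have h1 : deriv (fun t => g (γ t)) 0 = g (deriv γ 0) := hd.self_of_nhds.deriv
    rw [h1]
    have h2 := h.2.1.map' g.toLinearMap (LinearEquiv.ker g)
    have h3 : (g.toLinearMap ∘ ![γ 0, deriv γ 0]) = ![g (γ 0), g (deriv γ 0)] := by
      ext1 i
      fin_cases i <;> rfl
    rwa [h3] at h2
  · rw [← map_smul_nhdsWithin, ← h.2.2, map_map]
    refine Filter.map_congr ?_
    filter_upwards [h.eventually_ne_zero] with t ht
    exact (smul_toP3 g ht).symm

theorem of_nhdsWithin_eq (h : IsLocalParam γ Z p) {Z' : Set P3} (hZ : 𝓝[Z] p = 𝓝[Z'] p) :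
    IsLocalParam γ Z' p :=
  ⟨h.1, h.2.1, h.2.2.trans hZ⟩

theorem exists_of_projEquiv (h : IsLocalParam γ Z p) {Z' : Set P3} {p' : P3}
    (he : ProjEquiv Z p Z' p') : ∃ g : V4 ≃ₗ[ℂ] V4, IsLocalParam (fun t => g (γ t)) Z' p' := by
  obtain ⟨g, rfl, hg⟩ := he
  exact ⟨g, (h.linear_image g).of_nhdsWithin_eq
    (nhdsWithin_eq_iff_eventuallyEq.2 (eventuallyEq_set.2 hg))⟩

/-- A germ with local parametrization `g ∘ γ` is projectively equivalent to one with local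
parametrization `γ`. -/
theorem exists_projEquiv {g : V4 ≃ₗ[ℂ] V4} (h : IsLocalParam (fun t => g (γ t)) Z p) :
    ∃ (Z₀ : Set P3) (p₀ : P3), IsLocalParam γ Z₀ p₀ ∧ ProjEquiv Z₀ p₀ Z p := by
  refine ⟨(fun x : P3 => g.symm • x) '' Z, g.symm • p, ?_, g, ?_, ?_⟩
  · simpa using h.linear_image g.symm
  · exact smul_inv_smul g p
  · refine Eventually.of_forall fun q => ?_
    rw [Set.image_image]
    have : (fun x : P3 => g • g.symm • x) = id := funext fun x => smul_inv_smul g x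
    rw [this, Set.image_id]

end IsLocalParam

/-! ### Linear differential equations of fourth order and the model curves -/

/-- Near `0`, the components of `γ` solve `h'''' = c₂ h'' + c₁ h' + c₀ h`. -/
def SolvesODE (γ : ℂ → V4) (c₂ c₁ c₀ : ℂ → ℂ) : Prop :=
  ∀ᶠ t in 𝓝 (0 : ℂ), iteratedDeriv 4 γ t =
    c₂ t • iteratedDeriv 2 γ t + c₁ t • deriv γ t + c₀ t • γ t

theorem frame_zero (γ : ℂ → V4) (t : ℂ) : frame γ t 0 = γ t := by simp [frame]

theorem frame_one (γ : ℂ → V4) (t : ℂ) : frame γ t 1 = deriv γ t := by simp [frame]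

theorem frame_two (γ : ℂ → V4) (t : ℂ) : frame γ t 2 = iteratedDeriv 2 γ t := rfl

theorem hasDerivNear_one {γ : ℂ → V4} (h : AnalyticAt ℂ γ 0) :
    HasDerivNear (deriv γ) (iteratedDeriv 2 γ) := by
  simpa using hasDerivNear_iteratedDeriv h 1

theorem linearIndependent_pair_of_frame {γ : ℂ → V4} (h : LinearIndependent ℂ (frame γ 0)) :
    LinearIndependent ℂ ![γ 0, deriv γ 0] := by
  have h1 := h.comp ![0, 1] (by decide)
  have h2 : frame γ 0 ∘ ![0, 1] = ![γ 0, deriv γ 0] := by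
    ext1 i
    fin_cases i
    · exact frame_zero γ 0
    · exact frame_one γ 0
  rwa [h2] at h1

theorem iteratedDeriv_linear {γ : ℂ → V4} (hγ : AnalyticAt ℂ γ 0) (u : V4 →ₗ[ℂ] V4) (k : ℕ) :
    iteratedDeriv k (fun t => u (γ t)) =ᶠ[𝓝 0] fun t => u (iteratedDeriv k γ t) := by
  induction k with
  | zero => simp
  | succ k ih =>
    exact eventuallyEq_iteratedDeriv_succ ((hasDerivNear_deriv hγ).linear u).analyticAt ih
      ((hasDerivNear_iteratedDeriv hγ k).linear u)

theorem iteratedDeriv_eventuallyEq {E : Type*} [NormedAddCommGroup E] [NormedSpace ℂ E]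
    {γ δ : ℂ → E} (h : γ =ᶠ[𝓝 0] δ) (k : ℕ) : iteratedDeriv k γ =ᶠ[𝓝 0] iteratedDeriv k δ := by
  filter_upwards [h.eventually_nhds] with t ht
  exact EventuallyEq.iteratedDeriv_eq k ht

theorem SolvesODE.congr {γ δ : ℂ → V4} {c₂ c₁ c₀ : ℂ → ℂ} (h : SolvesODE γ c₂ c₁ c₀)
    (he : δ =ᶠ[𝓝 0] γ) : SolvesODE δ c₂ c₁ c₀ := by
  filter_upwards [h, iteratedDeriv_eventuallyEq he 4, iteratedDeriv_eventuallyEq he 2, he,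
    he.deriv] with t h1 h2 h3 h4 h5
  rw [h2, h3, h4, h5, h1]

theorem SolvesODE.linear {γ : ℂ → V4} {c₂ c₁ c₀ : ℂ → ℂ} (hγ : AnalyticAt ℂ γ 0)
    (h : SolvesODE γ c₂ c₁ c₀) (u : V4 →ₗ[ℂ] V4) :
    SolvesODE (fun t => u (γ t)) c₂ c₁ c₀ := by
  have h1' := iteratedDeriv_linear hγ u 1
  simp only [iteratedDeriv_one] at h1'
  filter_upwards [h, iteratedDeriv_linear hγ u 4, iteratedDeriv_linear hγ u 2, h1']
    with t h1 h2 h3 h4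
  rw [h2, h3, h4, h1]
  simp

/-- A solution of the linear equation satisfied by a curve `γ` with independent frame is the image
of `γ` under a linear map. -/
theorem exists_linearMap_of_solvesODE {γ G : ℂ → V4} {c₂ c₁ c₀ : ℂ → ℂ}
    (hγ : AnalyticAt ℂ γ 0) (hG : AnalyticAt ℂ G 0) (hc₂ : AnalyticAt ℂ c₂ 0)
    (hc₁ : AnalyticAt ℂ c₁ 0) (hc₀ : AnalyticAt ℂ c₀ 0) (h : SolvesODE γ c₂ c₁ c₀)
    (h' : SolvesODE G c₂ c₁ c₀) (hi : LinearIndependent ℂ (frame γ 0)) :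
    ∃ u : V4 →ₗ[ℂ] V4, (∀ j, u (frame γ 0 j) = frame G 0 j) ∧ G =ᶠ[𝓝 0] fun t => u (γ t) := by
  let b := basisOfLinearIndependentOfCardEqFinrank hi (by simp)
  let u : V4 →ₗ[ℂ] V4 := b.constr ℂ (frame G 0)
  have hu : ∀ j, u (frame γ 0 j) = frame G 0 j := fun j => by
    have h1 := b.constr_basis ℂ (frame G 0) j
    rwa [coe_basisOfLinearIndependentOfCardEqFinrank] at h1
  refine ⟨u, hu, ?_⟩
  have d : ∀ k, HasDerivNear (fun t => iteratedDeriv k G t - u (iteratedDeriv k γ t))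
      (fun t => iteratedDeriv (k + 1) G t - u (iteratedDeriv (k + 1) γ t)) := fun k =>
    (hasDerivNear_iteratedDeriv hG k).sub ((hasDerivNear_iteratedDeriv hγ k).linear u)
  have hz := eventually_eq_zero_of_linear_ode hc₀ hc₁ hc₂ (d 0) (d 1) (d 2)
    ((d 3).congr_right ?_) (sub_eq_zero.2 (hu 0).symm) (sub_eq_zero.2 (hu 1).symm)
    (sub_eq_zero.2 (hu 2).symm) (sub_eq_zero.2 (hu 3).symm)
  · filter_upwards [hz] with t ht
    simpa [sub_eq_zero] using ht
  · filter_upwards [h, h'] with t h1 h2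
    simp only [Nat.reduceAdd, h1, h2, iteratedDeriv_one, iteratedDeriv_zero, map_add, map_smul]
    module

theorem exists_linearEquiv_of_solvesODE {γ G : ℂ → V4} {c₂ c₁ c₀ : ℂ → ℂ}
    (hγ : AnalyticAt ℂ γ 0) (hG : AnalyticAt ℂ G 0) (hc₂ : AnalyticAt ℂ c₂ 0)
    (hc₁ : AnalyticAt ℂ c₁ 0) (hc₀ : AnalyticAt ℂ c₀ 0) (h : SolvesODE γ c₂ c₁ c₀)
    (h' : SolvesODE G c₂ c₁ c₀) (hi : LinearIndependent ℂ (frame γ 0))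
    (hi' : LinearIndependent ℂ (frame G 0)) :
    ∃ g : V4 ≃ₗ[ℂ] V4, G =ᶠ[𝓝 0] fun t => g (γ t) := by
  obtain ⟨u, hu, hG'⟩ := exists_linearMap_of_solvesODE hγ hG hc₂ hc₁ hc₀ h h' hi
  have hsurj : Function.Surjective u := by
    rw [← LinearMap.range_eq_top, eq_top_iff,
      ← hi'.span_eq_top_of_card_eq_finrank (by simp), Submodule.span_le]
    rintro _ ⟨j, rfl⟩
    exact ⟨_, hu j⟩
  exact ⟨LinearEquiv.ofBijective u ⟨LinearMap.injective_iff_surjective.2 hsurj, hsurj⟩, hG'⟩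

section

attribute [local instance] Matrix.linftyOpNormedRing Matrix.linftyOpNormedAlgebra

theorem hasDerivAt_exp_mulVec (A : Matrix (Fin 4) (Fin 4) ℂ) (v : V4) (t : ℂ) :
    HasDerivAt (fun t : ℂ => (NormedSpace.exp (t • A)).mulVec v)
      (A.mulVec ((NormedSpace.exp (t • A)).mulVec v)) t := by
  have h := hasDerivAt_exp_smul_const' (𝕂 := ℂ) A t
  let L : Matrix (Fin 4) (Fin 4) ℂ →ₗ[ℂ] V4 :=
    { toFun := fun M => M.mulVec v
      map_add' := fun M N => Matrix.add_mulVec M N v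
      map_smul' := fun c M => Matrix.smul_mulVec c M v }
  have h2 := (LinearMap.toContinuousLinearMap L).hasFDerivAt.comp_hasDerivAt t h
  rw [Matrix.mulVec_mulVec]
  exact h2

end

theorem hasDerivAt_modelCurve (r t : ℂ) :
    HasDerivAt (modelCurve r) ((modelMatrix r).mulVec (modelCurve r t)) t :=
  hasDerivAt_exp_mulVec _ _ t

theorem analyticAt_modelCurve (r : ℂ) : AnalyticAt ℂ (modelCurve r) 0 :=
  HasDerivNear.analyticAt (Eventually.of_forall (hasDerivAt_modelCurve r))

theorem iteratedDeriv_modelCurve (r : ℂ) (k : ℕ) :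
    iteratedDeriv k (modelCurve r) = fun t => (modelMatrix r ^ k).mulVec (modelCurve r t) := by
  induction k with
  | zero => simp
  | succ k ih =>
    rw [iteratedDeriv_succ, ih]
    funext t
    have h := (LinearMap.toContinuousLinearMap
      (Matrix.mulVecLin (modelMatrix r ^ k))).hasFDerivAt.comp_hasDerivAt t
      (hasDerivAt_modelCurve r t)
    refine h.deriv.trans ?_
    simp [Matrix.mulVec_mulVec, pow_succ]

theorem modelMatrix_pow_four (r : ℂ) :
    modelMatrix r ^ 4 = (1 + r ^ 2) • modelMatrix r ^ 2 - r ^ 2 • 1 := by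
  have h4 : ∀ M : Matrix (Fin 4) (Fin 4) ℂ, M ^ 4 = (M * M) * (M * M) := fun M => by
    rw [← mul_assoc, ← pow_two, ← pow_succ, ← pow_succ]
  rw [h4, pow_two (modelMatrix r)]
  unfold modelMatrix
  split_ifs with h0 h1
  · rw [h0]
    ext i j
    fin_cases i <;> fin_cases j <;> simp [Matrix.mul_apply, Fin.sum_univ_four]
  · rw [h1]
    ext i j
    fin_cases i <;> fin_cases j <;>
      simp [Matrix.mul_apply, Fin.sum_univ_four] <;> norm_num
  · ext i j
    fin_cases i <;> fin_cases j <;>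
      simp [Matrix.mul_apply, Fin.sum_univ_four] <;> ring

theorem solvesODE_modelCurve (r : ℂ) :
    SolvesODE (modelCurve r) (fun _ => 1 + r ^ 2) (fun _ => 0) (fun _ => -r ^ 2) := by
  refine Eventually.of_forall fun t => ?_
  rw [iteratedDeriv_modelCurve, iteratedDeriv_modelCurve, modelMatrix_pow_four]
  simp only [Matrix.sub_mulVec, Matrix.smul_mulVec, Matrix.one_mulVec]
  module

theorem linearIndependent_frame_modelCurve (r : ℂ) :
    LinearIndependent ℂ (frame (modelCurve r) 0) := by
  refine Matrix.linearIndependent_rows_of_det_ne_zero (A := Matrix.of (frame (modelCurve r) 0)) ?_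
  have hv : modelCurve r 0 = ![1, 1, 1, 1] := by simp [modelCurve]
  have h0 : frame (modelCurve r) 0 0 = ![1, 1, 1, 1] := by rw [frame_zero, hv]
  have hs : ∀ j : Fin 4, frame (modelCurve r) 0 j = (modelMatrix r ^ (j : ℕ)).mulVec ![1, 1, 1, 1] :=
    fun j => by
    rw [frame, iteratedDeriv_modelCurve]
    simp only [hv]
  have h1 : frame (modelCurve r) 0 1 = (modelMatrix r).mulVec ![1, 1, 1, 1] := by simp [hs]
  have h2 : frame (modelCurve r) 0 2 =
      (modelMatrix r).mulVec ((modelMatrix r).mulVec ![1, 1, 1, 1]) := by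
    simp [hs, pow_two]
  have h3 : frame (modelCurve r) 0 3 =
      (modelMatrix r).mulVec ((modelMatrix r).mulVec ((modelMatrix r).mulVec ![1, 1, 1, 1])) := by
    simp [hs, pow_succ, mul_assoc]
  have hf : Matrix.of (frame (modelCurve r) 0) = Matrix.of ![frame (modelCurve r) 0 0,
      frame (modelCurve r) 0 1, frame (modelCurve r) 0 2, frame (modelCurve r) 0 3] := by
    congr 1
    ext1 i
    fin_cases i <;> rfl
  rw [hf, h0, h1, h2, h3]
  by_cases e0 : r ^ 2 = 0
  · have hM : ∀ a b c d, (modelMatrix r).mulVec ![a, b, c, d] = ![a, c, 0, -d] := fun a b c d => by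
      ext i
      fin_cases i <;> simp [modelMatrix, e0, Matrix.mulVec, dotProduct, Fin.sum_univ_four]
    simp only [hM]
    rw [Matrix.det_succ_row_zero]
    simp [Fin.sum_univ_succ, Fin.succAbove, Matrix.det_fin_three]
  by_cases e1 : r ^ 2 = 1
  · have hM : ∀ a b c d, (modelMatrix r).mulVec ![a, b, c, d] = ![a + b, b, -c + d, -d] :=
      fun a b c d => by
        ext i
        fin_cases i <;> simp [modelMatrix, e1, Matrix.mulVec, dotProduct, Fin.sum_univ_four]
    simp only [hM]
    rw [Matrix.det_succ_row_zero]
    simp [Fin.sum_univ_succ, Fin.succAbove, Matrix.det_fin_three]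
    norm_num
  · have hM : ∀ a b c d, (modelMatrix r).mulVec ![a, b, c, d] = ![r * a, b, -c, -(r * d)] :=
      fun a b c d => by
        have e0' : r ≠ 0 := by simpa using e0
        ext i
        fin_cases i <;>
          simp [modelMatrix, e0', e1, Matrix.mulVec, dotProduct, Fin.sum_univ_four]
    simp only [hM]
    intro hd
    have hr : r * (r ^ 2 - 1) ^ 2 = 0 := by
      rw [Matrix.det_succ_row_zero] at hd
      simp [Fin.sum_univ_succ, Fin.succAbove, Matrix.det_fin_three] at hd
      linear_combination hd / 4
    have hr0 : r ≠ 0 := by simpa using e0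
    exact mul_ne_zero hr0 (pow_ne_zero 2 (sub_ne_zero.2 e1)) hr

theorem linearIndependent_frame_linear {γ : ℂ → V4} (hγ : AnalyticAt ℂ γ 0)
    (hi : LinearIndependent ℂ (frame γ 0)) (g : V4 ≃ₗ[ℂ] V4) :
    LinearIndependent ℂ (frame (fun t => g (γ t)) 0) := by
  have h1 := hi.map' g.toLinearMap (LinearEquiv.ker g)
  have h2 : g.toLinearMap ∘ frame γ 0 = frame (fun t => g (γ t)) 0 :=
    funext fun j => ((iteratedDeriv_linear hγ g.toLinearMap j).self_of_nhds).symm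
  rwa [h2] at h1

/-- Up to linear equivalence, the class is described by the differential equation
`h'''' = (1 + r²) h'' - r² h`. -/
theorem mem_classL_iff {r : ℂ} {Z : Set P3} {p : P3} :
    (Z, p) ∈ classL r ↔ ∃ γ : ℂ → V4, IsLocalParam γ Z p ∧
      SolvesODE γ (fun _ => 1 + r ^ 2) (fun _ => 0) (fun _ => -r ^ 2) ∧
      LinearIndependent ℂ (frame γ 0) := by
  constructor
  · rintro ⟨Z₀, p₀, h, he⟩
    obtain ⟨g, hg⟩ := h.exists_of_projEquiv he
    exact ⟨_, hg, (solvesODE_modelCurve r).linear (analyticAt_modelCurve r) g.toLinearMap,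
      linearIndependent_frame_linear (analyticAt_modelCurve r)
        (linearIndependent_frame_modelCurve r) g⟩
  · rintro ⟨γ, hγ, hs, hi⟩
    obtain ⟨g, hg⟩ := exists_linearEquiv_of_solvesODE (analyticAt_modelCurve r) hγ.1
      analyticAt_const analyticAt_const analyticAt_const (solvesODE_modelCurve r) hs
      (linearIndependent_frame_modelCurve r) hi
    exact (hγ.congr hg.symm).exists_projEquiv

theorem classL_nonempty (r : ℂ) : (classL r).Nonempty := by
  have hi := linearIndependent_frame_modelCurve r
  obtain ⟨Z, hZ⟩ := exists_isLocalParam (analyticAt_modelCurve r)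
    (linearIndependent_pair_of_frame hi)
  exact ⟨(Z, _), mem_classL_iff.2 ⟨_, hZ, solvesODE_modelCurve r, hi⟩⟩

/-! ### The symplectic form along a Legendrian curve -/

/-- The function `σ(γ⁽ⁱ⁾, γ⁽ʲ⁾)`. -/
noncomputable def pairing (σ : LinearMap.BilinForm ℂ V4) (γ : ℂ → V4) (i j : ℕ) (t : ℂ) : ℂ :=
  σ (iteratedDeriv i γ t) (iteratedDeriv j γ t)

section pairing

variable {σ : LinearMap.BilinForm ℂ V4} {γ : ℂ → V4}

theorem hasDerivNear_pairing (hγ : AnalyticAt ℂ γ 0) (i j : ℕ) :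
    HasDerivNear (pairing σ γ i j)
      (fun t => pairing σ γ (i + 1) j t + pairing σ γ i (j + 1) t) :=
  (hasDerivNear_iteratedDeriv hγ i).bilin σ (hasDerivNear_iteratedDeriv hγ j)

theorem pairing_self (hσ : σ.IsAlt) (i : ℕ) (t : ℂ) : pairing σ γ i i t = 0 := hσ.self_eq_zero _

theorem pairing_swap (hσ : σ.IsAlt) (i j : ℕ) (t : ℂ) :
    pairing σ γ j i t = -pairing σ γ i j t := (hσ.neg_eq _ _).symm

theorem eventually_pairing_zero_two (hσ : σ.IsAlt) (hγ : AnalyticAt ℂ γ 0)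
    (hL : ∀ᶠ t in 𝓝 0, pairing σ γ 0 1 t = 0) : ∀ᶠ t in 𝓝 0, pairing σ γ 0 2 t = 0 := by
  have h := (hasDerivNear_pairing (σ := σ) hγ 0 1).unique (HasDerivNear.const 0) hL
  filter_upwards [h] with t ht
  simpa [pairing_self hσ] using ht

theorem eventually_pairing_zero_three (hσ : σ.IsAlt) (hγ : AnalyticAt ℂ γ 0)
    (hL : ∀ᶠ t in 𝓝 0, pairing σ γ 0 1 t = 0) :
    ∀ᶠ t in 𝓝 0, pairing σ γ 0 3 t = -pairing σ γ 1 2 t := by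
  have h := (hasDerivNear_pairing (σ := σ) hγ 0 2).unique (HasDerivNear.const 0)
    (eventually_pairing_zero_two hσ hγ hL)
  filter_upwards [h] with t ht
  simp only [Nat.reduceAdd] at ht
  linear_combination ht

/-- The Gram matrix of the frame has Pfaffian `-a²` with `a = σ(γ', γ'')`; so the frame is
independent where `a` does not vanish. -/
theorem linearIndependent_frame {t : ℂ} (hσ : σ.IsAlt) (h01 : pairing σ γ 0 1 t = 0)
    (h02 : pairing σ γ 0 2 t = 0) (h03 : pairing σ γ 0 3 t = -pairing σ γ 1 2 t)
    (h12 : pairing σ γ 1 2 t ≠ 0) : LinearIndependent ℂ (frame γ t) := by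
  rw [Fintype.linearIndependent_iff]
  intro x hx
  have hp : ∀ i, x 0 * pairing σ γ i 0 t + x 1 * pairing σ γ i 1 t + x 2 * pairing σ γ i 2 t +
      x 3 * pairing σ γ i 3 t = 0 := fun i => by
    have := congrArg (σ (iteratedDeriv i γ t)) hx
    simpa [Fin.sum_univ_four, frame, pairing] using this
  have s10 := pairing_swap (γ := γ) hσ 0 1 t
  have s20 := pairing_swap (γ := γ) hσ 0 2 t
  have s30 := pairing_swap (γ := γ) hσ 0 3 t
  have s21 := pairing_swap (γ := γ) hσ 1 2 t
  have x3 : x 3 = 0 := by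
    have := hp 0
    rw [pairing_self hσ, h01, h02, h03] at this
    have h' : x 3 * pairing σ γ 1 2 t = 0 := by linear_combination -this
    exact (mul_eq_zero.1 h').resolve_right h12
  have x2 : x 2 = 0 := by
    have := hp 1
    rw [pairing_self hσ, s10, h01, x3] at this
    have h' : x 2 * pairing σ γ 1 2 t = 0 := by linear_combination this
    exact (mul_eq_zero.1 h').resolve_right h12
  have x1 : x 1 = 0 := by
    have := hp 2
    rw [pairing_self hσ, s20, h02, s21, x3] at this
    have h' : x 1 * pairing σ γ 1 2 t = 0 := by linear_combination -this
    exact (mul_eq_zero.1 h').resolve_right h12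
  have x0 : x 0 = 0 := by
    have := hp 3
    rw [pairing_self hσ, s30, h03, x1, x2] at this
    have h' : x 0 * pairing σ γ 1 2 t = 0 := by linear_combination this
    exact (mul_eq_zero.1 h').resolve_right h12
  intro i
  fin_cases i
  · exact x0
  · exact x1
  · exact x2
  · exact x3

theorem eq_zero_of_pairing_frame {t : ℂ} (hσ : IsSymplectic σ)
    (hi : LinearIndependent ℂ (frame γ t)) {v : V4} (h : ∀ j, σ (frame γ t j) v = 0) : v = 0 := by
  have hsp : ∀ w, σ w v = 0 := by
    intro w
    have hw : w ∈ Submodule.span ℂ (Set.range (frame γ t)) := by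
      rw [hi.span_eq_top_of_card_eq_finrank (by simp)]
      trivial
    induction hw using Submodule.span_induction with
    | mem x hx => obtain ⟨j, rfl⟩ := hx; exact h j
    | zero => simp
    | add x y _ _ hx hy => simp [hx, hy]
    | smul c x _ hx => simp [hx]
  exact hσ.2.2 v hsp

theorem pairing_one_two_ne_zero {t : ℂ} (hσ : IsSymplectic σ) (h01 : pairing σ γ 0 1 t = 0)
    (h02 : pairing σ γ 0 2 t = 0) (h03 : pairing σ γ 0 3 t = -pairing σ γ 1 2 t)
    (hi : LinearIndependent ℂ (frame γ t)) : pairing σ γ 1 2 t ≠ 0 := by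
  intro h12
  have h0 : frame γ t 0 = 0 := by
    refine eq_zero_of_pairing_frame hσ hi fun j => ?_
    have hs : σ (frame γ t j) (frame γ t 0) = -pairing σ γ 0 j t := pairing_swap hσ.1 0 j t
    rw [hs, neg_eq_zero]
    fin_cases j
    · exact pairing_self hσ.1 0 t
    · exact h01
    · exact h02
    · exact h03.trans (by rw [h12, neg_zero])
  exact hi.ne_zero 0 h0

/-- If `σ(γ', γ'')` vanishes identically, the osculating spaces stay in the hyperplane
orthogonal to `γ 0`. -/
theorem derivSpan_ne_top (hσ : IsSymplectic σ) (hγ : AnalyticAt ℂ γ 0)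
    (hi : LinearIndependent ℂ ![γ 0, deriv γ 0])
    (hL : ∀ᶠ t in 𝓝 0, pairing σ γ 0 1 t = 0) (h12 : ∀ᶠ t in 𝓝 0, pairing σ γ 1 2 t = 0)
    (k : ℕ) : derivSpan γ k ≠ ⊤ := by
  have hindep : ∀ᶠ t in 𝓝 0, LinearIndependent ℂ ![γ t, deriv γ t] := by
    have hc : ContinuousAt (fun t => (![γ t, deriv γ t] : Fin 2 → V4)) 0 := by
      refine continuousAt_pi.2 fun i => ?_
      fin_cases i
      · exact hγ.continuousAt
      · exact hγ.deriv.continuousAt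
    exact hc.eventually (isOpen_setOfPred_linearIndependent.mem_nhds hi)
  -- `γ''` is orthogonal to the Lagrangian plane spanned by `γ` and `γ'`, so it lies in it.
  have hmem : ∀ᶠ t in 𝓝 0, iteratedDeriv 2 γ t ∈ Submodule.span ℂ {γ t, deriv γ t} := by
    filter_upwards [hindep, hL, eventually_pairing_zero_two hσ.1 hγ hL, h12] with t hit h01 h02 h12
    let W := Submodule.span ℂ (Set.range ![γ t, deriv γ t])
    have hWr : Set.range ![γ t, deriv γ t] = {γ t, deriv γ t} := by
      simp [Set.pair_comm]
    have hW2 : Module.finrank ℂ W = 2 := by simpa using finrank_span_eq_card hit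
    have hge : ∀ v : V4, σ (γ t) v = 0 → σ (deriv γ t) v = 0 → v ∈ σ.orthogonal W := by
      intro v h0 h1
      rw [LinearMap.BilinForm.mem_orthogonal_iff]
      intro w hw
      change w ∈ Submodule.span ℂ (Set.range ![γ t, deriv γ t]) at hw
      rw [hWr] at hw
      obtain ⟨a, b, rfl⟩ := Submodule.mem_span_pair.1 hw
      simp [h0, h1]
    have e01 : σ (γ t) (deriv γ t) = 0 := by simpa [pairing] using h01
    have e10 : σ (deriv γ t) (γ t) = 0 := by rw [← hσ.1.neg_eq, e01, neg_zero]
    have hWle : W ≤ σ.orthogonal W := by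
      refine Submodule.span_le.2 ?_
      rw [hWr]
      rintro v (rfl | rfl)
      · exact hge _ (hσ.1.self_eq_zero _) e10
      · exact hge _ e01 (hσ.1.self_eq_zero _)
    have hO2 : Module.finrank ℂ (σ.orthogonal W) = 2 := by
      have := LinearMap.BilinForm.finrank_orthogonal hσ.2 W
      rw [hW2] at this
      simpa using this
    have hWeq : W = σ.orthogonal W := Submodule.eq_of_le_of_finrank_eq hWle (hW2.trans hO2.symm)
    rw [← hWr]
    change _ ∈ W
    rw [hWeq]
    refine hge _ ?_ ?_
    · simpa [pairing] using h02
    · simpa [pairing] using h12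
  have hall : ∀ k, (∀ᶠ t in 𝓝 0, pairing σ γ 0 k t = 0) ∧ ∀ᶠ t in 𝓝 0, pairing σ γ 1 k t = 0 := by
    intro k
    induction k with
    | zero =>
      refine ⟨Eventually.of_forall (pairing_self hσ.1 0), hL.mono fun t ht => ?_⟩
      rw [pairing_swap hσ.1 0 1, ht, neg_zero]
    | succ k ih =>
      have d0 := (hasDerivNear_pairing (σ := σ) hγ 0 k).unique (HasDerivNear.const 0) ih.1
      have d1 := (hasDerivNear_pairing (σ := σ) hγ 1 k).unique (HasDerivNear.const 0) ih.2
      constructor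
      · filter_upwards [d0, ih.2] with t ht h1
        simpa [h1] using ht
      · filter_upwards [d1, ih.1, ih.2, hmem] with t ht h0 h1 hm
        obtain ⟨a, b, hab⟩ := Submodule.mem_span_pair.1 hm
        have h2 : pairing σ γ 2 k t = 0 := by
          simp only [pairing, iteratedDeriv_zero, iteratedDeriv_one] at h0 h1 ⊢
          rw [← hab]
          simp [h0, h1]
        simpa [h2] using ht
  intro htop
  have hle : derivSpan γ k ≤ LinearMap.ker (σ (γ 0)) := by
    refine Submodule.span_le.2 ?_
    rintro _ ⟨j, -, rfl⟩
    simpa [pairing] using (hall j).1.self_of_nhds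
  rw [htop] at hle
  have : γ 0 = 0 := hσ.2.1 (γ 0) fun w => hle trivial
  exact linearIndependent_pair_ne_zero hi this

/-- A Legendrian curve normalized by `σ(γ', γ'') = const` satisfies
`γ'''' = c₂ γ'' + c₂' γ' + c₀ γ`. -/
theorem exists_solvesODE (hσ : IsSymplectic σ) (hγ : AnalyticAt ℂ γ 0)
    (hL : ∀ᶠ t in 𝓝 0, pairing σ γ 0 1 t = 0) {a : ℂ} (ha : a ≠ 0)
    (h12 : ∀ᶠ t in 𝓝 0, pairing σ γ 1 2 t = a) :
    ∃ c₂ c₀ : ℂ → ℂ, AnalyticAt ℂ c₂ 0 ∧ AnalyticAt ℂ c₀ 0 ∧ SolvesODE γ c₂ (deriv c₂) c₀ := by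
  have an : ∀ i j, AnalyticAt ℂ (pairing σ γ i j) 0 := fun i j =>
    (hasDerivNear_pairing hγ i j).analyticAt
  have h02 := eventually_pairing_zero_two hσ.1 hγ hL
  have h03 := eventually_pairing_zero_three hσ.1 hγ hL
  have h13 : ∀ᶠ t in 𝓝 0, pairing σ γ 1 3 t = 0 := by
    have h := (hasDerivNear_pairing (σ := σ) hγ 1 2).unique (HasDerivNear.const a) h12
    filter_upwards [h] with t ht
    simpa [pairing_self hσ.1] using ht
  have h04 : ∀ᶠ t in 𝓝 0, pairing σ γ 0 4 t = 0 := by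
    have h := (hasDerivNear_pairing (σ := σ) hγ 0 3).unique (HasDerivNear.const (-a)) (by
      filter_upwards [h03, h12] with t h1 h2
      rw [h1, h2])
    filter_upwards [h, h13] with t ht h1
    simpa [h1] using ht
  have h23 : ∀ᶠ t in 𝓝 0, pairing σ γ 2 3 t = -pairing σ γ 1 4 t := by
    have h := (hasDerivNear_pairing (σ := σ) hγ 1 3).unique (HasDerivNear.const 0) h13
    filter_upwards [h] with t ht
    simp only [Nat.reduceAdd] at ht
    linear_combination ht
  let c₂ : ℂ → ℂ := fun t => a⁻¹ * pairing σ γ 1 4 t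
  have hc₂ : AnalyticAt ℂ c₂ 0 := analyticAt_const.mul (an 1 4)
  have hc₂' : ∀ t, pairing σ γ 1 4 t = a * c₂ t := fun t => by
    simp only [c₂]
    field_simp
  have h24 : ∀ᶠ t in 𝓝 0, pairing σ γ 2 4 t = -a * deriv c₂ t := by
    have h := (hasDerivNear_pairing (σ := σ) hγ 2 3).unique
      ((hasDerivNear_deriv hc₂).const_mul (-a)) (by
        filter_upwards [h23] with t h1
        rw [h1, hc₂']
        ring)
    filter_upwards [h] with t ht
    simpa [pairing_self hσ.1] using ht
  refine ⟨c₂, fun t => a⁻¹ * (pairing σ γ 3 4 t - a * c₂ t ^ 2), hc₂,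
    analyticAt_const.mul ((an 3 4).sub (analyticAt_const.mul (hc₂.pow 2))), ?_⟩
  filter_upwards [hL, h02, h03, h12, h13, h04, h23, h24] with t e01 e02 e03 e12 e13 e04 e23 e24
  have hi := linearIndependent_frame hσ.1 e01 e02 e03 (by rw [e12]; exact ha)
  rw [← sub_eq_zero]
  refine eq_zero_of_pairing_frame hσ hi fun j => ?_
  have hexp : σ (frame γ t j) (iteratedDeriv 4 γ t - (c₂ t • iteratedDeriv 2 γ t +
      deriv c₂ t • deriv γ t + (a⁻¹ * (pairing σ γ 3 4 t - a * c₂ t ^ 2)) • γ t)) =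
      pairing σ γ j 4 t - (c₂ t * pairing σ γ j 2 t + deriv c₂ t * pairing σ γ j 1 t +
        (a⁻¹ * (pairing σ γ 3 4 t - a * c₂ t ^ 2)) * pairing σ γ j 0 t) := by
    simp [frame, pairing]
  rw [hexp]
  have s10 := pairing_swap (γ := γ) hσ.1 0 1 t
  have s20 := pairing_swap (γ := γ) hσ.1 0 2 t
  have s30 := pairing_swap (γ := γ) hσ.1 0 3 t
  have s21 := pairing_swap (γ := γ) hσ.1 1 2 t
  have s31 := pairing_swap (γ := γ) hσ.1 1 3 t
  have s32 := pairing_swap (γ := γ) hσ.1 2 3 t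
  have e14 := hc₂' t
  fin_cases j
  · simp [e04, e02, e01, pairing_self hσ.1]
  · simp [e14, e12, s10, e01, pairing_self hσ.1]
    ring
  · simp [e24, s21, e12, s20, e02, pairing_self hσ.1]
    ring
  · change pairing σ γ 3 4 t - (c₂ t * pairing σ γ 3 2 t + deriv c₂ t * pairing σ γ 3 1 t +
      (a⁻¹ * (pairing σ γ 3 4 t - a * c₂ t ^ 2)) * pairing σ γ 3 0 t) = 0
    rw [s32, e23, e14, s31, e13, s30, e03, e12]
    field_simp
    ring

/-- Along a Legendrian solution of a linear equation without third order term, `σ(γ', γ'')` is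
constant. -/
theorem eventually_pairing_one_two_eq (hσ : IsSymplectic σ) (hγ : AnalyticAt ℂ γ 0)
    (hL : ∀ᶠ t in 𝓝 0, pairing σ γ 0 1 t = 0) {c₂ c₁ c₀ : ℂ → ℂ} (h : SolvesODE γ c₂ c₁ c₀) :
    ∀ᶠ t in 𝓝 0, pairing σ γ 1 2 t = pairing σ γ 1 2 0 := by
  refine (hasDerivNear_pairing hγ 1 2).eventually_const ?_
  have h03 := eventually_pairing_zero_three hσ.1 hγ hL
  have h1 := (hasDerivNear_pairing (σ := σ) hγ 0 3).unique
    ((hasDerivNear_pairing (σ := σ) hγ 1 2).const_mul (-1)) (by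
      filter_upwards [h03] with t ht
      rw [ht]
      ring)
  filter_upwards [h1, h, hL, eventually_pairing_zero_two hσ.1 hγ hL] with t ht hode e01 e02
  have e04 : pairing σ γ 0 4 t = 0 := by
    have h00 := hσ.1.self_eq_zero (γ t)
    simp only [pairing, iteratedDeriv_zero, iteratedDeriv_one] at e01 e02 ⊢
    rw [hode]
    simp [e01, e02, h00]
  simp only [Nat.reduceAdd, pairing_self hσ.1, e04] at ht ⊢
  linear_combination ht / 2

/-- Behaviour of the Legendrian condition and of `σ(γ', γ'')` under change of parameter and
rescaling. -/
theorem pairing_reparam (hσ : σ.IsAlt) (hγ : AnalyticAt ℂ γ 0)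
    (hL : ∀ᶠ t in 𝓝 0, pairing σ γ 0 1 t = 0) {f τ w : ℂ → ℂ} (hf : AnalyticAt ℂ f 0)
    (hτ : HasDerivNear τ w) (hτ0 : τ 0 = 0) {γ' : ℂ → V4}
    (hγ' : γ' =ᶠ[𝓝 0] fun s => f s • γ (τ s)) :
    (∀ᶠ s in 𝓝 0, pairing σ γ' 0 1 s = 0) ∧
      ∀ᶠ s in 𝓝 0, pairing σ γ' 1 2 s = f s ^ 2 * w s ^ 3 * pairing σ γ 1 2 (τ s) := by
  have hγτ := (hasDerivNear_deriv hγ).comp hτ hτ0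
  have hγτ' := (hasDerivNear_one hγ).comp hτ hτ0
  have hf1 := hasDerivNear_deriv hf
  have hf2 := hasDerivNear_deriv hf.deriv
  have hw := hasDerivNear_deriv hτ.analyticAt_right
  have d0 := hf1.smul hγτ
  have d1 := (hf1.smul (hw.smul hγτ')).add (hf2.smul hγτ)
  have hγ'a : AnalyticAt ℂ γ' 0 := d0.analyticAt.congr hγ'.symm
  have i1 : iteratedDeriv 1 γ' =ᶠ[𝓝 0] _ :=
    eventuallyEq_iteratedDeriv_succ hγ'a (by simpa using hγ') d0
  have i2 : iteratedDeriv 2 γ' =ᶠ[𝓝 0] _ := eventuallyEq_iteratedDeriv_succ hγ'a i1 d1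
  have ht := hτ.tendsto_zero hτ0
  have key : ∀ᶠ s in 𝓝 0, σ (γ (τ s)) (deriv γ (τ s)) = 0 ∧ σ (deriv γ (τ s)) (γ (τ s)) = 0 ∧
      σ (γ (τ s)) (iteratedDeriv 2 γ (τ s)) = 0 := by
    filter_upwards [ht.eventually hL, ht.eventually (eventually_pairing_zero_two hσ hγ hL)]
      with s h1 h2
    simp only [pairing, iteratedDeriv_zero, iteratedDeriv_one] at h1 h2
    exact ⟨h1, by rw [← hσ.neg_eq, h1, neg_zero], h2⟩
  constructor
  · filter_upwards [hγ', i1, key] with s h0 h1 ⟨k1, k2, k3⟩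
    simp only [pairing, iteratedDeriv_zero]
    rw [h0, h1]
    simp [k1, hσ.self_eq_zero]
  · filter_upwards [i1, i2, key] with s h1 h2 ⟨k1, k2, k3⟩
    simp only [pairing]
    rw [h1, h2]
    simp [k1, k2, k3, hσ.self_eq_zero]
    ring

end pairing

/-! ### Changes of parameter and infinitesimal motions -/

/-- Derivative of a rescaled combination of vector functions `E₀, …, E₃` with `Eⱼ' = w Eⱼ₊₁`. -/
theorem HasDerivNear.combination {f k w p₀ p₁ p₂ p₃ q₀ q₁ q₂ q₃ : ℂ → ℂ} {E : ℕ → ℂ → V4}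
    (hf : HasDerivNear f (fun s => k s * f s))
    (hE : ∀ j, HasDerivNear (E j) (fun s => w s • E (j + 1) s))
    (h₀ : HasDerivNear p₀ q₀) (h₁ : HasDerivNear p₁ q₁) (h₂ : HasDerivNear p₂ q₂)
    (h₃ : HasDerivNear p₃ q₃) :
    HasDerivNear
      (fun s => f s • (p₀ s • E 0 s + p₁ s • E 1 s + p₂ s • E 2 s + p₃ s • E 3 s))
      (fun s => f s • ((q₀ s + k s * p₀ s) • E 0 s + (q₁ s + k s * p₁ s + w s * p₀ s) • E 1 s +
        (q₂ s + k s * p₂ s + w s * p₁ s) • E 2 s + (q₃ s + k s * p₃ s + w s * p₂ s) • E 3 s +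
        (w s * p₃ s) • E 4 s)) := by
  refine (hf.smul ((((h₀.smul (hE 0)).add (h₁.smul (hE 1))).add (h₂.smul (hE 2))).add
    (h₃.smul (hE 3)))).congr_right (Eventually.of_forall fun s => ?_)
  simp only [Nat.reduceAdd]
  module

/-- Change of parameter `τ` with `τ' = w`, `w' = w y`, together with the rescaling by
`f = w ^ (-3/2)`, in an equation `γ'''' = c₂ γ'' + c₀ γ` with constant coefficients. Here
`S = y' - y² / 2` is the Schwarzian derivative of `τ`. -/
theorem solvesODE_reparam {γ : ℂ → V4} (hγ : AnalyticAt ℂ γ 0) {c₂ c₀ : ℂ}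
    (h : SolvesODE γ (fun _ => c₂) (fun _ => 0) (fun _ => c₀)) {f τ w y S S₁ S₂ : ℂ → ℂ}
    (hf : HasDerivNear f (fun s => -(3 / 2) * y s * f s)) (hτ : HasDerivNear τ w) (hτ0 : τ 0 = 0)
    (hw : HasDerivNear w (fun s => w s * y s))
    (hy : HasDerivNear y (fun s => y s ^ 2 / 2 + S s)) (hS : HasDerivNear S S₁)
    (hS₁ : HasDerivNear S₁ S₂) {δ : ℂ → V4} (hδ : δ =ᶠ[𝓝 0] fun s => f s • γ (τ s)) :
    SolvesODE δ (fun s => w s ^ 2 * c₂ - 5 * S s) (fun s => 2 * w s ^ 2 * y s * c₂ - 5 * S₁ s)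
      (fun s => w s ^ 4 * c₀ - 9 / 4 * S s ^ 2 - 3 / 2 * S₂ s +
        3 / 2 * w s ^ 2 * c₂ * (y s ^ 2 + S s)) := by
  let E : ℕ → ℂ → V4 := fun j s => iteratedDeriv j γ (τ s)
  have hE : ∀ j, HasDerivNear (E j) (fun s => w s • E (j + 1) s) := fun j =>
    (hasDerivNear_iteratedDeriv hγ j).comp hτ hτ0
  have hz : HasDerivNear (fun _ : ℂ => (0 : ℂ)) (fun _ => 0) := HasDerivNear.const 0
  have d0 : HasDerivNear (fun s => f s • γ (τ s))
      (fun s => f s • ((-(3 / 2) * y s) • E 0 s + w s • E 1 s)) := by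
    refine (hf.combination hE (HasDerivNear.const 1) hz hz hz).congr
      (Eventually.of_forall fun s => ?_) (Eventually.of_forall fun s => ?_)
    · simp [E]
    · simp only []
      module
  have d1 : HasDerivNear (fun s => f s • ((-(3 / 2) * y s) • E 0 s + w s • E 1 s))
      (fun s => f s • ((3 / 2 * y s ^ 2 - 3 / 2 * S s) • E 0 s + (-2 * (w s * y s)) • E 1 s +
        w s ^ 2 • E 2 s)) := by
    refine (hf.combination hE (hy.const_mul (-(3 / 2))) hw hz hz).congr
      (Eventually.of_forall fun s => ?_) (Eventually.of_forall fun s => ?_)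
    · simp only []
      module
    · simp only []
      module
  have d2 : HasDerivNear
      (fun s => f s • ((3 / 2 * y s ^ 2 - 3 / 2 * S s) • E 0 s + (-2 * (w s * y s)) • E 1 s +
        w s ^ 2 • E 2 s))
      (fun s => f s • ((-(3 / 4) * y s ^ 3 + 21 / 4 * (y s * S s) - 3 / 2 * S₁ s) • E 0 s +
        (w s * (3 / 2 * y s ^ 2 - 7 / 2 * S s)) • E 1 s + (-(3 / 2) * (w s ^ 2 * y s)) • E 2 s +
        w s ^ 3 • E 3 s)) := by
    refine (hf.combination hE (((hy.pow 2).const_mul (3 / 2)).sub (hS.const_mul (3 / 2)))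
      ((hw.mul hy).const_mul (-2)) (hw.pow 2) hz).congr
      (Eventually.of_forall fun s => ?_) (Eventually.of_forall fun s => ?_)
    · simp only []
      module
    · simp only []
      push_cast
      module
  have d3 : HasDerivNear
      (fun s => f s • ((-(3 / 4) * y s ^ 3 + 21 / 4 * (y s * S s) - 3 / 2 * S₁ s) • E 0 s +
        (w s * (3 / 2 * y s ^ 2 - 7 / 2 * S s)) • E 1 s + (-(3 / 2) * (w s ^ 2 * y s)) • E 2 s +
        w s ^ 3 • E 3 s))
      (fun s => f s • ((-(15 / 2) * (y s ^ 2 * S s) + 21 / 4 * S s ^ 2 + 15 / 2 * (y s * S₁ s) -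
        3 / 2 * S₂ s) • E 0 s + (w s * (10 * (y s * S s) - 5 * S₁ s)) • E 1 s +
        (-5 * (w s ^ 2 * S s)) • E 2 s + w s ^ 4 • E 4 s)) := by
    refine (hf.combination hE ((((hy.pow 3).const_mul (-(3 / 4))).add
      ((hy.mul hS).const_mul (21 / 4))).sub (hS₁.const_mul (3 / 2)))
      (hw.mul (((hy.pow 2).const_mul (3 / 2)).sub (hS.const_mul (7 / 2))))
      (((hw.pow 2).mul hy).const_mul (-(3 / 2))) (hw.pow 3)).congr
      (Eventually.of_forall fun s => ?_) (Eventually.of_forall fun s => ?_)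
    · simp only []
    · simp only []
      push_cast
      module
  have hδa : AnalyticAt ℂ δ 0 := d0.analyticAt.congr hδ.symm
  have i1 : iteratedDeriv 1 δ =ᶠ[𝓝 0] _ :=
    eventuallyEq_iteratedDeriv_succ hδa (by simpa using hδ) d0
  have i2 : iteratedDeriv 2 δ =ᶠ[𝓝 0] _ := eventuallyEq_iteratedDeriv_succ hδa i1 d1
  have i3 : iteratedDeriv 3 δ =ᶠ[𝓝 0] _ := eventuallyEq_iteratedDeriv_succ hδa i2 d2
  have i4 : iteratedDeriv 4 δ =ᶠ[𝓝 0] _ := eventuallyEq_iteratedDeriv_succ hδa i3 d3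
  filter_upwards [hδ, i1, i2, i4, (hτ.tendsto_zero hτ0).eventually h] with s h0 h1 h2 h4 hs
  rw [← iteratedDeriv_one, h4, h2, h1, h0]
  simp only [E, hs, iteratedDeriv_one, iteratedDeriv_zero]
  module

/-- The vector function `-(3/2) β' γ + β γ'`: the infinitesimal motion of `γ` along the vector field
`β d/dt`. The first term accounts for the rescaling by `(τ')^(-3/2)` that goes with a change of
parameter `τ`. -/
noncomputable def motion (γ : ℂ → V4) (β : ℂ → ℂ) (t : ℂ) : V4 :=
  (-(3 / 2) * deriv β t) • γ t + β t • deriv γ t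

section motion

variable {γ : ℂ → V4} {β c₂ c₀ : ℂ → ℂ}

theorem analyticAt_motion (hγ : AnalyticAt ℂ γ 0) (hβ : AnalyticAt ℂ β 0) :
    AnalyticAt ℂ (motion γ β) 0 :=
  ((analyticAt_const.mul hβ.deriv).smul hγ).add (hβ.smul hγ.deriv)

/-- The defect of `motion γ β` in the differential equation satisfied by `γ`. -/
theorem eventually_iteratedDeriv_motion (hγ : AnalyticAt ℂ γ 0) (hβ : AnalyticAt ℂ β 0)
    (hc₂ : AnalyticAt ℂ c₂ 0) (hc₀ : AnalyticAt ℂ c₀ 0) (h : SolvesODE γ c₂ (deriv c₂) c₀) :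
    ∀ᶠ t in 𝓝 0, iteratedDeriv 4 (motion γ β) t - (c₂ t • iteratedDeriv 2 (motion γ β) t +
        deriv c₂ t • deriv (motion γ β) t + c₀ t • motion γ β t) =
      (-(3 / 2) * iteratedDeriv 5 β t + 4 * deriv β t * c₀ t + β t * deriv c₀ t +
        3 / 2 * c₂ t * iteratedDeriv 3 β t + 3 / 2 * deriv c₂ t * iteratedDeriv 2 β t) • γ t +
      (-5 * iteratedDeriv 4 β t + 3 * deriv β t * deriv c₂ t + β t * iteratedDeriv 2 c₂ t +
        2 * c₂ t * iteratedDeriv 2 β t) • deriv γ t +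
      (-5 * iteratedDeriv 3 β t + 2 * deriv β t * c₂ t + β t * deriv c₂ t) •
        iteratedDeriv 2 γ t := by
  let E : ℕ → ℂ → V4 := fun j t => iteratedDeriv j γ t
  let b : ℕ → ℂ → ℂ := fun j t => iteratedDeriv j β t
  have hE : ∀ j, HasDerivNear (E j) (fun s => (1 : ℂ) • E (j + 1) s) := fun j => by
    simpa using hasDerivNear_iteratedDeriv hγ j
  have hb : ∀ j, HasDerivNear (b j) (b (j + 1)) := fun j => hasDerivNear_iteratedDeriv hβ j
  have hone : HasDerivNear (fun _ : ℂ => (1 : ℂ)) (fun _ => (0 : ℂ) * 1) := by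
    simpa using HasDerivNear.const (1 : ℂ)
  have hz : HasDerivNear (fun _ : ℂ => (0 : ℂ)) (fun _ => 0) := HasDerivNear.const 0
  have d0 : HasDerivNear (motion γ β) (fun t => (-(3 / 2) * b 2 t) • E 0 t +
      (-(1 / 2) * b 1 t) • E 1 t + b 0 t • E 2 t) := by
    refine (hone.combination hE ((hb 1).const_mul (-(3 / 2))) (hb 0) hz hz).congr
      (Eventually.of_forall fun s => ?_) (Eventually.of_forall fun s => ?_)
    · simp [E, b, motion]
    · simp only [Nat.reduceAdd]
      module
  have d1 : HasDerivNear (fun t => (-(3 / 2) * b 2 t) • E 0 t +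
      (-(1 / 2) * b 1 t) • E 1 t + b 0 t • E 2 t) (fun t => (-(3 / 2) * b 3 t) • E 0 t +
      (-2 * b 2 t) • E 1 t + (1 / 2 * b 1 t) • E 2 t + b 0 t • E 3 t) := by
    refine (hone.combination hE ((hb 2).const_mul (-(3 / 2))) ((hb 1).const_mul (-(1 / 2)))
      (hb 0) hz).congr
      (Eventually.of_forall fun s => ?_) (Eventually.of_forall fun s => ?_)
    · simp only []
      module
    · simp only [Nat.reduceAdd]
      module
  have d2 : HasDerivNear (fun t => (-(3 / 2) * b 3 t) • E 0 t +
      (-2 * b 2 t) • E 1 t + (1 / 2 * b 1 t) • E 2 t + b 0 t • E 3 t)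
      (fun t => (-(3 / 2) * b 4 t) • E 0 t + (-(7 / 2) * b 3 t) • E 1 t +
      (-(3 / 2) * b 2 t) • E 2 t + (3 / 2 * b 1 t) • E 3 t + b 0 t • E 4 t) := by
    refine (hone.combination hE ((hb 3).const_mul (-(3 / 2))) ((hb 2).const_mul (-2))
      ((hb 1).const_mul (1 / 2)) (hb 0)).congr
      (Eventually.of_forall fun s => ?_) (Eventually.of_forall fun s => ?_)
    · simp only []
      module
    · simp only [Nat.reduceAdd]
      module
  have d3 : HasDerivNear (fun t => (-(3 / 2) * b 4 t) • E 0 t + (-(7 / 2) * b 3 t) • E 1 t +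
      (-(3 / 2) * b 2 t) • E 2 t + (3 / 2 * b 1 t) • E 3 t + b 0 t • E 4 t)
      (fun t => (-(3 / 2) * b 5 t) • E 0 t + (-5 * b 4 t) • E 1 t +
      (-5 * b 3 t) • E 2 t + (5 / 2 * b 1 t) • E 4 t + b 0 t • E 5 t) := by
    refine ((hone.combination hE ((hb 4).const_mul (-(3 / 2))) ((hb 3).const_mul (-(7 / 2)))
      ((hb 2).const_mul (-(3 / 2))) ((hb 1).const_mul (3 / 2))).add ((hb 0).smul (hE 4))).congr
      (Eventually.of_forall fun s => ?_) (Eventually.of_forall fun s => ?_)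
    · simp only []
      module
    · simp only [Nat.reduceAdd]
      module
  have hGa := analyticAt_motion hγ hβ
  have i1 : iteratedDeriv 1 (motion γ β) =ᶠ[𝓝 0] _ :=
    eventuallyEq_iteratedDeriv_succ hGa (by simp) d0
  have i2 : iteratedDeriv 2 (motion γ β) =ᶠ[𝓝 0] _ := eventuallyEq_iteratedDeriv_succ hGa i1 d1
  have i3 : iteratedDeriv 3 (motion γ β) =ᶠ[𝓝 0] _ := eventuallyEq_iteratedDeriv_succ hGa i2 d2
  have i4 : iteratedDeriv 4 (motion γ β) =ᶠ[𝓝 0] _ := eventuallyEq_iteratedDeriv_succ hGa i3 d3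
  have i5 : iteratedDeriv 5 γ =ᶠ[𝓝 0] _ := eventuallyEq_iteratedDeriv_succ hγ h
    (((((hasDerivNear_deriv hc₂).smul (hasDerivNear_iteratedDeriv hγ 2)).add
      ((hasDerivNear_deriv hc₂.deriv).smul (hasDerivNear_one hγ))).add
      ((hasDerivNear_deriv hc₀).smul (hasDerivNear_deriv hγ))))
  filter_upwards [i1, i2, i4, h, i5] with t h1 h2 h4 g4 g5
  rw [← iteratedDeriv_one (f := motion γ β), h4, h2, h1]
  have hc : iteratedDeriv 2 c₂ t = deriv (deriv c₂) t := by
    rw [iteratedDeriv_succ, iteratedDeriv_one]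
  simp only [E, motion, g4, g5, hc, iteratedDeriv_one, iteratedDeriv_zero, b]
  module

/-- The invariant `Q = c₀ + (9/100) c₂² - (3/10) c₂''` of the equation
`γ'''' = c₂ γ'' + c₂' γ' + c₀ γ`; up to sign it is the coefficient `q₀` of a Laguerre–Forsyth form. -/
noncomputable def quarticInv (c₂ c₀ : ℂ → ℂ) (t : ℂ) : ℂ :=
  c₀ t + 9 / 100 * c₂ t ^ 2 - 3 / 10 * iteratedDeriv 2 c₂ t

theorem analyticAt_quarticInv (hc₂ : AnalyticAt ℂ c₂ 0) (hc₀ : AnalyticAt ℂ c₀ 0) :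
    AnalyticAt ℂ (quarticInv c₂ c₀) 0 :=
  (hc₀.add (analyticAt_const.mul (hc₂.pow 2))).sub
    (analyticAt_const.mul (analyticAt_iteratedDeriv hc₂ 2))

theorem eventually_deriv_quarticInv (hc₂ : AnalyticAt ℂ c₂ 0) (hc₀ : AnalyticAt ℂ c₀ 0) :
    ∀ᶠ t in 𝓝 0, deriv (quarticInv c₂ c₀) t =
      deriv c₀ t + 9 / 50 * c₂ t * deriv c₂ t - 3 / 10 * iteratedDeriv 3 c₂ t := by
  have h := ((hasDerivNear_deriv hc₀).add (((hasDerivNear_deriv hc₂).pow 2).const_mul (9 / 100))).sub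
    ((hasDerivNear_iteratedDeriv hc₂ 2).const_mul (3 / 10))
  filter_upwards [h] with t ht
  refine ht.deriv.trans ?_
  push_cast
  ring

/-- First and second derivative of the third order equation for `β`. -/
theorem eventually_third_order_derivs (hβ : AnalyticAt ℂ β 0) (hc₂ : AnalyticAt ℂ c₂ 0)
    (h : ∀ᶠ t in 𝓝 0, 5 * iteratedDeriv 3 β t = 2 * deriv β t * c₂ t + β t * deriv c₂ t) :
    (∀ᶠ t in 𝓝 0, 5 * iteratedDeriv 4 β t =
      2 * iteratedDeriv 2 β t * c₂ t + 3 * deriv β t * deriv c₂ t + β t * iteratedDeriv 2 c₂ t) ∧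
    ∀ᶠ t in 𝓝 0, 5 * iteratedDeriv 5 β t = 2 * iteratedDeriv 3 β t * c₂ t +
      5 * iteratedDeriv 2 β t * deriv c₂ t + 4 * deriv β t * iteratedDeriv 2 c₂ t +
      β t * iteratedDeriv 3 c₂ t := by
  have b := fun j => hasDerivNear_iteratedDeriv hβ j
  have c := fun j => hasDerivNear_iteratedDeriv hc₂ j
  have h' : (fun t => 5 * iteratedDeriv 3 β t) =ᶠ[𝓝 0] fun t =>
      2 * (iteratedDeriv 1 β t * iteratedDeriv 0 c₂ t) +
        iteratedDeriv 0 β t * iteratedDeriv 1 c₂ t := by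
    filter_upwards [h] with t ht
    simp only [ht, iteratedDeriv_one, iteratedDeriv_zero]
    ring
  have h4 := ((b 3).const_mul 5).unique
    ((((b 1).mul (c 0)).const_mul 2).add ((b 0).mul (c 1))) h'
  have h4' : (fun t => 5 * iteratedDeriv 4 β t) =ᶠ[𝓝 0] fun t =>
      2 * (iteratedDeriv 2 β t * iteratedDeriv 0 c₂ t) +
      3 * (iteratedDeriv 1 β t * iteratedDeriv 1 c₂ t) +
      iteratedDeriv 0 β t * iteratedDeriv 2 c₂ t := by
    filter_upwards [h4] with t ht
    simp only [Nat.reduceAdd] at ht ⊢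
    linear_combination ht
  have h5 := ((b 4).const_mul 5).unique
    (((((b 2).mul (c 0)).const_mul 2).add (((b 1).mul (c 1)).const_mul 3)).add
      ((b 0).mul (c 2))) h4'
  constructor
  · filter_upwards [h4'] with t ht
    simp only [iteratedDeriv_one, iteratedDeriv_zero] at ht
    linear_combination ht
  · filter_upwards [h5] with t ht
    simp only [Nat.reduceAdd, iteratedDeriv_one, iteratedDeriv_zero] at ht
    linear_combination ht

theorem eventually_linearIndependent_frame (hγ : AnalyticAt ℂ γ 0)
    (hi : LinearIndependent ℂ (frame γ 0)) :
    ∀ᶠ t in 𝓝 0, LinearIndependent ℂ (frame γ t) := by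
  have hc : ContinuousAt (fun t => frame γ t) 0 :=
    continuousAt_pi.2 fun j => (analyticAt_iteratedDeriv hγ j).continuousAt
  exact hc.eventually (isOpen_setOfPred_linearIndependent.mem_nhds hi)

theorem eq_zero_of_frame_combination {t : ℂ} (hi : LinearIndependent ℂ (frame γ t)) {x₀ x₁ x₂ : ℂ}
    (h : x₀ • γ t + x₁ • deriv γ t + x₂ • iteratedDeriv 2 γ t = 0) :
    x₀ = 0 ∧ x₁ = 0 ∧ x₂ = 0 := by
  have h1 := Fintype.linearIndependent_iff.1 hi ![x₀, x₁, x₂, 0] (by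
    rw [← h]
    simp [Fin.sum_univ_four, frame])
  exact ⟨h1 0, h1 1, h1 2⟩

/-- If the motion along `β d/dt` preserves the equation, then `β` satisfies a third order linear
equation and preserves the quartic differential `Q dt⁴`. -/
theorem equations_of_solvesODE_motion (hγ : AnalyticAt ℂ γ 0) (hβ : AnalyticAt ℂ β 0)
    (hc₂ : AnalyticAt ℂ c₂ 0) (hc₀ : AnalyticAt ℂ c₀ 0) (h : SolvesODE γ c₂ (deriv c₂) c₀)
    (hi : LinearIndependent ℂ (frame γ 0)) (hm : SolvesODE (motion γ β) c₂ (deriv c₂) c₀) :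
    (∀ᶠ t in 𝓝 0, 5 * iteratedDeriv 3 β t = 2 * deriv β t * c₂ t + β t * deriv c₂ t) ∧
    ∀ᶠ t in 𝓝 0, 4 * deriv β t * quarticInv c₂ c₀ t + β t * deriv (quarticInv c₂ c₀) t = 0 := by
  have hx := ((eventually_iteratedDeriv_motion hγ hβ hc₂ hc₀ h).and (hm.and
    (eventually_linearIndependent_frame hγ hi))).mono fun t ⟨h1, h2, h3⟩ =>
    eq_zero_of_frame_combination h3 (h1.symm.trans (sub_eq_zero.2 h2))
  have h3 : ∀ᶠ t in 𝓝 0, 5 * iteratedDeriv 3 β t = 2 * deriv β t * c₂ t + β t * deriv c₂ t := by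
    filter_upwards [hx] with t ht
    linear_combination -ht.2.2
  refine ⟨h3, ?_⟩
  filter_upwards [hx, h3, (eventually_third_order_derivs hβ hc₂ h3).2,
    eventually_deriv_quarticInv hc₂ hc₀] with t ht e3 e5 hq
  rw [hq, quarticInv]
  linear_combination ht.1 + 3 / 10 * e5 - 9 / 50 * c₂ t * e3

theorem solvesODE_motion_of_equations (hγ : AnalyticAt ℂ γ 0) (hβ : AnalyticAt ℂ β 0)
    (hc₂ : AnalyticAt ℂ c₂ 0) (hc₀ : AnalyticAt ℂ c₀ 0) (h : SolvesODE γ c₂ (deriv c₂) c₀)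
    (h3 : ∀ᶠ t in 𝓝 0, 5 * iteratedDeriv 3 β t = 2 * deriv β t * c₂ t + β t * deriv c₂ t)
    (hQ : ∀ᶠ t in 𝓝 0, 4 * deriv β t * quarticInv c₂ c₀ t +
      β t * deriv (quarticInv c₂ c₀) t = 0) :
    SolvesODE (motion γ β) c₂ (deriv c₂) c₀ := by
  have h45 := eventually_third_order_derivs hβ hc₂ h3
  filter_upwards [eventually_iteratedDeriv_motion hγ hβ hc₂ hc₀ h, h3, h45.1, h45.2, hQ,
    eventually_deriv_quarticInv hc₂ hc₀] with t ht e3 e4 e5 eQ hq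
  rw [hq, quarticInv] at eQ
  rw [← sub_eq_zero, ht]
  have x0 : -(3 / 2) * iteratedDeriv 5 β t + 4 * deriv β t * c₀ t + β t * deriv c₀ t +
      3 / 2 * c₂ t * iteratedDeriv 3 β t + 3 / 2 * deriv c₂ t * iteratedDeriv 2 β t = 0 := by
    linear_combination eQ - 3 / 10 * e5 + 9 / 50 * c₂ t * e3
  have x1 : -5 * iteratedDeriv 4 β t + 3 * deriv β t * deriv c₂ t + β t * iteratedDeriv 2 c₂ t +
      2 * c₂ t * iteratedDeriv 2 β t = 0 := by
    linear_combination -e4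
  have x2 : -5 * iteratedDeriv 3 β t + 2 * deriv β t * c₂ t + β t * deriv c₂ t = 0 := by
    linear_combination -e3
  rw [x0, x1, x2]
  simp

end motion

/-- An infinitesimal symmetry moves the normalized curve along a vector field `β d/dt`. -/
theorem exists_motion_of_mem_csp {σ : LinearMap.BilinForm ℂ V4} {γ : ℂ → V4} (hσ : σ.IsAlt)
    (hγ : AnalyticAt ℂ γ 0) (hL : ∀ᶠ t in 𝓝 0, pairing σ γ 0 1 t = 0) {a : ℂ} (ha : a ≠ 0)
    (h12 : ∀ᶠ t in 𝓝 0, pairing σ γ 1 2 t = a) {u : Module.End ℂ V4} (hu : u ∈ csp σ)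
    (hut : ∀ᶠ t in 𝓝 0, u (γ t) ∈ Submodule.span ℂ {γ t, deriv γ t}) :
    ∃ (c : ℂ) (β : ℂ → ℂ), AnalyticAt ℂ β 0 ∧
      ∀ᶠ t in 𝓝 0, u (γ t) = (c / 2) • γ t + motion γ β t := by
  obtain ⟨c, hc⟩ := hu
  have h02 := eventually_pairing_zero_two hσ hγ hL
  have h03 := eventually_pairing_zero_three hσ hγ hL
  have h13 : ∀ᶠ t in 𝓝 0, pairing σ γ 1 3 t = 0 := by
    have h := (hasDerivNear_pairing (σ := σ) hγ 1 2).unique (HasDerivNear.const a) h12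
    filter_upwards [h] with t ht
    simpa [pairing_self hσ] using ht
  have hud : HasDerivNear (fun t => u (γ t)) (fun t => u (deriv γ t)) :=
    (hasDerivNear_deriv hγ).linear u
  have hud' : HasDerivNear (fun t => u (deriv γ t)) (fun t => u (iteratedDeriv 2 γ t)) :=
    (hasDerivNear_one hγ).linear u
  -- The coefficients of `u γ = α γ + β γ'` are read off by pairing with `γ'''` and `γ''`.
  let α : ℂ → ℂ := fun t => -a⁻¹ * σ (u (γ t)) (iteratedDeriv 3 γ t)
  let β : ℂ → ℂ := fun t => a⁻¹ * σ (u (γ t)) (iteratedDeriv 2 γ t)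
  have hα : AnalyticAt ℂ α 0 :=
    ((hud.bilin σ (hasDerivNear_iteratedDeriv hγ 3)).const_mul (-a⁻¹)).analyticAt
  have hβ : AnalyticAt ℂ β 0 :=
    ((hud.bilin σ (hasDerivNear_iteratedDeriv hγ 2)).const_mul (a⁻¹)).analyticAt
  have hαβ : ∀ᶠ t in 𝓝 0, u (γ t) = α t • γ t + β t • deriv γ t := by
    filter_upwards [hut, h02, h03, h12, h13] with t ht e02 e03 e12 e13
    obtain ⟨x, y, hxy⟩ := Submodule.mem_span_pair.1 ht
    simp only [pairing, iteratedDeriv_zero, iteratedDeriv_one] at e02 e03 e12 e13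
    have hx : α t = x := by
      simp only [α, ← hxy]
      simp [e03, e12, e13]
      field_simp
    have hy : β t = y := by
      simp only [β, ← hxy]
      simp [e02, e12]
      field_simp
    rw [hx, hy, hxy]
  have hu1 := hud.unique (((hasDerivNear_deriv hα).smul (hasDerivNear_deriv hγ)).add
    ((hasDerivNear_deriv hβ).smul (hasDerivNear_one hγ))) hαβ
  have hu2 := hud'.unique ((((hasDerivNear_deriv hα).smul (hasDerivNear_one hγ)).add
    ((hasDerivNear_deriv hα.deriv).smul (hasDerivNear_deriv hγ))).add
    (((hasDerivNear_deriv hβ).smul (hasDerivNear_iteratedDeriv hγ 2)).add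
    ((hasDerivNear_deriv hβ.deriv).smul (hasDerivNear_one hγ)))) (by
      filter_upwards [hu1] with t ht
      rw [ht])
  refine ⟨c, β, hβ, ?_⟩
  filter_upwards [hαβ, hu1, hu2, hL, h02, h12, h13] with t e0 e1 e2 e01 e02 e12 e13
  have hcc := hc (deriv γ t) (iteratedDeriv 2 γ t)
  have h00 := hσ.self_eq_zero
  have h10 : σ (deriv γ t) (γ t) = 0 := by
    rw [← hσ.neg_eq]
    simpa [pairing] using e01
  simp only [pairing, iteratedDeriv_zero, iteratedDeriv_one] at e01 e02 e12 e13
  rw [e1, e2] at hcc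
  simp only [Nat.reduceAdd, map_add, map_smul, LinearMap.add_apply, LinearMap.smul_apply,
    smul_eq_mul, e12, e02, e13, h10, h00] at hcc
  -- The relation between `α` and `β'` is the conformal condition on the pair `(γ', γ'')`.
  have hα' : α t = c / 2 - 3 / 2 * deriv β t :=
    mul_right_cancel₀ ha (by linear_combination hcc / 2)
  rw [e0, hα', motion]
  module

/-! ### The symplectic form of an equation with constant coefficients and Laguerre–Forsyth forms -/

theorem eq_sum_of_dual_family {e : Fin 4 → V4} (hi : LinearIndependent ℂ e)
    {ℓ : Fin 4 → V4 →ₗ[ℂ] ℂ} (hℓ : ∀ i j, ℓ i (e j) = if i = j then 1 else 0) (v : V4) :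
    v = ℓ 0 v • e 0 + ℓ 1 v • e 1 + ℓ 2 v • e 2 + ℓ 3 v • e 3 := by
  have hv : v ∈ Submodule.span ℂ (Set.range e) := by
    rw [hi.span_eq_top_of_card_eq_finrank (by simp)]
    trivial
  obtain ⟨x, rfl⟩ := (Submodule.mem_span_range_iff_exists_fun ℂ).1 hv
  simp [Fin.sum_univ_four, hℓ]

/-- The frame of a solution of `γ'''' = c₂ γ'' + c₀ γ` with constant coefficients carries a
symplectic form for which the generator of the flow is symplectic and `γ` is Legendrian. -/
theorem exists_symplectic {γ : ℂ → V4} (hγ : AnalyticAt ℂ γ 0) {c₂ c₀ : ℂ}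
    (h : SolvesODE γ (fun _ => c₂) (fun _ => 0) (fun _ => c₀))
    (hi : LinearIndependent ℂ (frame γ 0)) :
    ∃ σ : LinearMap.BilinForm ℂ V4, IsSymplectic σ ∧ ∀ᶠ t in 𝓝 0, pairing σ γ 0 1 t = 0 := by
  obtain ⟨ℓ, hℓ⟩ := exists_dual_family hi
  have hG : SolvesODE (deriv γ) (fun _ => c₂) (fun _ => 0) (fun _ => c₀) := by
    have h5 := (hasDerivNear_iteratedDeriv hγ 4).unique
      ((((hasDerivNear_iteratedDeriv hγ 2).const_smul c₂).add
        ((hasDerivNear_one hγ).const_smul (0 : ℂ))).add ((hasDerivNear_deriv hγ).const_smul c₀)) h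
    filter_upwards [h5] with t ht
    rw [← iteratedDeriv_succ', ← iteratedDeriv_succ', ht, zero_smul, zero_smul]
  obtain ⟨A, hA, hAγ⟩ := exists_linearMap_of_solvesODE hγ hγ.deriv analyticAt_const
    analyticAt_const analyticAt_const h hG hi
  have hA' : ∀ j : Fin 4, A (frame γ 0 j) = iteratedDeriv (j + 1) γ 0 := fun j => by
    rw [hA, frame, ← iteratedDeriv_succ']
  have A0 : A (frame γ 0 0) = frame γ 0 1 := hA' 0
  have A1 : A (frame γ 0 1) = frame γ 0 2 := hA' 1
  have A2 : A (frame γ 0 2) = frame γ 0 3 := hA' 2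
  have A3 : A (frame γ 0 3) = c₂ • frame γ 0 2 + c₀ • frame γ 0 0 := by
    refine (hA' 3).trans (h.self_of_nhds.trans ?_)
    rw [frame_zero, frame_two]
    module
  have hAv : ∀ v, A v = ℓ 0 v • frame γ 0 1 + ℓ 1 v • frame γ 0 2 + ℓ 2 v • frame γ 0 3 +
      ℓ 3 v • (c₂ • frame γ 0 2 + c₀ • frame γ 0 0) := fun v => by
    conv_lhs => rw [eq_sum_of_dual_family hi hℓ v]
    simp only [map_add, map_smul, A0, A1, A2, A3]
  -- Up to a factor, invariance under `A` and `σ(γ, γ') = 0` determine the values on the frame: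
  -- `σ(γ, γ''') = -1`, `σ(γ', γ'') = 1`, `σ(γ'', γ''') = -c₂`, and `0` for the other pairs.
  let σ : LinearMap.BilinForm ℂ V4 := LinearMap.mk₂ ℂ
    (fun v w => -(ℓ 0 v * ℓ 3 w - ℓ 3 v * ℓ 0 w) + (ℓ 1 v * ℓ 2 w - ℓ 2 v * ℓ 1 w) -
      c₂ * (ℓ 2 v * ℓ 3 w - ℓ 3 v * ℓ 2 w))
    (fun v v' w => by simp only [map_add]; ring) (fun c v w => by
      simp only [map_smul, smul_eq_mul]; ring)
    (fun v w w' => by simp only [map_add]; ring) (fun c v w => by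
      simp only [map_smul, smul_eq_mul]; ring)
  have hσ : ∀ v w, σ v w = -(ℓ 0 v * ℓ 3 w - ℓ 3 v * ℓ 0 w) + (ℓ 1 v * ℓ 2 w - ℓ 2 v * ℓ 1 w) -
      c₂ * (ℓ 2 v * ℓ 3 w - ℓ 3 v * ℓ 2 w) := fun v w => rfl
  have halt : σ.IsAlt := fun v => by rw [hσ]; ring
  have hker : ∀ v, (∀ w, σ v w = 0) → v = 0 := by
    intro v hv
    have e0 : ℓ 3 v = 0 := by simpa [hσ, hℓ] using hv (frame γ 0 0)
    have e1 : ℓ 2 v = 0 := by simpa [hσ, hℓ] using hv (frame γ 0 1)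
    have e2 : ℓ 1 v = 0 := by simpa [hσ, hℓ, e0] using hv (frame γ 0 2)
    have e3 : ℓ 0 v = 0 := by simpa [hσ, hℓ, e1] using hv (frame γ 0 3)
    rw [eq_sum_of_dual_family hi hℓ v, e0, e1, e2, e3]
    simp
  have hAσ : ∀ v w, σ (A v) w + σ v (A w) = 0 := by
    intro v w
    rw [hσ, hσ]
    simp only [hAv, map_add, map_smul, hℓ, smul_eq_mul]
    simp
    ring
  refine ⟨σ, ⟨halt, hker, fun v hv => hker v fun w => ?_⟩, ?_⟩
  · rw [← halt.neg_eq, hv, neg_zero]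
  · have hd : HasDerivNear (fun t => σ (γ t) (A (γ t)))
        (fun t => σ (deriv γ t) (A (γ t)) + σ (γ t) (A (deriv γ t))) :=
      (hasDerivNear_deriv hγ).bilin σ ((hasDerivNear_deriv hγ).linear A)
    have hc := hd.eventually_const (by
      filter_upwards [hAγ] with t ht
      rw [ht]
      have h1 := hAσ (γ t) (A (γ t))
      rw [halt.self_eq_zero] at h1 ⊢
      exact h1)
    have h0 : σ (γ 0) (A (γ 0)) = 0 := by
      rw [← frame_zero γ 0, A0, hσ]
      simp [hℓ]
    filter_upwards [hc, hAγ] with t ht hAt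
    simp only [pairing, iteratedDeriv_zero, iteratedDeriv_one]
    rw [hAt, ht, h0]

section

variable {σ : LinearMap.BilinForm ℂ V4} {γ : ℂ → V4}

theorem linearIndependent_frame_zero (hσ : IsSymplectic σ) (hγ : AnalyticAt ℂ γ 0)
    (hL : ∀ᶠ t in 𝓝 0, pairing σ γ 0 1 t = 0) (h12 : pairing σ γ 1 2 0 ≠ 0) :
    LinearIndependent ℂ (frame γ 0) :=
  linearIndependent_frame hσ.1 hL.self_of_nhds
    (eventually_pairing_zero_two hσ.1 hγ hL).self_of_nhds
    (eventually_pairing_zero_three hσ.1 hγ hL).self_of_nhds h12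

theorem pairing_one_two_zero_ne_zero (hσ : IsSymplectic σ) (hγ : AnalyticAt ℂ γ 0)
    (hL : ∀ᶠ t in 𝓝 0, pairing σ γ 0 1 t = 0) (hi : LinearIndependent ℂ (frame γ 0)) :
    pairing σ γ 1 2 0 ≠ 0 :=
  pairing_one_two_ne_zero hσ hL.self_of_nhds
    (eventually_pairing_zero_two hσ.1 hγ hL).self_of_nhds
    (eventually_pairing_zero_three hσ.1 hγ hL).self_of_nhds hi

theorem pairing_reparam_ne_zero (hσ : IsSymplectic σ) (hγ : AnalyticAt ℂ γ 0)
    (hL : ∀ᶠ t in 𝓝 0, pairing σ γ 0 1 t = 0) (h12 : pairing σ γ 1 2 0 ≠ 0) {f τ w : ℂ → ℂ}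
    (hf : AnalyticAt ℂ f 0) (hf0 : f 0 ≠ 0) (hτ : HasDerivNear τ w) (hτ0 : τ 0 = 0)
    (hw0 : w 0 ≠ 0) {γ' : ℂ → V4} (hγ' : γ' =ᶠ[𝓝 0] fun s => f s • γ (τ s)) :
    pairing σ γ' 1 2 0 ≠ 0 := by
  rw [(pairing_reparam hσ.1 hγ hL hf hτ hτ0 hγ').2.self_of_nhds, hτ0]
  exact mul_ne_zero (mul_ne_zero (pow_ne_zero _ hf0) (pow_ne_zero _ hw0)) h12

theorem IsLocalParam.pairing_eq_zero {Z : Set P3} {p : P3} (h : IsLocalParam γ Z p)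
    (hσ : σ.IsAlt) (hL : IsLegendrian σ Z p) : ∀ᶠ t in 𝓝 0, pairing σ γ 0 1 t = 0 := by
  filter_upwards [(h.isLegendrian_iff hσ).1 hL] with t ht
  simpa [pairing] using ht

end

/-- Change of parameter, with the normalizing rescaling, in an equation with constant
coefficients. Here `w` is the derivative of the old parameter with respect to the new one, `y` its
logarithmic derivative and `S` the Schwarzian derivative `y' - y² / 2`. -/
theorem IsLocalParam.exists_solvesODE_reparam {γ : ℂ → V4} {Z : Set P3} {p : P3}
    (h : IsLocalParam γ Z p) {c₂ c₀ : ℂ}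
    (hode : SolvesODE γ (fun _ => c₂) (fun _ => 0) (fun _ => c₀))
    (hi : LinearIndependent ℂ (frame γ 0)) {w y S S₁ S₂ : ℂ → ℂ} (hw0 : w 0 ≠ 0)
    (hw : HasDerivNear w (fun s => w s * y s)) (hy : HasDerivNear y (fun s => y s ^ 2 / 2 + S s))
    (hS : HasDerivNear S S₁) (hS₁ : HasDerivNear S₁ S₂) :
    ∃ γ' : ℂ → V4, IsLocalParam γ' Z p ∧ LinearIndependent ℂ (frame γ' 0) ∧
      SolvesODE γ' (fun s => w s ^ 2 * c₂ - 5 * S s) (fun s => 2 * w s ^ 2 * y s * c₂ - 5 * S₁ s)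
        (fun s => w s ^ 4 * c₀ - 9 / 4 * S s ^ 2 - 3 / 2 * S₂ s +
          3 / 2 * w s ^ 2 * c₂ * (y s ^ 2 + S s)) := by
  obtain ⟨τ, hτ0, hτ⟩ := exists_primitive hw.analyticAt
  obtain ⟨f, hf0, hf⟩ := exists_exp_primitive (g := fun s => -(3 / 2) * y s)
    (analyticAt_const.mul hy.analyticAt)
  have hf0' : f 0 ≠ 0 := by rw [hf0]; exact one_ne_zero
  have h' := h.reparam hf.analyticAt hf0' hτ hτ0 hw0
  refine ⟨_, h', ?_, solvesODE_reparam h.1 hode hf hτ hτ0 hw hy hS hS₁ EventuallyEq.rfl⟩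
  obtain ⟨σ, hσ, hL⟩ := exists_symplectic h.1 hode hi
  have h12 := pairing_one_two_zero_ne_zero hσ h.1 hL hi
  exact linearIndependent_frame_zero hσ h'.1
    (pairing_reparam hσ.1 h.1 hL hf.analyticAt hτ hτ0 EventuallyEq.rfl).1
    (pairing_reparam_ne_zero hσ h.1 hL h12 hf.analyticAt hf0' hτ hτ0 hw0 EventuallyEq.rfl)

/-- A germ given by an equation with constant coefficients has a local parametrization with
`γ'''' = C₀ γ`, where `C₀` is the invariant `c₀ + (9/100) c₂²` times the fourth power of the
derivative of the parameter change. -/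
theorem exists_laguerreForsyth {γ : ℂ → V4} {Z : Set P3} {p : P3} (h : IsLocalParam γ Z p)
    {c₂ c₀ : ℂ} (hode : SolvesODE γ (fun _ => c₂) (fun _ => 0) (fun _ => c₀))
    (hi : LinearIndependent ℂ (frame γ 0)) :
    ∃ (γ' : ℂ → V4) (w : ℂ → ℂ), IsLocalParam γ' Z p ∧ AnalyticAt ℂ w 0 ∧
      LinearIndependent ℂ (frame γ' 0) ∧
      SolvesODE γ' (fun _ => 0) (fun _ => 0) (fun s => (c₀ + 9 / 100 * c₂ ^ 2) * w s ^ 4) := by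
  obtain ⟨μ, hμ⟩ := IsAlgClosed.exists_pow_nat_eq (c₂ / 10) (n := 2) (by norm_num)
  have hc₂ : c₂ = 10 * μ ^ 2 := by rw [hμ]; ring
  -- The projective parameter is `s = (exp (2 μ t) - 1) / (2 μ)`, with `dt/ds = 1 / (1 + 2 μ s)`.
  let w : ℂ → ℂ := fun s => (1 + 2 * μ * s)⁻¹
  have hw : HasDerivNear w (fun s => w s * (-2 * μ * w s)) := by
    have h0 : ∀ᶠ s : ℂ in 𝓝 0, 1 + 2 * μ * s ≠ 0 := by
      have : ContinuousAt (fun s : ℂ => 1 + 2 * μ * s) 0 := by fun_prop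
      exact this.eventually_ne (by simp)
    filter_upwards [h0] with s hs
    have h1 : HasDerivAt (fun s : ℂ => 1 + 2 * μ * s) (2 * μ) s := by
      simpa using ((hasDerivAt_id s).const_mul (2 * μ)).const_add 1
    refine (h1.inv hs).congr_deriv ?_
    simp only [w]
    field_simp
  have hwa := hw.analyticAt
  let y : ℂ → ℂ := fun s => -2 * μ * w s
  let S : ℂ → ℂ := fun s => 2 * μ ^ 2 * w s ^ 2
  let S₁ : ℂ → ℂ := fun s => 4 * μ ^ 2 * (w s ^ 2 * y s)
  have hy : HasDerivNear y (fun s => y s ^ 2 / 2 + S s) :=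
    (hw.const_mul (-2 * μ)).congr_right (Eventually.of_forall fun s => by simp only [y, S]; ring)
  have hS : HasDerivNear S S₁ := ((hw.pow 2).const_mul (2 * μ ^ 2)).congr_right
    (Eventually.of_forall fun s => by simp only [y, S₁]; push_cast; ring)
  have hS₁ := ((hw.pow 2).mul hy).const_mul (4 * μ ^ 2)
  obtain ⟨γ', h', hi', hode'⟩ := h.exists_solvesODE_reparam hode hi (by simp [w]) hw hy hS hS₁
  refine ⟨γ', w, h', hwa, hi', ?_⟩
  filter_upwards [hode'] with s hs
  rw [hs]
  simp only [S, S₁, y, hc₂]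
  push_cast
  module

/-- Any Laguerre–Forsyth form of a germ given by an equation with constant coefficients. Here `y`
is the logarithmic derivative of `w`, and `w` is the derivative of the change of parameter. -/
theorem laguerreForsyth_coefficients {γ γ' : ℂ → V4} {Z : Set P3} {p : P3}
    (h : IsLocalParam γ Z p) {c₂ c₀ : ℂ}
    (hode : SolvesODE γ (fun _ => c₂) (fun _ => 0) (fun _ => c₀))
    (hi : LinearIndependent ℂ (frame γ 0)) {q₁ q₀ : ℂ → ℂ}
    (hLF : IsLaguerreForsyth γ' q₁ q₀ Z p) :
    (∀ᶠ t in 𝓝 0, q₁ t = 0) ∧ ∃ w y : ℂ → ℂ, w 0 ≠ 0 ∧ HasDerivNear w (fun s => w s * y s) ∧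
      HasDerivNear y (fun s => y s ^ 2 / 2 + w s ^ 2 * c₂ / 5) ∧
      ∀ᶠ s in 𝓝 0, q₀ s = -(c₀ + 9 / 100 * c₂ ^ 2) * w s ^ 4 := by
  obtain ⟨h', hq₁, hq₀, hLFode⟩ := hLF
  obtain ⟨f, τ, w, hf, hf0, hτ, hτ0, hw0, he⟩ := h.exists_reparam h'
  obtain ⟨σ, hσ, hL⟩ := exists_symplectic h.1 hode hi
  have h12 := pairing_one_two_zero_ne_zero hσ h.1 hL hi
  set a := pairing σ γ 1 2 0 with ha
  have hconst := eventually_pairing_one_two_eq hσ h.1 hL hode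
  have hrep := pairing_reparam hσ.1 h.1 hL hf hτ hτ0 he
  have hode₁ : SolvesODE γ' (fun _ => 0) (fun t => -q₁ t) (fun t => -q₀ t) := by
    filter_upwards [hLFode] with t ht
    rw [← sub_eq_zero, ← ht]
    module
  have hconst' := eventually_pairing_one_two_eq hσ h'.1 hrep.1 hode₁
  have h12' := pairing_reparam_ne_zero hσ h.1 hL h12 hf hf0 hτ hτ0 hw0 he
  have hi' := linearIndependent_frame_zero hσ h'.1 hrep.1 h12'
  have hwd := hasDerivNear_deriv hτ.analyticAt_right
  have hfd := hasDerivNear_deriv hf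
  have hwne : ∀ᶠ s in 𝓝 0, w s ≠ 0 := hwd.analyticAt.continuousAt.eventually_ne hw0
  have hfne : ∀ᶠ s in 𝓝 0, f s ≠ 0 := hf.continuousAt.eventually_ne hf0
  let y : ℂ → ℂ := fun s => deriv w s / w s
  have hya : AnalyticAt ℂ y 0 := hwd.analyticAt.deriv.div hwd.analyticAt hw0
  have hw : HasDerivNear w (fun s => w s * y s) := by
    refine hwd.congr_right ?_
    filter_upwards [hwne] with s hs
    simp only [y]
    field_simp
  -- Both parametrizations make `σ(γ', γ'')` constant, which determines `f` in terms of `w`.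
  have hf' : HasDerivNear f (fun s => -(3 / 2) * y s * f s) := by
    have hK : (fun s => f s ^ 2 * w s ^ 3) =ᶠ[𝓝 0] fun _ => pairing σ γ' 1 2 0 / a := by
      filter_upwards [hrep.2, hconst', (hτ.tendsto_zero hτ0).eventually hconst] with s h1 h2 h3
      rw [← h2, h1, h3, ← ha]
      field_simp
    have hd := ((hfd.pow 2).mul (hw.pow 3)).unique (HasDerivNear.const _) hK
    refine hfd.congr_right ?_
    filter_upwards [hd, hwne, hfne] with s hs h1 h2
    have h3 : (2 * f s * w s ^ 3) * (-(3 / 2) * y s * f s) =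
        (2 * f s * w s ^ 3) * deriv f s := by
      push_cast at hs
      linear_combination -hs
    exact mul_left_cancel₀ (mul_ne_zero (mul_ne_zero two_ne_zero h2) (pow_ne_zero _ h1)) h3
  let S : ℂ → ℂ := fun s => deriv y s - y s ^ 2 / 2
  have hSa : AnalyticAt ℂ S 0 := hya.deriv.sub ((hya.pow 2).div_const)
  have hy : HasDerivNear y (fun s => y s ^ 2 / 2 + S s) :=
    (hasDerivNear_deriv hya).congr_right (Eventually.of_forall fun s => by simp only [S]; ring)
  have hS := hasDerivNear_deriv hSa
  have hS₁ := hasDerivNear_deriv hSa.deriv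
  have hode₂ := solvesODE_reparam h.1 hode hf' hτ hτ0 hw hy hS hS₁ he
  have hcoef := (hode₁.and (hode₂.and (eventually_linearIndependent_frame h'.1 hi'))).mono
    fun s ⟨h1, h2, h3⟩ => eq_zero_of_frame_combination
      (x₀ := w s ^ 4 * c₀ - 9 / 4 * S s ^ 2 - 3 / 2 * deriv (deriv S) s +
        3 / 2 * w s ^ 2 * c₂ * (y s ^ 2 + S s) + q₀ s)
      (x₁ := 2 * w s ^ 2 * y s * c₂ - 5 * deriv S s + q₁ s)
      (x₂ := w s ^ 2 * c₂ - 5 * S s) h3 (by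
        rw [← sub_eq_zero.2 (h2.symm.trans h1)]
        module)
  have hS' : S =ᶠ[𝓝 0] fun s => c₂ / 5 * w s ^ 2 := by
    filter_upwards [hcoef] with s hs
    linear_combination -hs.2.2 / 5
  have hSd := hS.unique ((hw.pow 2).const_mul (c₂ / 5)) hS'
  have hSd' : deriv S =ᶠ[𝓝 0] fun s => 2 * c₂ / 5 * (w s ^ 2 * y s) := by
    filter_upwards [hSd] with s hs
    rw [hs]
    push_cast
    ring
  have hSdd := hS₁.unique (((hw.pow 2).mul hy).const_mul (2 * c₂ / 5)) hSd'
  refine ⟨?_, w, y, hw0, hw, hy.congr_right ?_, ?_⟩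
  · filter_upwards [hcoef, hSd'] with s hs h1
    rw [h1] at hs
    linear_combination hs.2.1
  · filter_upwards [hS'] with s hs
    rw [hs]
    ring
  · filter_upwards [hcoef, hS', hSdd] with s hs h1 h2
    have h0 := hs.1
    rw [h2, h1] at h0
    push_cast at h0
    linear_combination h0

/-- The invariant `Q` of the equation of the class of `r²`. -/
theorem quarticInv_model (r : ℂ) :
    -r ^ 2 + 9 / 100 * (1 + r ^ 2) ^ 2 = (r ^ 2 - 9) * (9 * r ^ 2 - 1) / 100 := by ring

theorem quarticInv_model_eq_zero_iff (r : ℂ) :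
    -r ^ 2 + 9 / 100 * (1 + r ^ 2) ^ 2 = 0 ↔ r ^ 2 = 9 ∨ r ^ 2 = 1 / 9 := by
  rw [quarticInv_model, div_eq_zero_iff, mul_eq_zero, sub_eq_zero, sub_eq_zero]
  constructor
  · rintro ((h | h) | h)
    · exact Or.inl h
    · exact Or.inr (by linear_combination h / 9)
    · norm_num at h
  · rintro (h | h)
    · exact Or.inl (Or.inl h)
    · exact Or.inl (Or.inr (by rw [h]; norm_num))

/-- The differential equations for `w` that express that the Schwarzian derivative of the parameter
change annihilates `c₂` make the absolute invariant constant. -/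
theorem absInv_eq {q₀ w y : ℂ → ℂ} {c₂ Q : ℂ} (hQ : Q ≠ 0) (hw0 : w 0 ≠ 0)
    (hw : HasDerivNear w (fun s => w s * y s))
    (hy : HasDerivNear y (fun s => y s ^ 2 / 2 + w s ^ 2 * c₂ / 5))
    (hq₀ : ∀ᶠ s in 𝓝 0, q₀ s = -Q * w s ^ 4) :
    ∀ᶠ s in 𝓝 0, q₀ s ≠ 0 ∧ absInv q₀ s = -c₂ ^ 2 / (100 * Q) := by
  have d0 : HasDerivNear q₀ (fun s => -4 * Q * (w s ^ 4 * y s)) :=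
    ((hw.pow 4).const_mul (-Q)).congr hq₀ (Eventually.of_forall fun s => by push_cast; ring)
  have d1 := ((hw.pow 4).mul hy).const_mul (-4 * Q)
  have hqa := d0.analyticAt
  have i1 : iteratedDeriv 1 q₀ =ᶠ[𝓝 0] _ :=
    eventuallyEq_iteratedDeriv_succ hqa (by simp) d0
  have i2 : iteratedDeriv 2 q₀ =ᶠ[𝓝 0] _ := eventuallyEq_iteratedDeriv_succ hqa i1 d1
  filter_upwards [hq₀, i1, i2, hw.analyticAt.continuousAt.eventually_ne hw0] with s h0 h1 h2 hws
  have hne : q₀ s ≠ 0 := by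
    rw [h0]
    exact mul_ne_zero (neg_ne_zero.2 hQ) (pow_ne_zero _ hws)
  refine ⟨hne, ?_⟩
  rw [iteratedDeriv_one] at h1
  have hrel : relInv q₀ s = 32 / 5 * (w s ^ 2 * c₂) * q₀ s ^ 2 := by
    rw [relInv, h1, h2, h0]
    push_cast
    ring
  rw [absInv, hrel, h0]
  field_simp
  ring

/-! ### The symmetry algebra -/

section symmetries

variable {σ : LinearMap.BilinForm ℂ V4} {γ : ℂ → V4} {Z : Set P3} {p : P3} {c₂ c₀ : ℂ → ℂ}

/-- A linear map is determined by its values on a curve with independent frame. -/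
theorem eq_zero_of_apply_curve (hγ : AnalyticAt ℂ γ 0) (hi : LinearIndependent ℂ (frame γ 0))
    {u : Module.End ℂ V4} (hu : ∀ᶠ t in 𝓝 0, u (γ t) = 0) : u = 0 := by
  refine LinearMap.ext_on (hi.span_eq_top_of_card_eq_finrank (by simp)) ?_
  rintro _ ⟨j, rfl⟩
  have h1 := (iteratedDeriv_linear hγ u j).self_of_nhds
  have h2 : (fun t => u (γ t)) =ᶠ[𝓝 0] fun _ => (0 : V4) := hu
  have h3 := (iteratedDeriv_eventuallyEq h2 j).self_of_nhds
  rw [h1] at h3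
  simpa [frame, iteratedDeriv_const] using h3

/-- An alternating form vanishes if it annihilates the pairs `(γ, γ')` and `(γ', γ'')` along a
solution `γ` of a linear equation. -/
theorem alternating_eq_zero {B : LinearMap.BilinForm ℂ V4} (hB : B.IsAlt)
    (hγ : AnalyticAt ℂ γ 0) (hode : SolvesODE γ c₂ (deriv c₂) c₀)
    (hi : LinearIndependent ℂ (frame γ 0)) (h01 : ∀ᶠ t in 𝓝 0, pairing B γ 0 1 t = 0)
    (h12 : ∀ᶠ t in 𝓝 0, pairing B γ 1 2 t = 0) : B = 0 := by
  have h02 := eventually_pairing_zero_two hB hγ h01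
  have h03 := eventually_pairing_zero_three hB hγ h01
  have h13 : ∀ᶠ t in 𝓝 0, pairing B γ 1 3 t = 0 := by
    have h := (hasDerivNear_pairing (σ := B) hγ 1 2).unique (HasDerivNear.const 0) h12
    filter_upwards [h] with t ht
    simpa [pairing_self hB] using ht
  have h23 : ∀ᶠ t in 𝓝 0, pairing B γ 2 3 t = 0 := by
    have h := (hasDerivNear_pairing (σ := B) hγ 1 3).unique (HasDerivNear.const 0) h13
    filter_upwards [h, h12, h01, hode] with t ht e12 e01 e4
    have e14 : pairing B γ 1 4 t = 0 := by
      have e10 := pairing_swap (γ := γ) hB 0 1 t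
      rw [e01] at e10
      simp only [pairing, iteratedDeriv_zero, iteratedDeriv_one] at e12 e10 ⊢
      rw [e4]
      simp [e12, e10, hB.self_eq_zero]
    simpa [e14] using ht
  have e01 := h01.self_of_nhds
  have e02 := h02.self_of_nhds
  have e03 := h03.self_of_nhds
  have e12 := h12.self_of_nhds
  have e13 := h13.self_of_nhds
  have e23 := h23.self_of_nhds
  rw [e12, neg_zero] at e03
  let b := basisOfLinearIndependentOfCardEqFinrank hi (by simp)
  have hb : ∀ j, b j = frame γ 0 j := fun j => by simp [b]
  refine LinearMap.BilinForm.ext_basis b fun i j => ?_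
  rw [hb, hb]
  change pairing B γ i j 0 = 0
  have e10 := pairing_swap (γ := γ) hB 0 1 0
  have e20 := pairing_swap (γ := γ) hB 0 2 0
  have e30 := pairing_swap (γ := γ) hB 0 3 0
  have e21 := pairing_swap (γ := γ) hB 1 2 0
  have e31 := pairing_swap (γ := γ) hB 1 3 0
  have e32 := pairing_swap (γ := γ) hB 2 3 0
  fin_cases i <;> fin_cases j <;>
    simp [e01, e02, e03, e12, e13, e23, e10, e20, e30, e21, e31, e32, pairing_self hB]

/-- The linear map generating a motion along a vector field is infinitesimally symplectic. -/
theorem mem_csp_of_motion (hσ : σ.IsAlt) (hγ : AnalyticAt ℂ γ 0)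
    (hL : ∀ᶠ t in 𝓝 0, pairing σ γ 0 1 t = 0) (hode : SolvesODE γ c₂ (deriv c₂) c₀)
    (hi : LinearIndependent ℂ (frame γ 0)) (h13 : ∀ᶠ t in 𝓝 0, pairing σ γ 1 3 t = 0)
    {β : ℂ → ℂ} (hβ : AnalyticAt ℂ β 0) {u : Module.End ℂ V4}
    (hu : ∀ᶠ t in 𝓝 0, u (γ t) = motion γ β t) : u ∈ csp σ := by
  let B : LinearMap.BilinForm ℂ V4 := LinearMap.mk₂ ℂ (fun v w => σ (u v) w + σ v (u w))
    (fun v v' w => by simp only [map_add, LinearMap.add_apply]; ring)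
    (fun c v w => by simp only [map_smul, LinearMap.smul_apply, smul_eq_mul]; ring)
    (fun v w w' => by simp only [map_add]; ring)
    (fun c v w => by simp only [map_smul, smul_eq_mul]; ring)
  have hB : ∀ v w, B v w = σ (u v) w + σ v (u w) := fun v w => rfl
  have hBalt : B.IsAlt := fun v => by
    rw [hB, ← hσ.neg_eq v (u v)]
    ring
  have b := fun j => hasDerivNear_iteratedDeriv hβ j
  have e := fun j => hasDerivNear_iteratedDeriv hγ j
  have u0 : (fun t => u (iteratedDeriv 0 γ t)) =ᶠ[𝓝 0] fun t =>
      (-(3 / 2) * iteratedDeriv 1 β t) • iteratedDeriv 0 γ t +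
        iteratedDeriv 0 β t • iteratedDeriv 1 γ t := by
    filter_upwards [hu] with t ht
    simpa [motion] using ht
  have u1 := ((e 0).linear u).unique
    ((((b 1).const_mul (-(3 / 2))).smul (e 0)).add ((b 0).smul (e 1))) u0
  have u1' : (fun t => u (iteratedDeriv 1 γ t)) =ᶠ[𝓝 0] fun t =>
      (-(3 / 2) * iteratedDeriv 2 β t) • iteratedDeriv 0 γ t +
      (-(1 / 2) * iteratedDeriv 1 β t) • iteratedDeriv 1 γ t +
        iteratedDeriv 0 β t • iteratedDeriv 2 γ t := by
    filter_upwards [u1] with t ht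
    simp only [Nat.reduceAdd, zero_add] at ht ⊢
    rw [ht]
    module
  have u2 := ((e 1).linear u).unique
    (((((b 2).const_mul (-(3 / 2))).smul (e 0)).add
      (((b 1).const_mul (-(1 / 2))).smul (e 1))).add ((b 0).smul (e 2))) u1'
  have h02 := eventually_pairing_zero_two hσ hγ hL
  have hzero : B = 0 := by
    refine alternating_eq_zero hBalt hγ hode hi ?_ ?_
    · filter_upwards [u0, u1', hL, h02] with t k0 k1 e01 e02
      have hp : pairing B γ 0 1 t = σ (u (iteratedDeriv 0 γ t)) (iteratedDeriv 1 γ t) +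
        σ (iteratedDeriv 0 γ t) (u (iteratedDeriv 1 γ t)) := rfl
      unfold pairing at e01 e02
      rw [hp, k0, k1]
      simp only [map_add, map_smul, LinearMap.add_apply, LinearMap.smul_apply, smul_eq_mul, e01,
        e02, hσ.self_eq_zero]
      ring
    · filter_upwards [u1', u2, hL, h02, h13] with t k1 k2 e01 e02 e13
      have hp : pairing B γ 1 2 t = σ (u (iteratedDeriv 1 γ t)) (iteratedDeriv 2 γ t) +
        σ (iteratedDeriv 1 γ t) (u (iteratedDeriv 2 γ t)) := rfl
      have e10 := pairing_swap (γ := γ) hσ 0 1 t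
      rw [e01, neg_zero] at e10
      unfold pairing at e10 e02 e13
      simp only [Nat.reduceAdd] at k2
      rw [hp, k1, k2]
      simp only [map_add, map_smul, LinearMap.add_apply, LinearMap.smul_apply, smul_eq_mul, e10,
        e02, e13, hσ.self_eq_zero]
      ring
  refine ⟨0, fun v w => ?_⟩
  rw [← hB, hzero]
  simp

theorem exists_mem_aut_of_motion (hσ : IsSymplectic σ) (h : IsLocalParam γ Z p)
    (hL : ∀ᶠ t in 𝓝 0, pairing σ γ 0 1 t = 0) (hc₂ : AnalyticAt ℂ c₂ 0)
    (hc₀ : AnalyticAt ℂ c₀ 0) (hode : SolvesODE γ c₂ (deriv c₂) c₀)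
    (hi : LinearIndependent ℂ (frame γ 0)) {β : ℂ → ℂ} (hβ : AnalyticAt ℂ β 0)
    (hm : SolvesODE (motion γ β) c₂ (deriv c₂) c₀) :
    ∃ u ∈ aut σ Z p, ∀ᶠ t in 𝓝 0, u (γ t) = motion γ β t := by
  obtain ⟨u, -, hu⟩ := exists_linearMap_of_solvesODE h.1 (analyticAt_motion h.1 hβ) hc₂ hc₂.deriv
    hc₀ hode hm hi
  have hu' : ∀ᶠ t in 𝓝 0, u (γ t) = motion γ β t := hu.mono fun t ht => ht.symm
  refine ⟨u, h.mem_aut_iff.2 ⟨?_, ?_⟩, hu'⟩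
  · refine mem_csp_of_motion hσ.1 h.1 hL hode hi ?_ hβ hu'
    have h12 := (hasDerivNear_pairing (σ := σ) h.1 1 2).unique (HasDerivNear.const _)
      (eventually_pairing_one_two_eq hσ h.1 hL hode)
    filter_upwards [h12] with t ht
    simpa [pairing_self hσ.1] using ht
  · filter_upwards [hu'] with t ht
    rw [ht]
    exact Submodule.mem_span_pair.2 ⟨_, _, rfl⟩

/-- Every infinitesimal symmetry is, up to a scalar, a motion along a vector field `β d/dt`
preserving the equation. -/
theorem exists_motion_of_mem_aut (hσ : IsSymplectic σ) (h : IsLocalParam γ Z p)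
    (hL : ∀ᶠ t in 𝓝 0, pairing σ γ 0 1 t = 0) (hode : SolvesODE γ c₂ (deriv c₂) c₀)
    (hi : LinearIndependent ℂ (frame γ 0)) {u : Module.End ℂ V4} (hu : u ∈ aut σ Z p) :
    ∃ (c : ℂ) (β : ℂ → ℂ), AnalyticAt ℂ β 0 ∧ (∀ᶠ t in 𝓝 0, u (γ t) = c • γ t + motion γ β t) ∧
      SolvesODE (motion γ β) c₂ (deriv c₂) c₀ := by
  have hu' := h.mem_aut_iff.1 hu
  obtain ⟨c, β, hβ, hm⟩ := exists_motion_of_mem_csp hσ.1 h.1 hL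
    (pairing_one_two_zero_ne_zero hσ h.1 hL hi) (eventually_pairing_one_two_eq hσ h.1 hL hode)
    hu'.1 hu'.2
  refine ⟨c / 2, β, hβ, hm, ?_⟩
  refine (hode.linear h.1 (u - (c / 2) • LinearMap.id)).congr ?_
  filter_upwards [hm] with t ht
  simp [ht]

theorem motion_congr {β β' : ℂ → ℂ} (hb : β =ᶠ[𝓝 0] β') :
    motion γ β =ᶠ[𝓝 0] motion γ β' := by
  filter_upwards [hb, hb.deriv] with t h1 h2
  rw [motion, motion, h1, h2]

theorem motion_sum {n : ℕ} {β : Fin n → ℂ → ℂ} (hβ : ∀ i, AnalyticAt ℂ (β i) 0)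
    (y : Fin n → ℂ) :
    motion γ (fun t => ∑ i, y i * β i t) =ᶠ[𝓝 0] fun t => ∑ i, y i • motion γ (β i) t := by
  have h1 : ∀ᶠ t in 𝓝 (0 : ℂ), ∀ i, HasDerivAt (β i) (deriv (β i) t) t :=
    eventually_all.2 fun i => hasDerivNear_deriv (hβ i)
  filter_upwards [h1] with t ht
  have h2 : deriv (fun t => ∑ i, y i * β i t) t = ∑ i, y i * deriv (β i) t :=
    (HasDerivAt.fun_sum fun i _ => (ht i).const_mul (y i)).deriv
  simp only [motion, h2, smul_add, Finset.sum_add_distrib, smul_smul, Finset.sum_smul,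
    Finset.mul_sum]
  congr 1
  refine Finset.sum_congr rfl fun i _ => ?_
  congr 1
  ring

theorem one_mem_aut : (1 : Module.End ℂ V4) ∈ aut σ Z p := by
  refine ⟨⟨2, fun v w => ?_⟩, Eventually.of_forall fun q z hz hz0 => ?_⟩
  · simp only [Module.End.one_apply]
    ring
  · exact Submodule.mem_sup_left (Submodule.mem_span_singleton_self z)

/-- The symmetry algebra is spanned by the scalars and the motions along the vector fields that
preserve the equation. -/
theorem finrank_aut_eq (hσ : IsSymplectic σ) (h : IsLocalParam γ Z p)
    (hL : ∀ᶠ t in 𝓝 0, pairing σ γ 0 1 t = 0) (hc₂ : AnalyticAt ℂ c₂ 0)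
    (hc₀ : AnalyticAt ℂ c₀ 0) (hode : SolvesODE γ c₂ (deriv c₂) c₀)
    (hi : LinearIndependent ℂ (frame γ 0)) {n : ℕ} {β : Fin n → ℂ → ℂ}
    (hβ : ∀ i, AnalyticAt ℂ (β i) 0) (hm : ∀ i, SolvesODE (motion γ (β i)) c₂ (deriv c₂) c₀)
    (hind : ∀ y : Fin n → ℂ, (∀ᶠ t in 𝓝 0, ∑ i, y i * β i t = 0) → y = 0)
    (hspan : ∀ b : ℂ → ℂ, AnalyticAt ℂ b 0 → SolvesODE (motion γ b) c₂ (deriv c₂) c₀ →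
      ∃ y : Fin n → ℂ, ∀ᶠ t in 𝓝 0, b t = ∑ i, y i * β i t) :
    Module.finrank ℂ (aut σ Z p) = n + 1 := by
  choose u hu huγ using fun i => exists_mem_aut_of_motion hσ h hL hc₂ hc₀ hode hi (hβ i) (hm i)
  let L : ℂ × (Fin n → ℂ) →ₗ[ℂ] Module.End ℂ V4 :=
    (LinearMap.toSpanSingleton ℂ _ 1).coprod (Fintype.linearCombination ℂ u)
  have hLapply : ∀ x y, L (x, y) = x • 1 + ∑ i, y i • u i := fun x y => by
    simp [L, Fintype.linearCombination_apply]
  have hLγ : ∀ x y, ∀ᶠ t in 𝓝 0, L (x, y) (γ t) =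
      x • γ t + motion γ (fun t => ∑ i, y i * β i t) t := fun x y => by
    filter_upwards [motion_sum hβ y, eventually_all.2 huγ] with t h1 h2
    rw [hLapply, h1]
    simp [h2]
  have hrange : LinearMap.range L = aut σ Z p := by
    apply le_antisymm
    · rintro _ ⟨⟨x, y⟩, rfl⟩
      rw [hLapply]
      exact Submodule.add_mem _ (Submodule.smul_mem _ _ one_mem_aut)
        (Submodule.sum_mem _ fun i _ => Submodule.smul_mem _ _ (hu i))
    · intro v hv
      obtain ⟨c, b, hb, hvγ, hvm⟩ := exists_motion_of_mem_aut hσ h hL hode hi hv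
      obtain ⟨y, hy⟩ := hspan b hb hvm
      refine ⟨(c, y), sub_eq_zero.1 (eq_zero_of_apply_curve h.1 hi ?_)⟩
      filter_upwards [hLγ c y, hvγ, motion_congr (γ := γ) hy] with t h1 h2 h3
      rw [LinearMap.sub_apply, h1, h2, h3, sub_self]
  have hinj : Function.Injective L := by
    rw [← LinearMap.ker_eq_bot, LinearMap.ker_eq_bot']
    rintro ⟨x, y⟩ hxy
    have hz : ∀ᶠ t in 𝓝 0, x • γ t + motion γ (fun t => ∑ i, y i * β i t) t = 0 := by
      filter_upwards [hLγ x y] with t ht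
      rw [← ht, hxy, LinearMap.zero_apply]
    have hcoef := (hz.and (eventually_linearIndependent_frame h.1 hi)).mono fun t ⟨h1, h2⟩ =>
      eq_zero_of_frame_combination h2
        (x₀ := x - 3 / 2 * deriv (fun t => ∑ i, y i * β i t) t)
        (x₁ := ∑ i, y i * β i t) (x₂ := 0) (by
          rw [← h1, motion]
          module)
    have hb0 : (fun t => ∑ i, y i * β i t) =ᶠ[𝓝 0] fun _ => 0 := hcoef.mono fun t ht => ht.2.1
    have hy := hind y hb0
    have hx := hcoef.self_of_nhds.1
    rw [hb0.deriv_eq] at hx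
    simp only [deriv_const, mul_zero, sub_zero] at hx
    rw [hx, hy]
    rfl
  rw [← hrange, LinearMap.finrank_range_of_inj hinj]
  simp [add_comm]

theorem finrank_aut_eq_two (hσ : IsSymplectic σ) (h : IsLocalParam γ Z p)
    (hL : ∀ᶠ t in 𝓝 0, pairing σ γ 0 1 t = 0) {c₂ c₀ : ℂ}
    (hode : SolvesODE γ (fun _ => c₂) (fun _ => 0) (fun _ => c₀))
    (hi : LinearIndependent ℂ (frame γ 0)) (hQ : c₀ + 9 / 100 * c₂ ^ 2 ≠ 0) :
    Module.finrank ℂ (aut σ Z p) = 2 := by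
  have hd : deriv (fun _ : ℂ => c₂) = fun _ => 0 := by simp
  have hode' : SolvesODE γ (fun _ => c₂) (deriv fun _ => c₂) (fun _ => c₀) := by rwa [hd]
  have hQc : quarticInv (fun _ => c₂) (fun _ => c₀) = fun _ => c₀ + 9 / 100 * c₂ ^ 2 := by
    funext t
    simp [quarticInv, iteratedDeriv_const]
  refine finrank_aut_eq (n := 1) (β := fun _ _ => 1) hσ h hL analyticAt_const analyticAt_const
    hode' hi (fun _ => analyticAt_const) (fun _ => ?_) (fun y hy => ?_) fun b hb hm => ?_
  · refine solvesODE_motion_of_equations h.1 analyticAt_const analyticAt_const analyticAt_const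
      hode' (Eventually.of_forall fun t => ?_) (Eventually.of_forall fun t => ?_)
    · simp [iteratedDeriv_const]
    · simp [hQc]
  · have := hy.self_of_nhds
    ext i
    fin_cases i
    simpa using this
  · have heq := (equations_of_solvesODE_motion h.1 hb analyticAt_const analyticAt_const hode' hi
      hm).2
    have hconst := (hasDerivNear_deriv hb).eventually_const (by
      filter_upwards [heq] with t ht
      rw [hQc] at ht
      simpa [hQ] using ht)
    exact ⟨fun _ => b 0, by simpa using hconst⟩

theorem finrank_aut_eq_four (hσ : IsSymplectic σ) (h : IsLocalParam γ Z p)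
    (hL : ∀ᶠ t in 𝓝 0, pairing σ γ 0 1 t = 0)
    (hode : SolvesODE γ (fun _ => 0) (fun _ => 0) (fun _ => 0))
    (hi : LinearIndependent ℂ (frame γ 0)) : Module.finrank ℂ (aut σ Z p) = 4 := by
  have hd : deriv (fun _ : ℂ => (0 : ℂ)) = fun _ => 0 := by simp
  have hode' : SolvesODE γ (fun _ => 0) (deriv fun _ => 0) (fun _ => 0) := by rwa [hd]
  have hQc : quarticInv (fun _ => 0) (fun _ => 0) = fun _ => 0 := by
    funext t
    simp [quarticInv]
  have hquad : ∀ y : Fin 3 → ℂ, HasDerivNear (fun t => ∑ i, y i * t ^ (i : ℕ))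
      (fun t => y 1 + 2 * y 2 * t) := fun y => by
    refine (((HasDerivNear.const (y 0)).add (HasDerivNear.id.const_mul (y 1))).add
      ((HasDerivNear.id.pow 2).const_mul (y 2))).congr (Eventually.of_forall fun t => ?_)
      (Eventually.of_forall fun t => ?_)
    · simp [Fin.sum_univ_three]
    · simp
      ring
  have hlin : ∀ a b : ℂ, HasDerivNear (fun t => a + b * t) (fun _ => b) := fun a b =>
    ((HasDerivNear.const a).add (HasDerivNear.id.const_mul b)).congr_right
      (Eventually.of_forall fun t => by simp)
  have hmono : ∀ i : Fin 3, AnalyticAt ℂ (fun t : ℂ => t ^ (i : ℕ)) 0 := fun i =>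
    analyticAt_id.pow _
  refine finrank_aut_eq (n := 3) (β := fun i t => t ^ (i : ℕ)) hσ h hL analyticAt_const
    analyticAt_const hode' hi hmono (fun i => ?_) (fun y hy => ?_) fun b hb hm => ?_
  · refine solvesODE_motion_of_equations h.1 (hmono i) analyticAt_const analyticAt_const
      hode' (Eventually.of_forall fun t => ?_) (Eventually.of_forall fun t => ?_)
    · have h3 : iteratedDeriv 3 (fun t : ℂ => t ^ (i : ℕ)) t = 0 := by
        rw [iteratedDeriv_eq_iterate, iter_deriv_pow]
        fin_cases i <;> simp [Finset.prod_range_succ]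
      rw [h3]
      simp
    · simp [hQc]
  · have d1 := (hquad y).unique (HasDerivNear.const 0) hy
    have d2 := (hlin (y 1) (2 * y 2)).unique (HasDerivNear.const 0) d1
    have e0 := hy.self_of_nhds
    have e1 := d1.self_of_nhds
    have e2 := d2.self_of_nhds
    simp only [Fin.sum_univ_three] at e0
    ext i
    fin_cases i
    · simpa using e0
    · simpa using e1
    · simpa using e2
  · have heq := (equations_of_solvesODE_motion h.1 hb analyticAt_const analyticAt_const hode' hi
      hm).1
    have h2 := (hasDerivNear_iteratedDeriv hb 2).eventually_const (by
      filter_upwards [heq] with t ht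
      simpa using ht)
    set y : Fin 3 → ℂ := ![b 0, iteratedDeriv 1 b 0, iteratedDeriv 2 b 0 / 2] with hy
    have d1 := (hasDerivNear_iteratedDeriv hb 1).sub (hlin (y 1) (2 * y 2))
    have c1 := d1.eventually_const (by
      filter_upwards [h2] with t ht
      simp [hy, ht]
      ring)
    have d0 := (hasDerivNear_iteratedDeriv hb 0).sub (hquad y)
    have c0 := d0.eventually_const (by
      filter_upwards [c1] with t ht
      simp only [zero_add]
      rw [ht]
      simp [hy])
    refine ⟨y, ?_⟩
    filter_upwards [c0] with t ht
    have h0 : iteratedDeriv 0 b 0 - ∑ i, y i * (0 : ℂ) ^ (i : ℕ) = 0 := by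
      simp [Fin.sum_univ_three, hy]
    rw [h0, sub_eq_zero, iteratedDeriv_zero] at ht
    exact ht

end symmetries

/-! ### The classes -/

section classes

variable {γ : ℂ → V4} {Z : Set P3} {p : P3} {c₂ c₀ : ℂ}

theorem IsLocalParam.exists_solvesODE_rescale (h : IsLocalParam γ Z p)
    (hode : SolvesODE γ (fun _ => c₂) (fun _ => 0) (fun _ => c₀))
    (hi : LinearIndependent ℂ (frame γ 0)) {k : ℂ} (hk : k ≠ 0) :
    ∃ γ' : ℂ → V4, IsLocalParam γ' Z p ∧ LinearIndependent ℂ (frame γ' 0) ∧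
      SolvesODE γ' (fun _ => k ^ 2 * c₂) (fun _ => 0) (fun _ => k ^ 4 * c₀) := by
  have h0 := HasDerivNear.const (0 : ℂ)
  obtain ⟨γ', h', hi', hode'⟩ := h.exists_solvesODE_reparam hode hi (w := fun _ => k) hk
    (y := fun _ => 0) (S := fun _ => 0)
    ((HasDerivNear.const k).congr_right (Eventually.of_forall fun s => by simp))
    (h0.congr_right (Eventually.of_forall fun s => by simp)) h0 h0
  refine ⟨γ', h', hi', ?_⟩
  simpa using hode'

theorem IsLocalParam.exists_mem_classL_of_ne_zero (h : IsLocalParam γ Z p)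
    (hode : SolvesODE γ (fun _ => c₂) (fun _ => 0) (fun _ => c₀))
    (hi : LinearIndependent ℂ (frame γ 0)) (hne : c₂ ≠ 0 ∨ c₀ ≠ 0) :
    ∃ r : ℂ, (Z, p) ∈ classL r := by
  -- The roots `x₁`, `x₂` of `x² - c₂ x - c₀`, with `x₂ ≠ 0`, are to become `r²` and `1`.
  obtain ⟨x₁, x₂, hx₂, hsum, hprod⟩ : ∃ x₁ x₂ : ℂ, x₂ ≠ 0 ∧ x₁ + x₂ = c₂ ∧ x₁ * x₂ = -c₀ := by
    obtain ⟨d, hd⟩ := IsAlgClosed.exists_pow_nat_eq (c₂ ^ 2 + 4 * c₀) (n := 2) (by norm_num)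
    by_cases hz : c₂ + d = 0
    · refine ⟨(c₂ + d) / 2, (c₂ - d) / 2, fun hz' => ?_, by ring, by linear_combination -hd / 4⟩
      have hc₂ : c₂ = 0 := by linear_combination hz / 2 + hz'
      have hd0 : d = 0 := by linear_combination hz / 2 - hz'
      rw [hc₂, hd0] at hd
      have hc₀ : c₀ = 0 := by linear_combination -hd / 4
      exact hne.elim (fun h => h hc₂) (fun h => h hc₀)
    · exact ⟨(c₂ - d) / 2, (c₂ + d) / 2, by simpa using hz, by ring, by linear_combination -hd / 4⟩
  obtain ⟨ρ, hρ⟩ := IsAlgClosed.exists_pow_nat_eq x₂ (n := 2) (by norm_num)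
  obtain ⟨r, hr⟩ := IsAlgClosed.exists_pow_nat_eq (x₁ / x₂) (n := 2) (by norm_num)
  have hρ0 : ρ ≠ 0 := by rintro rfl; exact hx₂ (by rw [← hρ]; simp)
  obtain ⟨γ', h', hi', hode'⟩ := h.exists_solvesODE_rescale hode hi (inv_ne_zero hρ0)
  refine ⟨r, mem_classL_iff.2 ⟨γ', h', ?_, hi'⟩⟩
  have e₂ : ρ⁻¹ ^ 2 * c₂ = 1 + r ^ 2 := by
    rw [inv_pow, hρ, hr, ← hsum]
    field_simp
    ring
  have e₀ : ρ⁻¹ ^ 4 * c₀ = -r ^ 2 := by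
    have : ρ⁻¹ ^ 4 = (x₂⁻¹) ^ 2 := by rw [← hρ]; ring
    rw [this, hr, ← neg_eq_iff_eq_neg.2 hprod]
    field_simp
  rwa [e₂, e₀] at hode'

/-- For a germ given by `γ'''' = 0`, the parameter `log (1 + 2 t) / 2` instead of `t`, with the
normalizing rescaling, leads to the equation of the class with `r² = 9`. -/
theorem IsLocalParam.mem_classL_three (h : IsLocalParam γ Z p)
    (hode : SolvesODE γ (fun _ => 0) (fun _ => 0) (fun _ => 0))
    (hi : LinearIndependent ℂ (frame γ 0)) : (Z, p) ∈ classL 3 := by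
  -- The derivative of the old parameter with respect to the new one is `w = exp (2 s)`.
  obtain ⟨w, hw0, hw⟩ := exists_exp_primitive (g := fun _ => (2 : ℂ)) analyticAt_const
  obtain ⟨γ', h', hi', hode'⟩ := h.exists_solvesODE_reparam hode hi (w := w) (by simp [hw0])
    (y := fun _ => 2) (S := fun _ => -2) (S₁ := fun _ => 0) (S₂ := fun _ => 0)
    (hw.congr_right (Eventually.of_forall fun s => by ring))
    ((HasDerivNear.const 2).congr_right (Eventually.of_forall fun s => by norm_num))
    (HasDerivNear.const (-2)) (HasDerivNear.const 0)
  refine mem_classL_iff.2 ⟨γ', h', ?_, hi'⟩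
  filter_upwards [hode'] with s hs
  rw [hs]
  norm_num

/-- Every germ given by an equation with constant coefficients belongs to one of the classes. -/
theorem IsLocalParam.exists_mem_classL (h : IsLocalParam γ Z p)
    (hode : SolvesODE γ (fun _ => c₂) (fun _ => 0) (fun _ => c₀))
    (hi : LinearIndependent ℂ (frame γ 0)) : ∃ r : ℂ, (Z, p) ∈ classL r := by
  by_cases hc₂ : c₂ = 0
  · by_cases hc₀ : c₀ = 0
    · subst hc₂ hc₀
      exact ⟨3, h.mem_classL_three hode hi⟩
    · exact h.exists_mem_classL_of_ne_zero hode hi (Or.inr hc₀)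
  · exact h.exists_mem_classL_of_ne_zero hode hi (Or.inl hc₂)

end classes

section members

variable {r : ℂ} {Z : Set P3} {p : P3} {σ : LinearMap.BilinForm ℂ V4}

theorem isCurveGerm_of_mem_classL (h : (Z, p) ∈ classL r) : IsCurveGerm Z p := by
  obtain ⟨γ, hγ, -⟩ := mem_classL_iff.1 h
  exact ⟨γ, hγ⟩

theorem osculatingFull_of_mem_classL (h : (Z, p) ∈ classL r) : OsculatingFull Z p 3 := by
  obtain ⟨γ, hγ, -, hi⟩ := mem_classL_iff.1 h
  exact (hγ.osculatingFull_iff 3).2 ((derivSpan_three_eq_top_iff γ).2 hi)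

theorem exists_isLegendrian_of_mem_classL (h : (Z, p) ∈ classL r) :
    ∃ σ : LinearMap.BilinForm ℂ V4, IsSymplectic σ ∧ IsLegendrian σ Z p := by
  obtain ⟨γ, hγ, hode, hi⟩ := mem_classL_iff.1 h
  obtain ⟨σ, hσ, hL⟩ := exists_symplectic hγ.1 hode hi
  refine ⟨σ, hσ, (hγ.isLegendrian_iff hσ.1).2 ?_⟩
  filter_upwards [hL] with t ht
  simpa [pairing] using ht

/-- The germs with `r² = 9` or `r² = 1/9` have a Laguerre–Forsyth form with `q₀ = q₁ = 0`. -/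
theorem exists_flat_of_mem_classL (h : (Z, p) ∈ classL r) (hr : r ^ 2 = 9 ∨ r ^ 2 = 1 / 9) :
    ∃ γ : ℂ → V4, IsLocalParam γ Z p ∧ LinearIndependent ℂ (frame γ 0) ∧
      SolvesODE γ (fun _ => 0) (fun _ => 0) (fun _ => 0) := by
  obtain ⟨γ, hγ, hode, hi⟩ := mem_classL_iff.1 h
  obtain ⟨γ', w, h', -, hi', hode'⟩ := exists_laguerreForsyth hγ hode hi
  refine ⟨γ', h', hi', ?_⟩
  simpa [(quarticInv_model_eq_zero_iff r).2 hr] using hode'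

theorem finrank_aut_eq_four_of_mem_classL (h : (Z, p) ∈ classL r)
    (hr : r ^ 2 = 9 ∨ r ^ 2 = 1 / 9) (hσ : IsSymplectic σ) (hL : IsLegendrian σ Z p) :
    Module.finrank ℂ (aut σ Z p) = 4 := by
  obtain ⟨γ, hγ, hi, hode⟩ := exists_flat_of_mem_classL h hr
  exact finrank_aut_eq_four hσ hγ (hγ.pairing_eq_zero hσ.1 hL) hode hi

theorem finrank_aut_eq_two_of_mem_classL (h : (Z, p) ∈ classL r)
    (hr : ¬(r ^ 2 = 9 ∨ r ^ 2 = 1 / 9)) (hσ : IsSymplectic σ) (hL : IsLegendrian σ Z p) :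
    Module.finrank ℂ (aut σ Z p) = 2 := by
  obtain ⟨γ, hγ, hode, hi⟩ := mem_classL_iff.1 h
  exact finrank_aut_eq_two hσ hγ (hγ.pairing_eq_zero hσ.1 hL) hode hi
    (mt (quarticInv_model_eq_zero_iff r).1 hr)

theorem isHomogeneous_of_mem_classL (h : (Z, p) ∈ classL r) (hσ : IsSymplectic σ)
    (hL : IsLegendrian σ Z p) : IsHomogeneous σ Z p := by
  unfold IsHomogeneous
  by_cases hr : r ^ 2 = 9 ∨ r ^ 2 = 1 / 9
  · rw [finrank_aut_eq_four_of_mem_classL h hr hσ hL]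
    norm_num
  · exact (finrank_aut_eq_two_of_mem_classL h hr hσ hL).ge

theorem exists_isLaguerreForsyth_of_mem_classL (h : (Z, p) ∈ classL r) :
    ∃ (γ : ℂ → V4) (q₁ q₀ : ℂ → ℂ), IsLaguerreForsyth γ q₁ q₀ Z p := by
  obtain ⟨γ, hγ, hode, hi⟩ := mem_classL_iff.1 h
  obtain ⟨γ', w, h', hw, hi', hode'⟩ := exists_laguerreForsyth hγ hode hi
  refine ⟨γ', fun _ => 0, fun s => -((-r ^ 2 + 9 / 100 * (1 + r ^ 2) ^ 2) * w s ^ 4), h',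
    analyticAt_const, (analyticAt_const.mul (hw.pow 4)).neg, ?_⟩
  filter_upwards [hode'] with s hs
  rw [hs]
  simp

theorem laguerreForsyth_of_mem_classL (h : (Z, p) ∈ classL r) {γ : ℂ → V4} {q₁ q₀ : ℂ → ℂ}
    (hLF : IsLaguerreForsyth γ q₁ q₀ Z p) :
    (∀ᶠ t in 𝓝 (0 : ℂ), q₁ t = 0) ∧
      ((r ^ 2 = 9 ∨ r ^ 2 = 1 / 9) → ∀ᶠ t in 𝓝 (0 : ℂ), q₀ t = 0) ∧
      (¬(r ^ 2 = 9 ∨ r ^ 2 = 1 / 9) → ∀ᶠ t in 𝓝 (0 : ℂ), q₀ t ≠ 0 ∧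
        absInv q₀ t = -(r ^ 2 + 1) ^ 2 / ((r ^ 2 - 9) * (9 * r ^ 2 - 1))) := by
  obtain ⟨γ', hγ', hode, hi⟩ := mem_classL_iff.1 h
  obtain ⟨hq₁, w, y, hw0, hw, hy, hq₀⟩ := laguerreForsyth_coefficients hγ' hode hi hLF
  refine ⟨hq₁, fun hr => ?_, fun hr => ?_⟩
  · filter_upwards [hq₀] with s hs
    rw [hs, (quarticInv_model_eq_zero_iff r).2 hr]
    simp
  · filter_upwards [absInv_eq (mt (quarticInv_model_eq_zero_iff r).1 hr) hw0 hw hy hq₀] with s hs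
    refine ⟨hs.1, ?_⟩
    rw [hs.2, quarticInv_model, mul_div_cancel₀ _ (by norm_num), add_comm]

theorem classL_subset_of_sq_mul_sq_eq_one {r s : ℂ} (hrs : r ^ 2 * s ^ 2 = 1) :
    classL r ⊆ classL s := by
  rintro ⟨Z, p⟩ h
  obtain ⟨γ, hγ, hode, hi⟩ := mem_classL_iff.1 h
  have hs : s ≠ 0 := by rintro rfl; simp at hrs
  obtain ⟨γ', h', hi', hode'⟩ := hγ.exists_solvesODE_rescale hode hi hs
  refine mem_classL_iff.2 ⟨γ', h', ?_, hi'⟩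
  have e₂ : s ^ 2 * (1 + r ^ 2) = 1 + s ^ 2 := by linear_combination hrs
  have e₀ : s ^ 4 * -r ^ 2 = -s ^ 2 := by linear_combination -s ^ 2 * hrs
  rwa [e₂, e₀] at hode'

/-- The absolute invariant, or the vanishing of `q₀`, tells the classes apart. -/
theorem sq_eq_or_of_mem_classL {r s : ℂ} (hr : (Z, p) ∈ classL r) (hs : (Z, p) ∈ classL s) :
    r ^ 2 = s ^ 2 ∨ r ^ 2 * s ^ 2 = 1 := by
  obtain ⟨γ, q₁, q₀, hLF⟩ := exists_isLaguerreForsyth_of_mem_classL hr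
  obtain ⟨-, r1, r2⟩ := laguerreForsyth_of_mem_classL hr hLF
  obtain ⟨-, s1, s2⟩ := laguerreForsyth_of_mem_classL hs hLF
  by_cases er : r ^ 2 = 9 ∨ r ^ 2 = 1 / 9
  · by_cases es : s ^ 2 = 9 ∨ s ^ 2 = 1 / 9
    · rcases er with er | er <;> rcases es with es | es <;> rw [er, es] <;> norm_num
    · exact absurd (r1 er).self_of_nhds (s2 es).self_of_nhds.1
  · by_cases es : s ^ 2 = 9 ∨ s ^ 2 = 1 / 9
    · exact absurd (s1 es).self_of_nhds (r2 er).self_of_nhds.1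
    · have hne : ∀ x : ℂ, ¬(x ^ 2 = 9 ∨ x ^ 2 = 1 / 9) → (x ^ 2 - 9) * (9 * x ^ 2 - 1) ≠ 0 :=
        fun x hx hz => hx ((quarticInv_model_eq_zero_iff x).1 (by rw [quarticInv_model, hz]; simp))
      have hI := (r2 er).self_of_nhds.2.symm.trans (s2 es).self_of_nhds.2
      rw [div_eq_div_iff (hne r er) (hne s es)] at hI
      have h0 : (r ^ 2 - s ^ 2) * (r ^ 2 * s ^ 2 - 1) = 0 := by
        linear_combination hI / 100
      exact (mul_eq_zero.1 h0).imp sub_eq_zero.1 sub_eq_zero.1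

theorem classL_eq_iff {r s : ℂ} :
    classL r = classL s ↔ r ^ 2 = s ^ 2 ∨ r ^ 2 * s ^ 2 = 1 := by
  constructor
  · intro h
    obtain ⟨⟨Z, p⟩, hr⟩ := classL_nonempty r
    exact sq_eq_or_of_mem_classL hr (h ▸ hr)
  · rintro (h | h)
    · ext ⟨Z, p⟩
      rw [mem_classL_iff, mem_classL_iff, h]
    · exact (classL_subset_of_sq_mul_sq_eq_one h).antisymm
        (classL_subset_of_sq_mul_sq_eq_one (by rw [mul_comm, h]))

end members

/-! ### The rational normal curve -/

section rational_normal_curve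

theorem mem_classL_image {r : ℂ} {Z : Set P3} {p : P3} (h : (Z, p) ∈ classL r)
    (g : V4 ≃ₗ[ℂ] V4) : ((fun x : P3 => g • x) '' Z, g • p) ∈ classL r := by
  obtain ⟨γ, hγ, hode, hi⟩ := mem_classL_iff.1 h
  exact mem_classL_iff.2 ⟨_, hγ.linear_image g, hode.linear hγ.1 g.toLinearMap,
    linearIndependent_frame_linear hγ.1 hi g⟩

/-- The parametrization of the rational normal curve around the point with affine coordinate
`m`. -/
def cubicCurve (m t : ℂ) : V4 := ![1, m + t, (m + t) ^ 2, (m + t) ^ 3]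

theorem iteratedDeriv_cubicCurve (m : ℂ) :
    iteratedDeriv 1 (cubicCurve m) = (fun t => ![0, 1, 2 * (m + t), 3 * (m + t) ^ 2]) ∧
    iteratedDeriv 2 (cubicCurve m) = (fun t => ![0, 0, 2, 6 * (m + t)]) ∧
    iteratedDeriv 3 (cubicCurve m) = (fun _ => ![0, 0, 0, 6]) ∧
    iteratedDeriv 4 (cubicCurve m) = fun _ => 0 := by
  have hm : ∀ t, HasDerivAt (fun t : ℂ => m + t) 1 t := fun t => (hasDerivAt_id t).const_add m
  have h1 : iteratedDeriv 1 (cubicCurve m) = fun t => ![0, 1, 2 * (m + t), 3 * (m + t) ^ 2] := by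
    rw [iteratedDeriv_one]
    refine funext fun t => HasDerivAt.deriv (hasDerivAt_pi.2 fun i => ?_)
    fin_cases i
    · exact hasDerivAt_const t 1
    · exact hm t
    · exact ((hm t).pow 2).congr_deriv (by simp)
    · exact ((hm t).pow 3).congr_deriv (by simp)
  have h2 : iteratedDeriv 2 (cubicCurve m) = fun t => ![0, 0, 2, 6 * (m + t)] := by
    rw [iteratedDeriv_succ, h1]
    refine funext fun t => HasDerivAt.deriv (hasDerivAt_pi.2 fun i => ?_)
    fin_cases i
    · exact hasDerivAt_const t 0
    · exact hasDerivAt_const t 1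
    · simpa using (hm t).const_mul 2
    · refine (((hm t).pow 2).const_mul 3).congr_deriv ?_
      simp
      ring
  have h3 : iteratedDeriv 3 (cubicCurve m) = fun _ => ![0, 0, 0, 6] := by
    rw [iteratedDeriv_succ, h2]
    refine funext fun t => HasDerivAt.deriv (hasDerivAt_pi.2 fun i => ?_)
    fin_cases i
    · exact hasDerivAt_const t 0
    · exact hasDerivAt_const t 0
    · exact hasDerivAt_const t 2
    · simpa using (hm t).const_mul 6
  exact ⟨h1, h2, h3, by rw [iteratedDeriv_succ, h3]; simp⟩

theorem analyticAt_cubicCurve (m : ℂ) : AnalyticAt ℂ (cubicCurve m) 0 := by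
  refine AnalyticAt.pi fun i => ?_
  fin_cases i
  · exact analyticAt_const
  · exact analyticAt_const.add analyticAt_id
  · exact (analyticAt_const.add analyticAt_id).pow 2
  · exact (analyticAt_const.add analyticAt_id).pow 3

theorem linearIndependent_frame_cubicCurve (m : ℂ) :
    LinearIndependent ℂ (frame (cubicCurve m) 0) := by
  obtain ⟨h1, h2, h3, -⟩ := iteratedDeriv_cubicCurve m
  rw [Fintype.linearIndependent_iff]
  intro x hx
  have e0 : frame (cubicCurve m) 0 0 = ![1, m, m ^ 2, m ^ 3] := by simp [frame, cubicCurve]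
  have e1 : frame (cubicCurve m) 0 1 = ![0, 1, 2 * m, 3 * m ^ 2] := by
    exact (congrFun h1 0).trans (by simp)
  have e2 : frame (cubicCurve m) 0 2 = ![0, 0, 2, 6 * m] := by
    exact (congrFun h2 0).trans (by simp)
  have e3 : frame (cubicCurve m) 0 3 = ![0, 0, 0, 6] := congrFun h3 0
  rw [Fin.sum_univ_four, e0, e1, e2, e3] at hx
  have x0 : x 0 = 0 := by simpa using congrFun hx 0
  have x1 : x 1 = 0 := by simpa [x0] using congrFun hx 1
  have x2 : x 2 = 0 := by simpa [x0, x1] using congrFun hx 2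
  have x3 : x 3 = 0 := by simpa [x0, x1, x2] using congrFun hx 3
  intro i
  fin_cases i
  exacts [x0, x1, x2, x3]

theorem toP3_cubic_eq {a b : ℂ} (ha : a ≠ 0) (m : ℂ) :
    toP3 ![a ^ 3, a ^ 2 * b, a * b ^ 2, b ^ 3] = toP3 (cubicCurve m (b / a - m)) := by
  have h0 : cubicCurve m (b / a - m) ≠ 0 := fun h => by simpa [cubicCurve] using congrFun h 0
  rw [← toP3_smul h0 (pow_ne_zero 3 ha)]
  congr 1
  ext i
  fin_cases i <;> simp [cubicCurve] <;> field_simp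

theorem isLocalParam_cubicCurve (m : ℂ) :
    IsLocalParam (cubicCurve m) rationalNormalCurve (toP3 (cubicCurve m 0)) := by
  have hne : ∀ t, cubicCurve m t ≠ 0 := fun t h => by simpa [cubicCurve] using congrFun h 0
  refine ⟨analyticAt_cubicCurve m,
    linearIndependent_pair_of_frame (linearIndependent_frame_cubicCurve m), ?_⟩
  refine map_nhds_eq_of_left_inverse (ψ := fun v => v 1 / v 0 - m) (N := Set.univ)
    (analyticAt_cubicCurve m).continuousAt (hne 0) (fun c v hc => ?_) ?_ (by simp [cubicCurve])
    (fun t _ => ⟨by simp [cubicCurve], hne t⟩) ?_ (Eventually.of_forall fun t => ?_)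
  · simp [mul_div_mul_left _ _ hc]
  · refine (ContinuousAt.div (continuous_apply 1).continuousAt (continuous_apply 0).continuousAt
      ?_).sub continuousAt_const
    simp [cubicCurve]
  · have h0 : ∀ᶠ q in 𝓝 (toP3 (cubicCurve m 0)), ∃ v : V4, v 0 ≠ 0 ∧ q = toP3 v := by
      rw [nhds_toP3 (hne 0), eventually_map]
      have : ∀ᶠ v : V4 in 𝓝 (cubicCurve m 0), v 0 ≠ 0 :=
        (continuous_apply 0).continuousAt.eventually_ne (by simp [cubicCurve])
      filter_upwards [this] with v hv using ⟨v, hv, rfl⟩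
    filter_upwards [nhdsWithin_le_nhds h0, self_mem_nhdsWithin] with q ⟨v, hv, hqv⟩ ⟨a, b, hab, hq⟩
    have ha : a ≠ 0 := by
      rintro rfl
      have hb : b ≠ 0 := by simpa using hab
      have hv0 : v ≠ 0 := fun h => hv (by simp [h])
      have hw0 : (![0 ^ 3, 0 ^ 2 * b, 0 * b ^ 2, b ^ 3] : V4) ≠ 0 := fun h => by
        simpa [hb] using congrFun h 3
      obtain ⟨c, hc⟩ := (toP3_eq_toP3_iff hw0 hv0).1 (hq.symm.trans hqv)
      exact hv (by simp [← hc])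
    exact ⟨b / a - m, Set.mem_univ _, by rw [hq, toP3_cubic_eq ha m]⟩
  · exact ⟨1, m + t, Or.inl one_ne_zero, by simp [cubicCurve]⟩

theorem rationalNormalCurve_mem_classL {p : P3} (hp : p ∈ rationalNormalCurve) :
    (rationalNormalCurve, p) ∈ classL 3 := by
  have haff : ∀ m, (rationalNormalCurve, toP3 (cubicCurve m 0)) ∈ classL 3 := fun m => by
    refine (isLocalParam_cubicCurve m).mem_classL_three (Eventually.of_forall fun t => ?_)
      (linearIndependent_frame_cubicCurve m)
    simp [(iteratedDeriv_cubicCurve m).2.2.2]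
  obtain ⟨a, b, hab, rfl⟩ := hp
  by_cases ha : a = 0
  · -- The point at infinity is exchanged with `[1 : 0 : 0 : 0]` by reversing the coordinates.
    subst ha
    have hb : b ≠ 0 := by simpa using hab
    let g : V4 ≃ₗ[ℂ] V4 := LinearEquiv.funCongrLeft ℂ ℂ Fin.revPerm
    have hg : ∀ x y z w : ℂ, g ![x, y, z, w] = ![w, z, y, x] := fun x y z w => by
      ext i
      fin_cases i <;> rfl
    have hgt : ∀ x y : ℂ, (x ≠ 0 ∨ y ≠ 0) → g • toP3 ![x ^ 3, x ^ 2 * y, x * y ^ 2, y ^ 3] =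
        toP3 ![y ^ 3, y ^ 2 * x, y * x ^ 2, x ^ 3] := fun x y hxy => by
      have h0 : (![x ^ 3, x ^ 2 * y, x * y ^ 2, y ^ 3] : V4) ≠ 0 := fun h => by
        rcases hxy with hx | hy
        · simpa [hx] using congrFun h 0
        · simpa [hy] using congrFun h 3
      rw [smul_toP3 g h0, hg, mul_comm x, mul_comm (x ^ 2)]
    have hZ : (fun x : P3 => g • x) '' rationalNormalCurve = rationalNormalCurve := by
      ext q
      constructor
      · rintro ⟨_, ⟨x, y, hxy, rfl⟩, rfl⟩
        exact ⟨y, x, hxy.symm, hgt x y hxy⟩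
      · rintro ⟨x, y, hxy, rfl⟩
        exact ⟨_, ⟨y, x, hxy.symm, rfl⟩, hgt y x hxy.symm⟩
    have h := mem_classL_image (haff 0) g
    have h0 : toP3 (cubicCurve 0 0) = toP3 ![b ^ 3, b ^ 2 * 0, b * 0 ^ 2, 0 ^ 3] := by
      rw [toP3_cubic_eq hb 0]
      simp
    rwa [hZ, h0, hgt b 0 (Or.inl hb)] at h
  · have h := haff (b / a)
    rwa [toP3_cubic_eq ha (b / a), sub_self]

end rational_normal_curve

/-! ### Homogeneous germs -/

/-- The integral curve of a nonvanishing vector field on the line: the inverse function of a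
primitive of `1 / β`. -/
theorem exists_integral_curve {β : ℂ → ℂ} (hβ : AnalyticAt ℂ β 0) (hβ0 : β 0 ≠ 0) :
    ∃ τ : ℂ → ℂ, τ 0 = 0 ∧ HasDerivNear τ (fun s => β (τ s)) := by
  obtain ⟨G, hG0, hG⟩ := exists_primitive (hβ.inv hβ0)
  have hGa := hG.analyticAt
  have hd : deriv G 0 ≠ 0 := by
    rw [hG.self_of_nhds.deriv]
    exact inv_ne_zero hβ0
  let τ := hGa.hasStrictDerivAt.localInverse _ _ _ hd
  have hτ0 : τ 0 = 0 := by
    have := (HasStrictDerivAt.eventually_left_inverse hGa.hasStrictDerivAt hd).self_of_nhds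
    rwa [hG0] at this
  have hτ : AnalyticAt ℂ τ 0 := by
    have := hGa.analyticAt_localInverse hd
    rwa [hG0] at this
  have hinv : ∀ᶠ s in 𝓝 0, G (τ s) = s := by
    have := HasStrictDerivAt.eventually_right_inverse hGa.hasStrictDerivAt hd
    rwa [hG0] at this
  refine ⟨τ, hτ0, (hasDerivNear_deriv hτ).congr_right ?_⟩
  have hne : ∀ᶠ s in 𝓝 0, β (τ s) ≠ 0 :=
    ((hasDerivNear_deriv hτ).tendsto_zero hτ0).eventually (hβ.continuousAt.eventually_ne hβ0)
  filter_upwards [(hG.comp_mul (hasDerivNear_deriv hτ) hτ0).unique HasDerivNear.id hinv, hne]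
    with s hs hn
  simp only [Pi.inv_apply] at hs
  field_simp at hs
  exact hs.symm

section homogeneous

variable {σ : LinearMap.BilinForm ℂ V4} {γ : ℂ → V4} {Z : Set P3} {p : P3} {c₂ c₀ : ℂ → ℂ}

/-- A suitable rescaling makes `σ(γ', γ'')` constant. -/
theorem IsLocalParam.exists_pairing_const (h : IsLocalParam γ Z p) (hσ : σ.IsAlt)
    (hL : ∀ᶠ t in 𝓝 0, pairing σ γ 0 1 t = 0) (h12 : pairing σ γ 1 2 0 ≠ 0) :
    ∃ (γ' : ℂ → V4) (a : ℂ), IsLocalParam γ' Z p ∧ (∀ᶠ t in 𝓝 0, pairing σ γ' 0 1 t = 0) ∧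
      a ≠ 0 ∧ ∀ᶠ t in 𝓝 0, pairing σ γ' 1 2 t = a := by
  have hP := hasDerivNear_deriv (hasDerivNear_pairing (σ := σ) h.1 1 2).analyticAt
  obtain ⟨f, hf0, hf⟩ := exists_exp_primitive
    (g := fun t => -(1 / 2) * (deriv (pairing σ γ 1 2) t * (pairing σ γ 1 2 t)⁻¹))
    (analyticAt_const.mul (hP.analyticAt_right.mul (hP.analyticAt.inv h12)))
  have hf0' : f 0 ≠ 0 := by rw [hf0]; exact one_ne_zero
  have hrep := pairing_reparam hσ h.1 hL hf.analyticAt HasDerivNear.id rfl EventuallyEq.rfl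
  have hconst := ((hf.pow 2).mul hP).eventually_const (by
    filter_upwards [hP.analyticAt.continuousAt.eventually_ne h12] with t ht
    push_cast
    field_simp
    ring)
  refine ⟨fun t => f t • γ t, f 0 ^ 2 * pairing σ γ 1 2 0,
    h.reparam hf.analyticAt hf0' HasDerivNear.id rfl one_ne_zero, hrep.1,
    mul_ne_zero (pow_ne_zero 2 hf0') h12, ?_⟩
  filter_upwards [hrep.2, hconst] with t h1 h2
  rw [h1, ← h2]
  ring

/-- Straightening: if a linear map moves the curve along a nonvanishing vector field, then in the
time parameter of this vector field the equation of the curve has constant coefficients. -/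
theorem IsLocalParam.exists_const_solvesODE (h : IsLocalParam γ Z p) (hσ : IsSymplectic σ)
    (hL : ∀ᶠ t in 𝓝 0, pairing σ γ 0 1 t = 0) {a : ℂ} (ha : a ≠ 0)
    (h12 : ∀ᶠ t in 𝓝 0, pairing σ γ 1 2 t = a) {v : Module.End ℂ V4} {β : ℂ → ℂ}
    (hβ : AnalyticAt ℂ β 0) (hβ0 : β 0 ≠ 0) (hv : ∀ᶠ t in 𝓝 0, v (γ t) = motion γ β t) :
    ∃ (γ' : ℂ → V4) (b₂ b₀ : ℂ), IsLocalParam γ' Z p ∧ LinearIndependent ℂ (frame γ' 0) ∧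
      SolvesODE γ' (fun _ => b₂) (fun _ => 0) (fun _ => b₀) := by
  obtain ⟨τ, hτ0, hτ⟩ := exists_integral_curve hβ hβ0
  have hβτ := (hasDerivNear_deriv hβ).comp_mul hτ hτ0
  have hβτ' := (hasDerivNear_deriv hβ.deriv).comp_mul hτ hτ0
  obtain ⟨f, hf0, hf⟩ := exists_exp_primitive (g := fun s => -(3 / 2) * deriv β (τ s))
    (analyticAt_const.mul hβτ'.analyticAt)
  have hf0' : f 0 ≠ 0 := by rw [hf0]; exact one_ne_zero
  have hw0 : β (τ 0) ≠ 0 := by rwa [hτ0]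
  have h' := h.reparam hf.analyticAt hf0' hτ hτ0 hw0
  set δ : ℂ → V4 := fun s => f s • γ (τ s) with hδ
  have hrep := pairing_reparam hσ.1 h.1 hL hf.analyticAt hτ hτ0 (γ' := δ) EventuallyEq.rfl
  have hconst : ∀ᶠ s in 𝓝 0, pairing σ δ 1 2 s = f 0 ^ 2 * β (τ 0) ^ 3 * a := by
    have h0 := ((hf.pow 2).mul (hβτ.pow 3)).eventually_const (Eventually.of_forall fun s => by
      push_cast
      ring)
    filter_upwards [h0, hrep.2, (hτ.tendsto_zero hτ0).eventually h12] with s h1 h2 h3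
    rw [h2, h3, h1]
  have hne : f 0 ^ 2 * β (τ 0) ^ 3 * a ≠ 0 :=
    mul_ne_zero (mul_ne_zero (pow_ne_zero 2 hf0') (pow_ne_zero 3 hw0)) ha
  have hi' : LinearIndependent ℂ (frame δ 0) := linearIndependent_frame_zero hσ h'.1 hrep.1
    (by rw [hconst.self_of_nhds]; exact hne)
  obtain ⟨b₂, b₀, hb₂, hb₀, hode⟩ := exists_solvesODE hσ h'.1 hrep.1 hne hconst
  have hvδ : (motion δ fun _ => 1) =ᶠ[𝓝 0] fun s => v (δ s) := by
    filter_upwards [hf.smul ((hasDerivNear_deriv h.1).comp hτ hτ0),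
      (hτ.tendsto_zero hτ0).eventually hv] with s h1 h2
    have h3 : deriv δ s = _ := h1.deriv
    rw [motion, h3, hδ]
    simp only [deriv_const, map_smul, h2, motion]
    module
  obtain ⟨e₂, eQ⟩ := equations_of_solvesODE_motion h'.1 analyticAt_const hb₂ hb₀ hode hi'
    ((hode.linear h'.1 v).congr hvδ)
  have d₂ : ∀ᶠ s in 𝓝 0, deriv b₂ s = 0 := by
    filter_upwards [e₂] with s hs
    simpa [iteratedDeriv_const] using hs.symm
  have d₂' : ∀ᶠ s in 𝓝 0, iteratedDeriv 3 b₂ s = 0 := by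
    have h2 := (hasDerivNear_deriv hb₂.deriv).unique (HasDerivNear.const 0) d₂
    have h3 := (hasDerivNear_deriv hb₂.deriv.deriv).unique (HasDerivNear.const 0) h2
    simp only [iteratedDeriv_succ, iteratedDeriv_zero]
    exact h3
  have d₀ : ∀ᶠ s in 𝓝 0, deriv b₀ s = 0 := by
    filter_upwards [eQ, eventually_deriv_quarticInv hb₂ hb₀, d₂, d₂'] with s h1 h2 h3 h4
    rw [h2, h3, h4] at h1
    simpa using h1
  refine ⟨δ, b₂ 0, b₀ 0, h', hi', ?_⟩
  filter_upwards [hode, (hasDerivNear_deriv hb₂).eventually_const d₂,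
    (hasDerivNear_deriv hb₀).eventually_const d₀, d₂] with s h1 h2 h3 h4
  rw [h1, h2, h3, h4]

/-- If the invariant `Q` vanishes, then the quadratic covariant `3 F F'' - 2 F'² - (9/10) c₂ F²`
of a component `F` of `γ` is a vector field that preserves the equation. -/
theorem exists_motion_of_quarticInv_eq_zero (hγ : AnalyticAt ℂ γ 0) (hc₂ : AnalyticAt ℂ c₂ 0)
    (hc₀ : AnalyticAt ℂ c₀ 0) (hode : SolvesODE γ c₂ (deriv c₂) c₀)
    (hi : LinearIndependent ℂ (frame γ 0)) (hQ : quarticInv c₂ c₀ =ᶠ[𝓝 0] fun _ => 0) :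
    ∃ y : ℂ → ℂ, AnalyticAt ℂ y 0 ∧ y 0 ≠ 0 ∧ SolvesODE (motion γ y) c₂ (deriv c₂) c₀ := by
  obtain ⟨ℓ, hℓ⟩ := exists_dual_family hi
  -- The component vanishing at `0` to first order makes `y 0` nonzero.
  let F : ℕ → ℂ → ℂ := fun k t => ℓ 1 (iteratedDeriv k γ t)
  have hF : ∀ k, HasDerivNear (F k) (F (k + 1)) := fun k =>
    (hasDerivNear_iteratedDeriv hγ k).linear (ℓ 1)
  have hF4 : ∀ᶠ t in 𝓝 0, F 4 t = c₂ t * F 2 t + deriv c₂ t * F 1 t + c₀ t * F 0 t := by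
    filter_upwards [hode] with t ht
    simp [F, ht]
  have hc := fun k => hasDerivNear_iteratedDeriv hc₂ k
  have hF0 : F 0 0 = 0 := by simpa [F, frame] using hℓ 1 0
  have hF1 : F 1 0 = 1 := by simpa [F, frame] using hℓ 1 1
  have hc₀' : ∀ᶠ t in 𝓝 0, c₀ t = -9 / 100 * c₂ t ^ 2 + 3 / 10 * iteratedDeriv 2 c₂ t := by
    filter_upwards [hQ] with t ht
    rw [quarticInv] at ht
    linear_combination ht
  have d0 : HasDerivNear (fun t => 3 * (F 0 t * F 2 t) - 2 * F 1 t ^ 2 -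
      9 / 10 * (c₂ t * F 0 t ^ 2)) _ :=
    ((((hF 0).mul (hF 2)).const_mul 3).sub (((hF 1).pow 2).const_mul 2)).sub
      (((hasDerivNear_deriv hc₂).mul ((hF 0).pow 2)).const_mul (9 / 10))
  set y : ℂ → ℂ := fun t => 3 * (F 0 t * F 2 t) - 2 * F 1 t ^ 2 -
      9 / 10 * (c₂ t * F 0 t ^ 2) with hy
  have hya := d0.analyticAt
  have i1 : iteratedDeriv 1 y =ᶠ[𝓝 0] fun t => 3 * (F 0 t * F 3 t) - F 1 t * F 2 t -
      9 / 10 * (iteratedDeriv 1 c₂ t * F 0 t ^ 2) -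
      9 / 5 * (iteratedDeriv 0 c₂ t * (F 0 t * F 1 t)) := by
    refine (eventuallyEq_iteratedDeriv_succ hya (by simp) d0).trans (Eventually.of_forall fun t => ?_)
    simp
    ring
  have d1 := (((((hF 0).mul (hF 3)).const_mul 3).sub ((hF 1).mul (hF 2))).sub
    (((hc 1).mul ((hF 0).pow 2)).const_mul (9 / 10))).sub
    (((hc 0).mul ((hF 0).mul (hF 1))).const_mul (9 / 5))
  have i2 : iteratedDeriv 2 y =ᶠ[𝓝 0] fun t => 2 * (F 1 t * F 3 t) - F 2 t ^ 2 +
      6 / 5 * (iteratedDeriv 0 c₂ t * (F 0 t * F 2 t)) -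
      3 / 5 * (iteratedDeriv 1 c₂ t * (F 0 t * F 1 t)) -
      27 / 100 * (iteratedDeriv 0 c₂ t ^ 2 * F 0 t ^ 2) -
      9 / 5 * (iteratedDeriv 0 c₂ t * F 1 t ^ 2) := by
    refine (eventuallyEq_iteratedDeriv_succ hya i1 d1).trans ?_
    filter_upwards [hF4, hc₀'] with t h4 h0
    simp only [Nat.reduceAdd, h4, h0, iteratedDeriv_zero, iteratedDeriv_one]
    push_cast
    ring
  have d2 := ((((((hF 1).mul (hF 3)).const_mul 2).sub ((hF 2).pow 2)).add
    (((hc 0).mul ((hF 0).mul (hF 2))).const_mul (6 / 5))).sub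
    (((hc 1).mul ((hF 0).mul (hF 1))).const_mul (3 / 5))).sub
    ((((hc 0).pow 2).mul ((hF 0).pow 2)).const_mul (27 / 100))
  have d2' := d2.sub (((hc 0).mul ((hF 1).pow 2)).const_mul (9 / 5))
  have i3 := eventuallyEq_iteratedDeriv_succ hya i2 d2'
  refine ⟨y, hya, by simp [hy, hF0, hF1], solvesODE_motion_of_equations hγ hya hc₂ hc₀ hode ?_ ?_⟩
  · filter_upwards [i1, i3, hF4, hc₀'] with t h1 h3 h4 h0
    rw [← iteratedDeriv_one, h1, h3]
    simp only [Nat.reduceAdd, h4, h0, iteratedDeriv_zero, iteratedDeriv_one, hy]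
    push_cast
    ring
  · filter_upwards [hQ, hQ.deriv] with t h1 h2
    simp [h1, h2]

/-- A vector field that preserves the quartic differential `Q dt⁴` and vanishes at a point, but not
identically, forces `Q` to vanish: `β⁴ Q` is constant. -/
theorem eventually_eq_zero_of_vanishing_motion {β Q : ℂ → ℂ} (hβ : AnalyticAt ℂ β 0)
    (hQ : AnalyticAt ℂ Q 0) (hβ0 : β 0 = 0) (hne : ¬∀ᶠ t in 𝓝 0, β t = 0)
    (h : ∀ᶠ t in 𝓝 0, 4 * deriv β t * Q t + β t * deriv Q t = 0) : ∀ᶠ t in 𝓝 0, Q t = 0 := by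
  have hconst := (((hasDerivNear_deriv hβ).pow 4).mul (hasDerivNear_deriv hQ)).eventually_const (by
    filter_upwards [h] with t ht
    push_cast
    linear_combination β t ^ 3 * ht)
  have hβne := hβ.eventually_eq_zero_or_eventually_ne_zero.resolve_left hne
  refine hQ.eventually_eq_zero_or_eventually_ne_zero.resolve_right fun hQne => ?_
  obtain ⟨t, h1, h2, h3⟩ := (hβne.and (hQne.and (nhdsWithin_le_nhds hconst))).exists
  rw [hβ0] at h3
  exact mul_ne_zero (pow_ne_zero 4 h1) h2 (by simpa using h3)

theorem IsLocalParam.exists_mem_classL_of_mem_aut (h : IsLocalParam γ Z p) (hσ : IsSymplectic σ)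
    (hL : ∀ᶠ t in 𝓝 0, pairing σ γ 0 1 t = 0) (h12 : pairing σ γ 1 2 0 ≠ 0)
    {u : Module.End ℂ V4} (hu : u ∈ aut σ Z p) (hu1 : ∀ c : ℂ, u ≠ c • 1) :
    ∃ r : ℂ, (Z, p) ∈ classL r := by
  obtain ⟨δ, a, h', hL', ha, h12'⟩ := h.exists_pairing_const hσ.1 hL h12
  obtain ⟨c₂, c₀, hc₂, hc₀, hode⟩ := exists_solvesODE hσ h'.1 hL' ha h12'
  have hi := linearIndependent_frame_zero hσ h'.1 hL' (by rw [h12'.self_of_nhds]; exact ha)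
  obtain ⟨c, β, hβ, huβ, hm⟩ := exists_motion_of_mem_aut hσ h' hL' hode hi hu
  obtain ⟨v, y, hy, hy0, hv⟩ : ∃ (v : Module.End ℂ V4) (y : ℂ → ℂ), AnalyticAt ℂ y 0 ∧ y 0 ≠ 0 ∧
      ∀ᶠ t in 𝓝 0, v (δ t) = motion δ y t := by
    by_cases hβ0 : β 0 = 0
    · have hne : ¬∀ᶠ t in 𝓝 0, β t = 0 := fun hz => by
        have hz' : β =ᶠ[𝓝 0] fun _ => 0 := hz
        refine hu1 c (sub_eq_zero.1 (eq_zero_of_apply_curve h'.1 hi ?_))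
        filter_upwards [huβ, motion_congr (γ := δ) hz'] with t h1 h2
        rw [LinearMap.sub_apply, h1, h2]
        simp [motion]
      have hQ := eventually_eq_zero_of_vanishing_motion hβ (analyticAt_quarticInv hc₂ hc₀) hβ0 hne
        (equations_of_solvesODE_motion h'.1 hβ hc₂ hc₀ hode hi hm).2
      obtain ⟨y, hy, hy0, hym⟩ := exists_motion_of_quarticInv_eq_zero h'.1 hc₂ hc₀ hode hi hQ
      obtain ⟨v, -, hv⟩ := exists_mem_aut_of_motion hσ h' hL' hc₂ hc₀ hode hi hy hym
      exact ⟨v, y, hy, hy0, hv⟩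
    · refine ⟨u - c • 1, β, hβ, hβ0, ?_⟩
      filter_upwards [huβ] with t ht
      simp [ht]
  obtain ⟨γ', b₂, b₀, hγ', hi', hode'⟩ := h'.exists_const_solvesODE hσ hL' ha h12' hy hy0 hv
  exact hγ'.exists_mem_classL hode' hi'

theorem exists_mem_aut_ne_smul_one (hH : IsHomogeneous σ Z p) :
    ∃ u ∈ aut σ Z p, ∀ c : ℂ, u ≠ c • 1 := by
  by_contra! hcon
  have hle : aut σ Z p ≤ Submodule.span ℂ {1} := fun u hu => by
    obtain ⟨c, hc⟩ := hcon u hu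
    exact Submodule.mem_span_singleton.2 ⟨c, hc.symm⟩
  have h1 := (Submodule.finrank_mono hle).trans (finrank_span_le_card (R := ℂ) _)
  have h2 : 2 ≤ Module.finrank ℂ (aut σ Z p) := hH
  simp at h1
  omega

theorem exists_mem_classL_of_osculatingFull (hσ : IsSymplectic σ) (hZ : IsCurveGerm Z p)
    (hLeg : IsLegendrian σ Z p) (hH : IsHomogeneous σ Z p) (hO : OsculatingFull Z p 3) :
    ∃ r : ℂ, (Z, p) ∈ classL r := by
  obtain ⟨γ, h⟩ := hZ
  obtain ⟨u, hu, hu1⟩ := exists_mem_aut_ne_smul_one hH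
  have hL := h.pairing_eq_zero hσ.1 hLeg
  exact h.exists_mem_classL_of_mem_aut hσ hL (pairing_one_two_zero_ne_zero hσ h.1 hL
    ((derivSpan_three_eq_top_iff γ).1 ((h.osculatingFull_iff 3).1 hO))) hu hu1

/-- Osculation fails only at isolated points: at the zeros of `σ(γ', γ'')`. -/
theorem eventually_exists_mem_classL (hσ : IsSymplectic σ) (hZ : IsCurveGerm Z p)
    (hLeg : IsLegendrian σ Z p) (hN : IsNondegenerate Z p) (hH : IsHomogeneous σ Z p) :
    ∀ᶠ q in 𝓝[Z \ {p}] p, ∃ r : ℂ, (Z, q) ∈ classL r := by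
  obtain ⟨γ, h⟩ := hZ
  obtain ⟨k, -, hk⟩ := hN
  obtain ⟨u, hu, hu1⟩ := exists_mem_aut_ne_smul_one hH
  have hL := h.pairing_eq_zero hσ.1 hLeg
  have h12 : ∀ᶠ t in 𝓝[≠] 0, pairing σ γ 1 2 t ≠ 0 :=
    (hasDerivNear_pairing h.1 1 2).analyticAt.eventually_eq_zero_or_eventually_ne_zero.resolve_left
      fun hz => derivSpan_ne_top hσ h.1 h.2.1 hL hz k ((h.osculatingFull_iff k).1 hk)
  have hLeg' := h.eventually_nhdsWithin_iff.1 (eventually_eventually_nhdsWithin.2 hLeg)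
  have hu' := h.eventually_nhdsWithin_iff.1 (eventually_eventually_nhdsWithin.2 hu.2)
  have hall : ∀ᶠ q in 𝓝[Z] p, q ≠ p → ∃ r : ℂ, (Z, q) ∈ classL r := by
    refine h.eventually_nhdsWithin_iff.2 ?_
    filter_upwards [eventually_nhdsWithin_iff.1 h12, h.eventually_translate, hLeg', hu']
      with t h1 h2 h3 h4 hq
    have ht : t ≠ 0 := by
      rintro rfl
      exact hq h.eq_toP3.symm
    refine h2.exists_mem_classL_of_mem_aut hσ (h2.pairing_eq_zero hσ.1 h3) ?_ ⟨hu.1, h4⟩ hu1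
    have h5 : pairing σ (fun s => γ (t + s)) 1 2 0 = pairing σ γ 1 2 t := by
      simp only [pairing, iteratedDeriv_comp_const_add, add_zero]
    rw [h5]
    exact h1 ht
  filter_upwards [nhdsWithin_mono p Set.sdiff_subset hall, self_mem_nhdsWithin] with q h1 h2
  exact h1 h2.2

end homogeneous

end LegendrianCurve

theorem theorem2p10 :
    -- each class is nonempty and consists of homogeneous nondegenerate Legendrian germs
    (∀ r : ℂ, (classL r).Nonempty ∧
      ∀ (Z : Set P3) (p : P3), (Z, p) ∈ classL r →
        IsCurveGerm Z p ∧ OsculatingFull Z p 3 ∧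
        ∃ σ : LinearMap.BilinForm ℂ V4,
          IsSymplectic σ ∧ IsLegendrian σ Z p ∧ IsHomogeneous σ Z p) ∧
    -- the classes cover all homogeneous nondegenerate Legendrian germs
    (∀ (σ : LinearMap.BilinForm ℂ V4) (Z : Set P3) (p : P3),
      IsSymplectic σ → IsCurveGerm Z p → IsLegendrian σ Z p → IsNondegenerate Z p →
      IsHomogeneous σ Z p →
        (OsculatingFull Z p 3 → ∃ r : ℂ, (Z, p) ∈ classL r) ∧
        (∀ᶠ q in 𝓝[Z \ {p}] p, ∃ r : ℂ, (Z, q) ∈ classL r)) ∧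
    -- the coincidences between the classes
    (∀ r s : ℂ, classL r = classL s ↔ (r ^ 2 = s ^ 2 ∨ r ^ 2 * s ^ 2 = 1)) ∧
    -- dimension of the symmetry algebra
    (∀ (r : ℂ) (Z : Set P3) (p : P3), (Z, p) ∈ classL r →
      ∀ σ : LinearMap.BilinForm ℂ V4, IsSymplectic σ → IsLegendrian σ Z p →
        ((r ^ 2 = 9 ∨ r ^ 2 = 1 / 9) → Module.finrank ℂ (aut σ Z p) = 4) ∧
        (¬ (r ^ 2 = 9 ∨ r ^ 2 = 1 / 9) → Module.finrank ℂ (aut σ Z p) = 2)) ∧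
    -- Laguerre–Forsyth forms, the relative invariant `q₀` and the absolute invariant
    (∀ (r : ℂ) (Z : Set P3) (p : P3), (Z, p) ∈ classL r →
      (∃ (γ : ℂ → V4) (q₁ q₀ : ℂ → ℂ), IsLaguerreForsyth γ q₁ q₀ Z p) ∧
      ∀ (γ : ℂ → V4) (q₁ q₀ : ℂ → ℂ), IsLaguerreForsyth γ q₁ q₀ Z p →
        (∀ᶠ t in 𝓝 (0 : ℂ), q₁ t = 0) ∧
        ((r ^ 2 = 9 ∨ r ^ 2 = 1 / 9) → ∀ᶠ t in 𝓝 (0 : ℂ), q₀ t = 0) ∧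
        (¬ (r ^ 2 = 9 ∨ r ^ 2 = 1 / 9) → ∀ᶠ t in 𝓝 (0 : ℂ), q₀ t ≠ 0 ∧
          absInv q₀ t = -(r ^ 2 + 1) ^ 2 / ((r ^ 2 - 9) * (9 * r ^ 2 - 1)))) ∧
    -- the class of the rational normal curve
    (∀ p ∈ rationalNormalCurve, (rationalNormalCurve, p) ∈ classL 3) := by
  refine ⟨fun r => ⟨classL_nonempty r, fun Z p h => ?_⟩, fun σ Z p hσ hZ hL hN hH =>
    ⟨exists_mem_classL_of_osculatingFull hσ hZ hL hH,
      eventually_exists_mem_classL hσ hZ hL hN hH⟩, fun r s => classL_eq_iff,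
    fun r Z p h σ hσ hL => ⟨fun hr => finrank_aut_eq_four_of_mem_classL h hr hσ hL,
      fun hr => finrank_aut_eq_two_of_mem_classL h hr hσ hL⟩,
    fun r Z p h => ⟨exists_isLaguerreForsyth_of_mem_classL h, fun γ q₁ q₀ hLF =>
      laguerreForsyth_of_mem_classL h hLF⟩, fun p hp => rationalNormalCurve_mem_classL hp⟩
  obtain ⟨σ, hσ, hL⟩ := exists_isLegendrian_of_mem_classL h
  exact ⟨isCurveGerm_of_mem_classL h, osculatingFull_of_mem_classL h, σ, hσ, hL,
    isHomogeneous_of_mem_classL h hσ hL⟩
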